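/- Let $k$ be a field and $H$ a Hopf algebra over $k$ with bijective antipode $S$. All coalgebras are coassociative counital $k$-coalgebras, and Sweedler notation is used. **Partial corepresentations and $H^{par}$.** A linear map $\omega\colon D\to H$ from a coalgebra $D$ is a *partial corepresentation* if for all $d\in D$ $$\epsilon_H(\omega(d))=\epsilon_D(d),$$ $$\omega(d_{(1)})_{(1)}\otimes\omega(d_{(1)})_{(2)}S(\omega(d_{(2)}))=\omega(d_{(1)})\otimes\omega(d_{(2)})S(\omega(d_{(3)})),$$ $$\omega(d_{(1)})S(\omega(d_{(2)})_{(1)})\otimes\omega(d_{(2)})_{(2)}=\omega(d_{(1)})S(\omega(d_{(2)}))\otimes\omega(d_{(3)}).$$ Let $(C(H),p)$ be the cofree coalgebra on the vector space $H$, and let $H^{par}\subseteq C(H)$ be the sum of all subcoalgebras $X\subseteq C(H)$ such that $p|_X$ is a partial corepresentation. Thus every partial corepresentation $\omega\colon D\to H$ factors through a unique coalgebra map $\overline\omega\colon D\to H^{par}$ with $p\circ\overline\omega=\omega$. Put $E\colon H^{par}\to H$, $E(x)=p(x_{(1)})S(p(x_{(2)}))$, let $\overline E\colon H^{par}\to C(H)$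 be the unique coalgebra map with $p\circ\overline E=E$, and let $C=\overline E(H^{par})$ be the *base coalgebra*. **Partial cosmash coproduct.** A coalgebra $D$ is a *left partial $H$-comodule coalgebra* if it carries a linear map $\lambda\colon D\to H\otimes D$, $\lambda(d)=d^{[-1]}\otimes d^{[0]}$, such that, with $\nabla(d)=d^{[-1]}\epsilon(d^{[0]})$, $$d^{[-1]}\otimes d^{[0]}{}_{(1)}\otimes d^{[0]}{}_{(2)}=d_{(1)}{}^{[-1]}d_{(2)}{}^{[-1]}\otimes d_{(1)}{}^{[0]}\otimes d_{(2)}{}^{[0]},\qquad \epsilon(d^{[-1]})d^{[0]}=d,$$ $$d^{[-1]}\otimes d^{[0][-1]}\otimes d^{[0][0]}=\nabla(d_{(1)})\,d_{(2)}{}^{[-1]}{}_{(1)}\otimes d_{(2)}{}^{[-1]}{}_{(2)}\otimes d_{(2)}{}^{[0]}=d_{(1)}{}^{[-1]}{}_{(1)}\nabla(d_{(2)})\otimes d_{(1)}{}^{[-1]}{}_{(2)}\otimes d_{(1)}{}^{[0]}.$$ The partial cosmash coproduct $\underline{D>\!\!\blacktriangleleft H}$ is then the subspace of $D\otimes H$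 spanned by the elements $d>\!\!\blacktriangleleft h:=d_{(1)}\otimes\nabla(d_{(2)})h$ ($d\in D$, $h\in H$), which is a coalgebra with $$\underline\Delta(d>\!\!\blacktriangleleft h)=\bigl(d_{(1)}>\!\!\blacktriangleleft d_{(2)}{}^{[-1]}h_{(1)}\bigr)\otimes\bigl(d_{(2)}{}^{[0]}>\!\!\blacktriangleleft h_{(2)}\bigr),\qquad \underline\epsilon(d>\!\!\blacktriangleleft h)=\epsilon(d)\epsilon(h).$$ **Theorem.** There is a (necessarily unique) linear map $\lambda\colon C\to H\otimes C$ with $$\lambda(\overline E(x))=p(x_{(1)})S(p(x_{(3)}))\otimes\overline E(x_{(2)})\qquad(x\in H^{par}),$$ and it makes the base coalgebra $C$ a left partial $H$-comodule coalgebra. For the corresponding partial cosmash coproduct, the linear map $\omega_0\colon\underline{C>\!\!\blacktriangleleft H}\to H$, $\omega_0(c>\!\!\blacktriangleleft h)=\nabla(c)h$, is a partial corepresentation, and $$\Phi\colon H^{par}\to\underline{C>\!\!\blacktriangleleft H},\qquad \Phi(x)=\overline E(x_{(1)})>\!\!\blacktriangleleft p(x_{(2)}),$$ is an isomorphism of coalgebras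 whose inverse is $\overline\omega_0$, the unique coalgebra map $\underline{C>\!\!\blacktriangleleft H}\to H^{par}$ with $p\circ\overline\omega_0=\omega_0$. -/

import Mathlib

open scoped TensorProduct
open Coalgebra

namespace HopfPar

universe u v w x

noncomputable section

set_option linter.unusedSectionVars false

section Subcoalgebra

variable {k : Type u} {D : Type v} [Field k] [AddCommGroup D] [Module k D] [Coalgebra k D]

/-- A subcoalgebra of `D`: a subspace `S` with `Δ(S) ⊆ S ⊗ S` (the image of `S ⊗ S` in `D ⊗ D`). -/
structure Subcoalgebra (k : Type u) (D : Type v) [Field k] [AddCommGroup D] [Module k D]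
    [Coalgebra k D] where
  toSubmodule : Submodule k D
  comul_mem : ∀ x ∈ toSubmodule, comul (R := k) x ∈
    LinearMap.range (TensorProduct.map toSubmodule.subtype toSubmodule.subtype)

theorem map_injective {M N M' N' : Type*} [AddCommGroup M] [Module k M] [AddCommGroup N]
    [Module k N] [AddCommGroup M'] [Module k M'] [AddCommGroup N'] [Module k N']
    {f : M →ₗ[k] M'} {g : N →ₗ[k] N'} (hf : Function.Injective f) (hg : Function.Injective g) :
    Function.Injective (TensorProduct.map f g) :=
  TensorProduct.map_injective_of_flat_flat f g hf hg

/-- A comultiplication on a subspace that is compatible with that of the ambient coalgebra is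
automatically coassociative and counital. -/
theorem subcoalgebra_axioms {S : Type w} [AddCommGroup S] [Module k S] (i : S →ₗ[k] D)
    (hi : Function.Injective i) (δ : S →ₗ[k] S ⊗[k] S)
    (hδ : TensorProduct.map i i ∘ₗ δ = comul ∘ₗ i) :
    (TensorProduct.assoc k S S S ∘ₗ δ.rTensor S ∘ₗ δ = δ.lTensor S ∘ₗ δ) ∧
    ((counit ∘ₗ i).rTensor S ∘ₗ δ = TensorProduct.mk k _ _ 1) ∧
    ((counit ∘ₗ i).lTensor S ∘ₗ δ = (TensorProduct.mk k _ _).flip 1) := by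
  have hδ' : ∀ x, TensorProduct.map i i (δ x) = comul (i x) := fun x => LinearMap.congr_fun hδ x
  refine ⟨?_, ?_, ?_⟩
  · refine LinearMap.ext fun x => map_injective hi (map_injective hi hi) ?_
    have h1 : ∀ t : S ⊗[k] S, TensorProduct.map i (TensorProduct.map i i)
        (TensorProduct.assoc k S S S (δ.rTensor S t)) =
        TensorProduct.assoc k D D D (comul.rTensor D (TensorProduct.map i i t)) := by
      intro t
      induction t with
      | zero => simp
      | add a b ha hb => simp only [map_add, ha, hb]
      | tmul a b =>
        simp only [LinearMap.rTensor_tmul, TensorProduct.map_tmul, ← hδ']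
        generalize δ a = s
        induction s with
        | zero => simp
        | add a b ha hb => simp only [map_add, ha, hb, TensorProduct.add_tmul]
        | tmul a b => simp
    have h2 : ∀ t : S ⊗[k] S, TensorProduct.map i (TensorProduct.map i i) (δ.lTensor S t) =
        comul.lTensor D (TensorProduct.map i i t) := by
      intro t
      induction t with
      | zero => simp
      | add a b ha hb => simp only [map_add, ha, hb]
      | tmul a b => simp [← hδ']
    simp only [LinearMap.comp_apply, LinearEquiv.coe_coe, h1, h2, hδ', coassoc_apply]
  · refine LinearMap.ext fun x => map_injective (f := (LinearMap.id : k →ₗ[k] k))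
      Function.injective_id hi ?_
    have h1 : ∀ t : S ⊗[k] S, TensorProduct.map LinearMap.id i ((counit ∘ₗ i).rTensor S t) =
        counit.rTensor D (TensorProduct.map i i t) := by
      intro t
      induction t with
      | zero => simp
      | add a b ha hb => simp only [map_add, ha, hb]
      | tmul a b => simp
    simp only [LinearMap.comp_apply, h1, hδ', rTensor_counit_comul]
    simp
  · refine LinearMap.ext fun x => map_injective (g := (LinearMap.id : k →ₗ[k] k)) hi
      Function.injective_id ?_
    have h1 : ∀ t : S ⊗[k] S, TensorProduct.map i LinearMap.id ((counit ∘ₗ i).lTensor S t) =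
        counit.lTensor D (TensorProduct.map i i t) := by
      intro t
      induction t with
      | zero => simp
      | add a b ha hb => simp only [map_add, ha, hb]
      | tmul a b => simp
    simp only [LinearMap.comp_apply, h1, hδ', lTensor_counit_comul]
    simp

namespace Subcoalgebra

instance : CoeSort (Subcoalgebra k D) (Type v) := ⟨fun S => S.toSubmodule⟩

variable (S : Subcoalgebra k D)

/-- The comultiplication of a subcoalgebra is the restriction of the ambient one. -/
def comulAux : S →ₗ[k] S ⊗[k] S :=
  (LinearEquiv.ofInjective
    (TensorProduct.map S.toSubmodule.subtype S.toSubmodule.subtype)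
    (map_injective S.toSubmodule.injective_subtype S.toSubmodule.injective_subtype)).symm.toLinearMap
  ∘ₗ LinearMap.codRestrict _ (comul ∘ₗ S.toSubmodule.subtype) (fun x => S.comul_mem x x.2)

theorem map_comulAux : TensorProduct.map S.toSubmodule.subtype S.toSubmodule.subtype ∘ₗ
    S.comulAux = comul ∘ₗ S.toSubmodule.subtype := by
  ext x
  have := LinearEquiv.ofInjective_symm_apply (h := map_injective S.toSubmodule.injective_subtype
    S.toSubmodule.injective_subtype) (f :=
    (TensorProduct.map S.toSubmodule.subtype S.toSubmodule.subtype))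
    (⟨comul (R := k) (x : D), S.comul_mem x x.2⟩)
  exact this

instance : Coalgebra k S where
  comul := S.comulAux
  counit := counit ∘ₗ S.toSubmodule.subtype
  coassoc := (subcoalgebra_axioms _ S.toSubmodule.injective_subtype _ S.map_comulAux).1
  rTensor_counit_comp_comul :=
    (subcoalgebra_axioms _ S.toSubmodule.injective_subtype _ S.map_comulAux).2.1
  lTensor_counit_comp_comul :=
    (subcoalgebra_axioms _ S.toSubmodule.injective_subtype _ S.map_comulAux).2.2

/-- The inclusion of a subcoalgebra. -/
def incl : S →ₗc[k] D where
  toLinearMap := S.toSubmodule.subtype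
  counit_comp := rfl
  map_comp_comul := S.map_comulAux

theorem incl_injective : Function.Injective S.incl := S.toSubmodule.injective_subtype

@[simp] theorem incl_apply (x : S) : S.incl x = (x : D) := rfl

/-- A coalgebra morphism with values in a subcoalgebra, corestricted to it. -/
def codRestrict {A : Type w} [AddCommGroup A] [Module k A] [Coalgebra k A] (f : A →ₗc[k] D)
    (h : ∀ a, f a ∈ S.toSubmodule) : A →ₗc[k] S where
  toLinearMap := LinearMap.codRestrict S.toSubmodule (f : A →ₗ[k] D) h
  counit_comp := by
    ext a
    exact LinearMap.congr_fun f.counit_comp a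
  map_comp_comul := by
    refine LinearMap.ext fun a => map_injective S.toSubmodule.injective_subtype
      S.toSubmodule.injective_subtype ?_
    have h1 := LinearMap.congr_fun S.map_comulAux
      (LinearMap.codRestrict S.toSubmodule (f : A →ₗ[k] D) h a)
    refine Eq.trans ?_ h1.symm
    have h2 := LinearMap.congr_fun f.map_comp_comul a
    refine Eq.trans ?_ h2
    simp only [LinearMap.comp_apply]
    rw [← LinearMap.comp_apply, ← TensorProduct.map_comp]
    rfl

theorem range_map_mono {S T : Submodule k D} (h : S ≤ T) :
    LinearMap.range (TensorProduct.map S.subtype S.subtype) ≤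
      LinearMap.range (TensorProduct.map T.subtype T.subtype) := by
  have : TensorProduct.map S.subtype S.subtype = TensorProduct.map T.subtype T.subtype ∘ₗ
      TensorProduct.map (Submodule.inclusion h) (Submodule.inclusion h) := by
    rw [← TensorProduct.map_comp]; rfl
  rw [this]
  exact LinearMap.range_comp_le_range _ _

/-- The sum of a family of subcoalgebras is a subcoalgebra. -/
def sum (Λ : Set (Subcoalgebra k D)) : Subcoalgebra k D where
  toSubmodule := ⨆ S ∈ Λ, S.toSubmodule
  comul_mem := by
    change (⨆ S ∈ Λ, S.toSubmodule) ≤ Submodule.comap comul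
      (LinearMap.range (TensorProduct.map (⨆ S ∈ Λ, S.toSubmodule).subtype
        (⨆ S ∈ Λ, S.toSubmodule).subtype))
    refine iSup₂_le fun S hS x hx => ?_
    exact range_map_mono (le_iSup₂_of_le S hS le_rfl) (S.comul_mem x hx)

theorem le_sum {Λ : Set (Subcoalgebra k D)} {S : Subcoalgebra k D} (hS : S ∈ Λ) :
    S.toSubmodule ≤ (sum Λ).toSubmodule :=
  le_iSup₂_of_le (f := fun (S : Subcoalgebra k D) (_ : S ∈ Λ) => S.toSubmodule) S hS le_rfl

/-- The image of a coalgebra morphism. -/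
def range {A : Type w} [AddCommGroup A] [Module k A] [Coalgebra k A] (f : A →ₗc[k] D) :
    Subcoalgebra k D where
  toSubmodule := LinearMap.range (f : A →ₗ[k] D)
  comul_mem := by
    rintro _ ⟨a, rfl⟩
    have h2 := LinearMap.congr_fun f.map_comp_comul a
    simp only [LinearMap.comp_apply] at h2
    refine ⟨TensorProduct.map (LinearMap.rangeRestrict (f : A →ₗ[k] D))
      (LinearMap.rangeRestrict (f : A →ₗ[k] D)) (comul a), ?_⟩
    refine Eq.trans ?_ h2
    rw [← LinearMap.comp_apply, ← TensorProduct.map_comp]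
    rfl

/-- The corestriction of a coalgebra morphism to its image. -/
def rangeRestrict {A : Type w} [AddCommGroup A] [Module k A] [Coalgebra k A] (f : A →ₗc[k] D) :
    A →ₗc[k] range f :=
  (range f).codRestrict f fun a => ⟨a, rfl⟩

theorem rangeRestrict_surjective {A : Type w} [AddCommGroup A] [Module k A] [Coalgebra k A]
    (f : A →ₗc[k] D) : Function.Surjective (rangeRestrict f) := by
  rintro ⟨_, a, rfl⟩
  exact ⟨a, rfl⟩

end Subcoalgebra

/-! ### The fundamental theorem of coalgebras -/

theorem tensor_eq_of_left {M N : Type*} [AddCommGroup M] [Module k M] [AddCommGroup N] [Module k N]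
    (t s : M ⊗[k] N) (h : ∀ f : M →ₗ[k] k, (f.rTensor N) t = (f.rTensor N) s) : t = s := by
  classical
  let b := Module.Basis.ofVectorSpace k M
  apply (TensorProduct.equivFinsuppOfBasisLeft b).injective
  ext i
  have key : ∀ r : M ⊗[k] N, TensorProduct.equivFinsuppOfBasisLeft b r i =
      TensorProduct.lid k N ((b.coord i).rTensor N r) := by
    intro r
    induction r with
    | zero => simp
    | add x y hx hy => simp only [map_add, Finsupp.add_apply, hx, hy]
    | tmul x y => simp
  rw [key, key, h]

theorem tensor_eq_of_right {M N : Type*} [AddCommGroup M] [Module k M] [AddCommGroup N] [Module k N]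
    (t s : M ⊗[k] N) (h : ∀ f : N →ₗ[k] k, (f.lTensor M) t = (f.lTensor M) s) : t = s := by
  apply (TensorProduct.comm k M N).injective
  refine tensor_eq_of_left _ _ fun f => ?_
  rw [LinearMap.rTensor_comm, LinearMap.rTensor_comm, h]

/-- `d ↦ f(d₁) d₂`. -/
def hitL (f : D →ₗ[k] k) : D →ₗ[k] D :=
  (TensorProduct.lid k D).toLinearMap ∘ₗ f.rTensor D ∘ₗ comul

/-- `d ↦ d₁ g(d₂)`. -/
def hitR (g : D →ₗ[k] k) : D →ₗ[k] D :=
  (TensorProduct.rid k D).toLinearMap ∘ₗ g.lTensor D ∘ₗ comul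

/-- The convolution product of two functionals. -/
def conv (f g : D →ₗ[k] k) : D →ₗ[k] k :=
  (TensorProduct.lid k k).toLinearMap ∘ₗ TensorProduct.map f g ∘ₗ comul

theorem hitL_counit (d : D) : hitL (k := k) counit d = d := by
  simp [hitL]

theorem hitR_counit (d : D) : hitR (k := k) counit d = d := by
  simp [hitR]

theorem hitL_hitL (f f' : D →ₗ[k] k) (d : D) : hitL f' (hitL f d) = hitL (conv f f') d := by
  let A : D ⊗[k] (D ⊗[k] D) →ₗ[k] D := (TensorProduct.lid k D).toLinearMap ∘ₗ
    TensorProduct.map f ((TensorProduct.lid k D).toLinearMap ∘ₗ f'.rTensor D)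
  have h1 : ∀ t : D ⊗[k] D, hitL f' (TensorProduct.lid k D (f.rTensor D t)) =
      A (comul.lTensor D t) := by
    intro t
    induction t with
    | zero => simp
    | add a b ha hb => simp only [map_add, ha, hb]
    | tmul a b => simp [A, hitL]
  have h2 : ∀ t : D ⊗[k] D, TensorProduct.lid k D ((conv f f').rTensor D t) =
      A (TensorProduct.assoc k D D D (comul.rTensor D t)) := by
    intro t
    induction t with
    | zero => simp
    | add a b ha hb => simp only [map_add, ha, hb]
    | tmul a b =>
      simp only [LinearMap.rTensor_tmul, conv, LinearMap.comp_apply]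
      generalize comul (R := k) a = s
      induction s with
      | zero => simp
      | add a b ha hb => simp only [map_add, ha, hb, TensorProduct.add_tmul]
      | tmul a c => simp [A, mul_smul, smul_comm (f' c)]
  have h3 := h1 (comul d)
  rw [← coassoc_apply, ← h2] at h3
  exact h3

theorem hitR_hitR (g g' : D →ₗ[k] k) (d : D) : hitR g' (hitR g d) = hitR (conv g' g) d := by
  let A : D ⊗[k] (D ⊗[k] D) →ₗ[k] D := (TensorProduct.rid k D).toLinearMap ∘ₗ
    ((TensorProduct.lid k k).toLinearMap ∘ₗ TensorProduct.map g' g).lTensor D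
  have h1 : ∀ t : D ⊗[k] D, hitR g' (TensorProduct.rid k D (g.lTensor D t)) =
      A (TensorProduct.assoc k D D D (comul.rTensor D t)) := by
    intro t
    induction t with
    | zero => simp
    | add a b ha hb => simp only [map_add, ha, hb]
    | tmul a b =>
      simp only [LinearMap.lTensor_tmul, LinearMap.rTensor_tmul, TensorProduct.rid_tmul, hitR,
        map_smul, LinearMap.comp_apply]
      generalize comul (R := k) a = s
      induction s with
      | zero => simp
      | add a b ha hb => simp only [map_add, ha, hb, TensorProduct.add_tmul, smul_add]
      | tmul a c => simp [A, mul_smul, smul_comm (g b)]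
  have h2 : ∀ t : D ⊗[k] D, TensorProduct.rid k D ((conv g' g).lTensor D t) =
      A (comul.lTensor D t) := by
    intro t
    induction t with
    | zero => simp
    | add a b ha hb => simp only [map_add, ha, hb]
    | tmul a b => simp [A, conv]
  have h3 := h1 (comul d)
  rw [coassoc_apply, ← h2] at h3
  exact h3

/-- `hit f g t` contracts the outer legs of a threefold tensor. -/
def hit (f g : D →ₗ[k] k) : D ⊗[k] (D ⊗[k] D) →ₗ[k] D :=
  (TensorProduct.lid k D).toLinearMap ∘ₗ
    TensorProduct.map f ((TensorProduct.rid k D).toLinearMap ∘ₗ g.lTensor D)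

theorem hitR_hitL (f g : D →ₗ[k] k) (d : D) :
    hitR g (hitL f d) = hit f g (comul.lTensor D (comul d)) := by
  have h1 : ∀ t : D ⊗[k] D, hitR g (TensorProduct.lid k D (f.rTensor D t)) =
      hit f g (comul.lTensor D t) := by
    intro t
    induction t with
    | zero => simp
    | add a b ha hb => simp only [map_add, ha, hb]
    | tmul a b => simp [hit, hitR]
  exact h1 (comul d)

theorem hitL_hitR (f g : D →ₗ[k] k) (d : D) :
    hitL f (hitR g d) = hit f g (comul.lTensor D (comul d)) := by
  have h1 : ∀ t : D ⊗[k] D, hitL f (TensorProduct.rid k D (g.lTensor D t)) =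
      hit f g (TensorProduct.assoc k D D D (comul.rTensor D t)) := by
    intro t
    induction t with
    | zero => simp
    | add a b ha hb => simp only [map_add, ha, hb]
    | tmul a b =>
      simp only [LinearMap.lTensor_tmul, LinearMap.rTensor_tmul, TensorProduct.rid_tmul, hitL,
        map_smul, LinearMap.comp_apply]
      generalize comul (R := k) a = s
      induction s with
      | zero => simp
      | add a b ha hb => simp only [map_add, ha, hb, TensorProduct.add_tmul, smul_add]
      | tmul a c => simp [hit, smul_comm (g b)]
  rw [← coassoc_apply]
  exact h1 (comul d)

theorem hit_finite (t : D ⊗[k] (D ⊗[k] D)) :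
    ∃ W : Submodule k D, FiniteDimensional k W ∧ ∀ f g, hit f g t ∈ W := by
  induction t with
  | zero => exact ⟨⊥, inferInstance, fun f g => by simp⟩
  | add a b ha hb =>
    obtain ⟨A, hA, ha⟩ := ha
    obtain ⟨B, hB, hb⟩ := hb
    refine ⟨A ⊔ B, inferInstance, fun f g => ?_⟩
    rw [map_add]
    exact Submodule.add_mem_sup (ha f g) (hb f g)
  | tmul a s =>
    induction s with
    | zero => exact ⟨⊥, inferInstance, fun f g => by simp⟩
    | add b c hb hc =>
      obtain ⟨A, hA, ha⟩ := hb
      obtain ⟨B, hB, hb⟩ := hc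
      refine ⟨A ⊔ B, inferInstance, fun f g => ?_⟩
      rw [TensorProduct.tmul_add, map_add]
      exact Submodule.add_mem_sup (ha f g) (hb f g)
    | tmul b c =>
      refine ⟨Submodule.span k {b}, inferInstance, fun f g => ?_⟩
      simp only [hit, LinearMap.comp_apply, TensorProduct.map_tmul, LinearMap.lTensor_tmul,
        LinearEquiv.coe_coe, TensorProduct.rid_tmul, TensorProduct.lid_tmul]
      exact Submodule.smul_mem _ _ (Submodule.smul_mem _ _ (Submodule.mem_span_singleton_self b))

/-- A subspace stable under all `hitL f` and `hitR g` is a subcoalgebra. -/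
theorem comul_mem_of_stable (W : Submodule k D) (hL : ∀ f : D →ₗ[k] k, ∀ x ∈ W, hitL f x ∈ W)
    (hR : ∀ g : D →ₗ[k] k, ∀ x ∈ W, hitR g x ∈ W) (x : D) (hx : x ∈ W) :
    comul (R := k) x ∈ LinearMap.range (TensorProduct.map W.subtype W.subtype) := by
  obtain ⟨P, hP⟩ := W.subtype.exists_leftInverse_of_injective (Submodule.ker_subtype W)
  let Q : D →ₗ[k] D := W.subtype ∘ₗ P
  have hQ : ∀ y ∈ W, Q y = y := fun y hy => by
    have := LinearMap.congr_fun hP ⟨y, hy⟩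
    simp only [LinearMap.comp_apply, Submodule.subtype_apply, LinearMap.id_apply] at this
    simp [Q, this]
  have e1 : Q.lTensor D (comul x) = comul x := by
    refine tensor_eq_of_left _ _ fun f => (TensorProduct.lid k D).injective ?_
    have h1 : ∀ t : D ⊗[k] D, TensorProduct.lid k D (f.rTensor D (Q.lTensor D t)) =
        Q (TensorProduct.lid k D (f.rTensor D t)) := by
      intro t
      induction t with
      | zero => simp
      | add a b ha hb => simp only [map_add, ha, hb]
      | tmul a b => simp
    rw [h1]
    exact hQ _ (hL f x hx)
  have e2 : Q.rTensor D (comul x) = comul x := by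
    refine tensor_eq_of_right _ _ fun f => (TensorProduct.rid k D).injective ?_
    have h1 : ∀ t : D ⊗[k] D, TensorProduct.rid k D (f.lTensor D (Q.rTensor D t)) =
        Q (TensorProduct.rid k D (f.lTensor D t)) := by
      intro t
      induction t with
      | zero => simp
      | add a b ha hb => simp only [map_add, ha, hb]
      | tmul a b => simp
    rw [h1]
    exact hQ _ (hR f x hx)
  refine ⟨TensorProduct.map P P (comul x), ?_⟩
  rw [← LinearMap.comp_apply, ← TensorProduct.map_comp]
  change TensorProduct.map Q Q (comul x) = comul x
  conv_rhs => rw [← e1, ← e2]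
  exact (LinearMap.congr_fun (LinearMap.lTensor_comp_rTensor _ _ _) (comul x)).symm

/-- Every element of a coalgebra over a field lies in a finite-dimensional subcoalgebra. -/
theorem exists_finite_subcoalgebra (d : D) :
    ∃ S : Subcoalgebra k D, d ∈ S.toSubmodule ∧ FiniteDimensional k S.toSubmodule := by
  let W : Submodule k D :=
    Submodule.span k (Set.range fun fg : (D →ₗ[k] k) × (D →ₗ[k] k) => hitL fg.1 (hitR fg.2 d))
  have hL : ∀ f : D →ₗ[k] k, ∀ x ∈ W, hitL f x ∈ W := by
    intro f
    change W ≤ W.comap (hitL f)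
    refine Submodule.span_le.2 ?_
    rintro _ ⟨⟨f', g⟩, rfl⟩
    change hitL f (hitL f' (hitR g d)) ∈ W
    rw [hitL_hitL]
    exact Submodule.subset_span ⟨(_, g), rfl⟩
  have hR : ∀ f : D →ₗ[k] k, ∀ x ∈ W, hitR f x ∈ W := by
    intro g
    change W ≤ W.comap (hitR g)
    refine Submodule.span_le.2 ?_
    rintro _ ⟨⟨f, g'⟩, rfl⟩
    change hitR g (hitL f (hitR g' d)) ∈ W
    rw [hitR_hitL, ← hitL_hitR, hitR_hitR]
    exact Submodule.subset_span ⟨(f, _), rfl⟩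
  refine ⟨⟨W, comul_mem_of_stable W hL hR⟩, ?_, ?_⟩
  · refine Submodule.subset_span ⟨(counit, counit), ?_⟩
    simp only [hitR_counit, hitL_counit]
  · obtain ⟨V, hV, h⟩ := hit_finite (k := k) (comul.lTensor D (comul d))
    refine Submodule.finiteDimensional_of_le (S₂ := V) (Submodule.span_le.2 ?_)
    rintro _ ⟨⟨f, g⟩, rfl⟩
    simp only [hitL_hitR]
    exact h f g

end Subcoalgebra

section Cofree

/-! ### The cofree coalgebra over a vector space -/

/-- A coalgebra structure on `k^n` together with a linear map to `V`. -/
structure CofreeIndex (k : Type u) (V : Type v) [Field k] [AddCommGroup V] [Module k V] where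
  n : ℕ
  coalg : Coalgebra k (Fin n → k)
  map : (Fin n → k) →ₗ[k] V

variable {k : Type u} {V : Type v} [Field k] [AddCommGroup V] [Module k V]

/-- The finite-dimensional coalgebra belonging to an index. -/
def CofreeIndex.Carrier (i : CofreeIndex k V) : Type u := Fin i.n → k

instance (i : CofreeIndex k V) : AddCommGroup i.Carrier :=
  inferInstanceAs (AddCommGroup (Fin i.n → k))

instance (i : CofreeIndex k V) : Module k i.Carrier :=
  inferInstanceAs (Module k (Fin i.n → k))

instance (i : CofreeIndex k V) : Coalgebra k i.Carrier := i.coalg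

instance : DecidableEq (CofreeIndex k V) := Classical.decEq _

variable (k V)

/-- The direct sum of all finite-dimensional coalgebras equipped with a linear map to `V`. -/
abbrev CofreeSum : Type (max u v) := Π₀ i : CofreeIndex k V, i.Carrier

variable {k V}

/-- The sum of the given linear maps to `V`. -/
def cofreeSumMap : CofreeSum k V →ₗ[k] V := DFinsupp.lsum k fun i => i.map

theorem map_mkQ_eq_zero_of_le {D : Type w} [AddCommGroup D] [Module k D] {I J : Submodule k D}
    (h : I ≤ J) (t : D ⊗[k] D) (ht : TensorProduct.map I.mkQ I.mkQ t = 0) :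
    TensorProduct.map J.mkQ J.mkQ t = 0 := by
  have e : J.mkQ = Submodule.mapQ I J LinearMap.id h ∘ₗ I.mkQ := rfl
  rw [e, TensorProduct.map_comp, LinearMap.comp_apply, ht, map_zero]

/-- The sum of all coideals of a coalgebra contained in the kernel of a linear map. -/
def largestCoideal {D : Type w} [AddCommGroup D] [Module k D] [Coalgebra k D] (f : D →ₗ[k] V) :
    Submodule k D :=
  sSup {I | I.IsCoideal ∧ I ≤ LinearMap.ker f}

section

variable {D : Type w} [AddCommGroup D] [Module k D] [Coalgebra k D]

theorem le_largestCoideal (f : D →ₗ[k] V) (I : Submodule k D) (h : I.IsCoideal)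
    (h' : I ≤ LinearMap.ker f) : I ≤ largestCoideal f := le_sSup ⟨h, h'⟩

theorem largestCoideal_le (f : D →ₗ[k] V) : largestCoideal f ≤ LinearMap.ker f :=
  sSup_le fun _ h => h.2

instance (f : D →ₗ[k] V) : (largestCoideal f).IsCoideal where
  counit_eq_zero := by
    change largestCoideal f ≤ LinearMap.ker (counit (R := k))
    exact sSup_le fun I h x hx => h.1.counit_eq_zero hx
  map_mkQ_comul_eq_zero := by
    change largestCoideal f ≤ LinearMap.ker
      (TensorProduct.map (largestCoideal f).mkQ (largestCoideal f).mkQ ∘ₗ comul)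
    exact sSup_le fun I h x hx => map_mkQ_eq_zero_of_le (le_sSup h) _
      (h.1.map_mkQ_comul_eq_zero hx)

end

variable (k V)

/-- The cofree coalgebra over `V`: the quotient of the direct sum of all finite-dimensional
coalgebras over `V` by its largest coideal on which the map to `V` vanishes. Its universal
property is given by `CofreeCoalgebra.exists_lift` and `CofreeCoalgebra.hom_ext`. -/
def CofreeCoalgebra : Type (max u v) :=
  CofreeSum k V ⧸ largestCoideal (cofreeSumMap (k := k) (V := V))

namespace CofreeCoalgebra

instance : AddCommGroup (CofreeCoalgebra k V) :=
  inferInstanceAs (AddCommGroup (CofreeSum k V ⧸ largestCoideal (cofreeSumMap (k := k) (V := V))))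

instance : Module k (CofreeCoalgebra k V) :=
  inferInstanceAs (Module k (CofreeSum k V ⧸ largestCoideal (cofreeSumMap (k := k) (V := V))))

instance : Coalgebra k (CofreeCoalgebra k V) :=
  inferInstanceAs (Coalgebra k (CofreeSum k V ⧸ largestCoideal (cofreeSumMap (k := k) (V := V))))

/-- The structure map `p : C(V) → V` of the cofree coalgebra. -/
def proj : CofreeCoalgebra k V →ₗ[k] V :=
  (largestCoideal (cofreeSumMap (k := k) (V := V))).liftQ cofreeSumMap (largestCoideal_le _)

/-- The quotient map. -/
def mk : CofreeSum k V →ₗc[k] CofreeCoalgebra k V :=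
  Coalgebra.Quotient.mkQCoalgHom (largestCoideal (cofreeSumMap (k := k) (V := V)))

variable {k V}

theorem proj_mk (x : CofreeSum k V) : proj k V (mk k V x) = cofreeSumMap x := rfl

theorem mk_surjective : Function.Surjective (mk k V) := Submodule.mkQ_surjective _

theorem map_eq_zero_of_comp {A B C' : Type*} [AddCommGroup A] [Module k A] [AddCommGroup B]
    [Module k B] [AddCommGroup C'] [Module k C'] (I : Submodule k A) (f : A →ₗ[k] B)
    (h : I ≤ LinearMap.ker f) (t : A ⊗[k] A) (ht : TensorProduct.map I.mkQ I.mkQ t = 0) :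
    TensorProduct.map f f t = 0 := by
  have e : f = I.liftQ f h ∘ₗ I.mkQ := rfl
  rw [e, TensorProduct.map_comp, LinearMap.comp_apply, ht, map_zero]

/-- A coideal of `C(V)` on which the map to `V` vanishes is zero. -/
theorem coideal_eq_bot (I : Submodule k (CofreeCoalgebra k V)) (hI : I.IsCoideal)
    (h : I ≤ LinearMap.ker (proj k V)) : I = ⊥ := by
  have hJ : (I.comap (mk k V : CofreeSum k V →ₗ[k] CofreeCoalgebra k V)).IsCoideal := by
    refine ⟨fun x hx => ?_, fun x hx => ?_⟩
    · exact hI.counit_eq_zero hx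
    · have h1 := hI.map_mkQ_comul_eq_zero hx
      have h2 := LinearMap.congr_fun (mk k V).map_comp_comul x
      simp only [LinearMap.comp_apply] at h2
      set J := I.comap (mk k V : CofreeSum k V →ₗ[k] CofreeCoalgebra k V) with hJdef
      have h3 : TensorProduct.map (I.mkQ ∘ₗ (mk k V : CofreeSum k V →ₗ[k] CofreeCoalgebra k V))
        (I.mkQ ∘ₗ (mk k V : CofreeSum k V →ₗ[k] CofreeCoalgebra k V)) (comul x) = 0 := by
        rw [TensorProduct.map_comp, LinearMap.comp_apply]
        exact (congrArg _ h2).trans h1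
      let g : CofreeSum k V ⧸ J →ₗ[k] CofreeCoalgebra k V ⧸ I :=
        Submodule.mapQ J I (mk k V : CofreeSum k V →ₗ[k] CofreeCoalgebra k V) le_rfl
      have hg : Function.Injective g := by
        rw [← LinearMap.ker_eq_bot, eq_bot_iff]
        intro y hy
        obtain ⟨y, rfl⟩ := Submodule.mkQ_surjective _ y
        have : mk k V y ∈ I := by
          have hy' : I.mkQ (mk k V y) = 0 := hy
          simpa using hy'
        exact (Submodule.Quotient.mk_eq_zero J).2 this
      apply map_injective hg hg
      rw [map_zero, ← LinearMap.comp_apply, ← TensorProduct.map_comp]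
      exact h3
  have h1 := le_largestCoideal (cofreeSumMap (k := k) (V := V)) _ hJ (fun x hx => h hx)
  rw [eq_bot_iff]
  intro y hy
  obtain ⟨y, rfl⟩ := mk_surjective y
  have : y ∈ largestCoideal (cofreeSumMap (k := k) (V := V)) := h1 hy
  exact (Submodule.Quotient.mk_eq_zero _).2 this

variable {D : Type w} [AddCommGroup D] [Module k D] [Coalgebra k D]

/-- Coalgebra morphisms to `C(V)` are determined by their composition with `p`. -/
theorem hom_ext (F G : D →ₗc[k] CofreeCoalgebra k V)
    (h : ∀ d, proj k V (F d) = proj k V (G d)) : F = G := by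
  let f : D →ₗ[k] CofreeCoalgebra k V := F
  let g : D →ₗ[k] CofreeCoalgebra k V := G
  have hI : (LinearMap.range (f - g)).IsCoideal := by
    refine ⟨?_, ?_⟩
    · rintro _ ⟨d, rfl⟩
      have h1 : counit (R := k) (f d) = counit d := LinearMap.congr_fun F.counit_comp d
      have h2 : counit (R := k) (g d) = counit d := LinearMap.congr_fun G.counit_comp d
      rw [LinearMap.sub_apply, map_sub, h1, h2, sub_self]
    · rintro _ ⟨d, rfl⟩
      have h1 : TensorProduct.map f f (comul d) = comul (f d) :=
        LinearMap.congr_fun F.map_comp_comul d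
      have h2 : TensorProduct.map g g (comul d) = comul (g d) :=
        LinearMap.congr_fun G.map_comp_comul d
      have h3 : (LinearMap.range (f - g)).mkQ ∘ₗ f = (LinearMap.range (f - g)).mkQ ∘ₗ g := by
        ext x
        simp only [LinearMap.comp_apply, Submodule.mkQ_apply]
        rw [Submodule.Quotient.eq]
        exact ⟨x, rfl⟩
      rw [LinearMap.sub_apply, map_sub, map_sub, ← h1, ← h2, TensorProduct.map_map,
        TensorProduct.map_map, h3, sub_self]
  have h0 := coideal_eq_bot _ hI (by
    rintro _ ⟨d, rfl⟩
    rw [LinearMap.mem_ker, LinearMap.sub_apply, map_sub]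
    exact sub_eq_zero.2 (h d))
  rw [LinearMap.range_eq_bot] at h0
  ext d
  exact sub_eq_zero.1 (LinearMap.congr_fun h0 d)

/-- Transport of a coalgebra structure along a linear equivalence. -/
@[reducible] def transport {E : Type*} {W : Type*} [AddCommGroup E] [Module k E] [Coalgebra k E]
    [AddCommGroup W] [Module k W] (e : E ≃ₗ[k] W) : Coalgebra k W :=
  have h : TensorProduct.map e.symm.toLinearMap e.symm.toLinearMap ∘ₗ
      (TensorProduct.map e.toLinearMap e.toLinearMap ∘ₗ comul ∘ₗ e.symm.toLinearMap) =
      comul ∘ₗ e.symm.toLinearMap := by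
    refine LinearMap.ext fun x => ?_
    simp only [LinearMap.comp_apply, TensorProduct.map_map, LinearEquiv.symm_comp]
    simp
  { comul := TensorProduct.map e.toLinearMap e.toLinearMap ∘ₗ comul ∘ₗ e.symm.toLinearMap
    counit := counit ∘ₗ e.symm.toLinearMap
    coassoc := (subcoalgebra_axioms _ e.symm.injective _ h).1
    rTensor_counit_comp_comul := (subcoalgebra_axioms _ e.symm.injective _ h).2.1
    lTensor_counit_comp_comul := (subcoalgebra_axioms _ e.symm.injective _ h).2.2 }

theorem exists_lift_finite [FiniteDimensional k D] (f : D →ₗ[k] V) :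
    ∃ F : D →ₗc[k] CofreeCoalgebra k V, ∀ d, proj k V (F d) = f d := by
  let e : D ≃ₗ[k] (Fin (Module.finrank k D) → k) := (Module.finBasis k D).equivFun
  let i : CofreeIndex k V := ⟨Module.finrank k D, transport e, f ∘ₗ e.symm.toLinearMap⟩
  let e' : D →ₗ[k] i.Carrier := e.toLinearMap
  have hc : counit ∘ₗ e' = (counit : D →ₗ[k] k) := by
    refine LinearMap.ext fun d => ?_
    exact congrArg (counit (R := k)) (e.symm_apply_apply d)
  have hm : TensorProduct.map e' e' ∘ₗ comul = comul ∘ₗ e' := by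
    refine LinearMap.ext fun d => ?_
    exact (congrArg (fun x => TensorProduct.map e' e' (comul (R := k) x))
      (e.symm_apply_apply d)).symm
  let s : i.Carrier →ₗc[k] CofreeSum k V :=
    { toLinearMap := DFinsupp.lsingle i
      counit_comp := DFinsupp.counit_comp_lsingle k _ _ i
      map_comp_comul := (DFinsupp.comul_comp_lsingle k _ _ i).symm }
  let e'' : D →ₗc[k] i.Carrier := { toLinearMap := e', counit_comp := hc, map_comp_comul := hm }
  refine ⟨(mk k V).comp (s.comp e''), fun d => ?_⟩
  change cofreeSumMap (DFinsupp.single i (e' d)) = f d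
  have h1 : cofreeSumMap (DFinsupp.single i (e' d)) = i.map (e' d) :=
    DFinsupp.lsum_single (S := k) _ _ _
  rw [h1]
  exact congrArg f (e.symm_apply_apply d)

/-- The universal property of `C(V)`: every linear map `f : D → V` from a coalgebra lifts. -/
theorem exists_lift (f : D →ₗ[k] V) :
    ∃ F : D →ₗc[k] CofreeCoalgebra k V, ∀ d, proj k V (F d) = f d := by
  choose S hdS hS using fun d : D => exists_finite_subcoalgebra (k := k) d
  have hex : ∀ T : Subcoalgebra k D, FiniteDimensional k T.toSubmodule →
      ∃ F : T →ₗc[k] CofreeCoalgebra k V, ∀ d : T, proj k V (F d) = f d := fun T hT =>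
    exists_lift_finite (f ∘ₗ T.toSubmodule.subtype)
  choose Φ hΦ using hex
  have hle : ∀ (T T' : Subcoalgebra k D) (h : T.toSubmodule ≤ T'.toSubmodule)
      (hT : FiniteDimensional k T.toSubmodule) (hT' : FiniteDimensional k T'.toSubmodule)
      (x : T), Φ T hT x = Φ T' hT' ⟨x, h x.2⟩ := by
    intro T T' h hT hT' x
    have := hom_ext (Φ T hT) ((Φ T' hT').comp (T'.codRestrict T.incl fun a => h a.2)) (by
      intro d
      rw [hΦ]
      exact (hΦ T' hT' ⟨d, h d.2⟩).symm)
    exact congrArg (fun F : T →ₗc[k] CofreeCoalgebra k V => F x) this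
  have hsup : ∀ T T' : Subcoalgebra k D, FiniteDimensional k T.toSubmodule →
      FiniteDimensional k T'.toSubmodule →
      ∃ U : Subcoalgebra k D, FiniteDimensional k U.toSubmodule ∧
        T.toSubmodule ≤ U.toSubmodule ∧ T'.toSubmodule ≤ U.toSubmodule := by
    intro T T' hT hT'
    refine ⟨Subcoalgebra.sum {T, T'}, ?_, Subcoalgebra.le_sum (by simp),
      Subcoalgebra.le_sum (by simp)⟩
    have : (Subcoalgebra.sum {T, T'}).toSubmodule = T.toSubmodule ⊔ T'.toSubmodule := by
      simp only [Subcoalgebra.sum, iSup_insert, iSup_singleton]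
    rw [this]
    infer_instance
  let F₀ : D → CofreeCoalgebra k V := fun d => Φ (S d) (hS d) ⟨d, hdS d⟩
  have hF₀ : ∀ (T : Subcoalgebra k D) (hT : FiniteDimensional k T.toSubmodule) (x : T),
      F₀ x = Φ T hT x := by
    intro T hT x
    obtain ⟨U, hU, h1, h2⟩ := hsup (S x) T (hS x) hT
    exact (hle _ U h1 (hS x) hU _).trans (hle _ U h2 hT hU _).symm
  let F : D →ₗ[k] CofreeCoalgebra k V :=
    { toFun := F₀
      map_add' := by
        intro x y
        obtain ⟨U, hU, h1, h2⟩ := hsup (S x) (S y) (hS x) (hS y)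
        have hx := h1 (hdS x)
        have hy := h2 (hdS y)
        have ex := hF₀ U hU ⟨x, hx⟩
        have ey := hF₀ U hU ⟨y, hy⟩
        have exy := hF₀ U hU (⟨x, hx⟩ + ⟨y, hy⟩)
        rw [map_add] at exy
        exact exy.trans (congrArg₂ (· + ·) ex.symm ey.symm)
      map_smul' := by
        intro c x
        have ex := hF₀ (S x) (hS x) ⟨x, hdS x⟩
        have ecx := hF₀ (S x) (hS x) (c • ⟨x, hdS x⟩)
        rw [map_smul] at ecx
        exact ecx.trans (congrArg (c • ·) ex.symm) }
  have hFS : ∀ x : D, F ∘ₗ (S x).toSubmodule.subtype =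
      (Φ (S x) (hS x) : S x →ₗ[k] CofreeCoalgebra k V) :=
    fun x => LinearMap.ext fun y => hF₀ (S x) (hS x) y
  refine ⟨{ toLinearMap := F, counit_comp := ?_, map_comp_comul := ?_ }, fun d => ?_⟩
  · refine LinearMap.ext fun x => ?_
    exact LinearMap.congr_fun (Φ (S x) (hS x)).counit_comp ⟨x, hdS x⟩
  · refine LinearMap.ext fun x => ?_
    have h1 := LinearMap.congr_fun (Φ (S x) (hS x)).map_comp_comul ⟨x, hdS x⟩
    have h2 := LinearMap.congr_fun (S x).incl.map_comp_comul ⟨x, hdS x⟩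
    refine Eq.trans ?_ h1
    change TensorProduct.map F F (comul ((S x).incl ⟨x, hdS x⟩)) = _
    refine (congrArg (TensorProduct.map F F) h2.symm).trans ?_
    simp only [LinearMap.comp_apply]
    rw [TensorProduct.map_map]
    exact congrArg (fun G => TensorProduct.map G G _) (hFS x)
  · exact hΦ (S d) (hS d) ⟨d, hdS d⟩

/-- The coalgebra morphism `f̄ : D → C(V)` with `p ∘ f̄ = f`. -/
def lift (f : D →ₗ[k] V) : D →ₗc[k] CofreeCoalgebra k V := (exists_lift f).choose

theorem proj_lift (f : D →ₗ[k] V) (d : D) : proj k V (lift f d) = f d :=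
  (exists_lift f).choose_spec d

end CofreeCoalgebra
end Cofree

section Corep

variable {k : Type u} {H : Type v} {D : Type w} [Field k] [Ring H] [HopfAlgebra k H]
  [AddCommGroup D] [Module k D] [Coalgebra k D]

/-- A partial corepresentation of `H` over the coalgebra `D`. In Sweedler notation:
* `ε_H(ω(c)) = ε_D(c)`;
* `ω(c₁)₁ ⊗ ω(c₁)₂ S(ω(c₂)) = ω(c₁) ⊗ ω(c₂) S(ω(c₃))`;
* `ω(c₁) S(ω(c₂)₁) ⊗ ω(c₂)₂ = ω(c₁) S(ω(c₂)) ⊗ ω(c₃)`. -/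
structure IsPartialCorep (ω : D →ₗ[k] H) : Prop where
  counit_comp : counit ∘ₗ ω = (counit : D →ₗ[k] k)
  left : (LinearMap.mul' k H).lTensor H ∘ₗ (TensorProduct.assoc k H H H).toLinearMap ∘ₗ
      TensorProduct.map (comul ∘ₗ ω) (HopfAlgebra.antipode k ∘ₗ ω) ∘ₗ comul =
    TensorProduct.map ω (LinearMap.mul' k H ∘ₗ
      TensorProduct.map ω (HopfAlgebra.antipode k ∘ₗ ω)) ∘ₗ comul.lTensor D ∘ₗ comul
  right : (LinearMap.mul' k H ∘ₗ (HopfAlgebra.antipode k).lTensor H).rTensor H ∘ₗ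
      (TensorProduct.assoc k H H H).symm.toLinearMap ∘ₗ
      TensorProduct.map ω (comul ∘ₗ ω) ∘ₗ comul =
    TensorProduct.map (LinearMap.mul' k H ∘ₗ
      TensorProduct.map ω (HopfAlgebra.antipode k ∘ₗ ω)) ω ∘ₗ comul.rTensor D ∘ₗ comul

/-- If the composition of `ω` with a surjective coalgebra morphism is a partial corepresentation,
then so is `ω`. -/
theorem IsPartialCorep.of_surjective {A : Type x} [AddCommGroup A] [Module k A] [Coalgebra k A]
    {ω : D →ₗ[k] H} (f : A →ₗc[k] D) (hf : Function.Surjective f)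
    (h : IsPartialCorep (ω ∘ₗ (f : A →ₗ[k] D))) : IsPartialCorep ω := by
  have e : ∀ a, comul (R := k) (f a) = TensorProduct.map (f : A →ₗ[k] D) (f : A →ₗ[k] D) (comul a) :=
    fun a => (LinearMap.congr_fun f.map_comp_comul a).symm
  have e2 : ∀ t : A ⊗[k] A, LinearMap.mul' k H (TensorProduct.map ω (HopfAlgebra.antipode k ∘ₗ ω)
      (TensorProduct.map (f : A →ₗ[k] D) (f : A →ₗ[k] D) t)) =
      LinearMap.mul' k H (TensorProduct.map (ω ∘ₗ (f : A →ₗ[k] D))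
        (HopfAlgebra.antipode k ∘ₗ ω ∘ₗ (f : A →ₗ[k] D)) t) := fun t => by
    rw [TensorProduct.map_map, LinearMap.comp_assoc]
  refine ⟨?_, ?_, ?_⟩
  · refine LinearMap.ext fun d => ?_
    obtain ⟨a, rfl⟩ := hf d
    exact (LinearMap.congr_fun h.counit_comp a).trans (LinearMap.congr_fun f.counit_comp a).symm
  · refine LinearMap.ext fun d => ?_
    obtain ⟨a, rfl⟩ := hf d
    have h1 := LinearMap.congr_fun h.left a
    simp only [LinearMap.comp_apply, e] at h1 ⊢
    generalize comul (R := k) a = t at h1 ⊢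
    have e3 : TensorProduct.map (comul ∘ₗ ω) (HopfAlgebra.antipode k ∘ₗ ω)
        (TensorProduct.map (f : A →ₗ[k] D) (f : A →ₗ[k] D) t) =
        TensorProduct.map (comul ∘ₗ ω ∘ₗ (f : A →ₗ[k] D))
          (HopfAlgebra.antipode k ∘ₗ ω ∘ₗ (f : A →ₗ[k] D)) t := by
      rw [TensorProduct.map_map, LinearMap.comp_assoc, LinearMap.comp_assoc]
    rw [e3, h1]
    clear h1 e3
    induction t with
    | zero => simp
    | add x y hx hy => simp only [map_add, hx, hy]
    | tmul x y =>
      simp only [LinearMap.lTensor_tmul, TensorProduct.map_tmul, LinearMap.comp_apply]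
      refine congrArg _ ?_
      refine Eq.trans (e2 (comul y)).symm ?_
      exact congrArg (fun z => LinearMap.mul' k H
        (TensorProduct.map ω (HopfAlgebra.antipode k ∘ₗ ω) z)) (e y).symm
  · refine LinearMap.ext fun d => ?_
    obtain ⟨a, rfl⟩ := hf d
    have h1 := LinearMap.congr_fun h.right a
    simp only [LinearMap.comp_apply, e] at h1 ⊢
    generalize comul (R := k) a = t at h1 ⊢
    have e3 : TensorProduct.map ω (comul ∘ₗ ω)
        (TensorProduct.map (f : A →ₗ[k] D) (f : A →ₗ[k] D) t) =
        TensorProduct.map (ω ∘ₗ (f : A →ₗ[k] D)) (comul ∘ₗ ω ∘ₗ (f : A →ₗ[k] D)) t := by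
      rw [TensorProduct.map_map, LinearMap.comp_assoc]
    rw [e3, h1]
    clear h1 e3
    induction t with
    | zero => simp
    | add x y hx hy => simp only [map_add, hx, hy]
    | tmul x y =>
      simp only [LinearMap.rTensor_tmul, TensorProduct.map_tmul, LinearMap.comp_apply]
      refine congrArg (· ⊗ₜ[k] _) ?_
      refine Eq.trans (e2 (comul x)).symm ?_
      exact congrArg (fun z => LinearMap.mul' k H
        (TensorProduct.map ω (HopfAlgebra.antipode k ∘ₗ ω) z)) (e x).symm

end Corep

section Hpar

variable (k : Type u) (H : Type v) [Field k] [Ring H] [HopfAlgebra k H]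

/-- The sum of all subcoalgebras `X` of the cofree coalgebra `C(H)` such that `p|_X` is a partial
corepresentation of `H`. -/
def hparSubcoalgebra : Subcoalgebra k (CofreeCoalgebra k H) :=
  Subcoalgebra.sum {X | IsPartialCorep (CofreeCoalgebra.proj k H ∘ₗ X.toSubmodule.subtype)}

/-- The universal corep-coalgebra `H^par`. -/
abbrev Hpar : Type (max u v) := hparSubcoalgebra k H

namespace Hpar

/-- The restriction of `p : C(H) → H` to `H^par`. -/
def proj : Hpar k H →ₗ[k] H :=
  CofreeCoalgebra.proj k H ∘ₗ (hparSubcoalgebra k H).toSubmodule.subtype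

variable {k H}

/-- The coalgebra morphism `ω̄ : D → H^par` with `p ∘ ω̄ = ω` defined by a partial
corepresentation `ω : D → H`. -/
def lift {D : Type w} [AddCommGroup D] [Module k D] [Coalgebra k D] (ω : D →ₗ[k] H)
    (hω : IsPartialCorep ω) : D →ₗc[k] Hpar k H :=
  (hparSubcoalgebra k H).codRestrict (CofreeCoalgebra.lift ω) fun d => by
    have h : IsPartialCorep (CofreeCoalgebra.proj k H ∘ₗ
        (Subcoalgebra.range (CofreeCoalgebra.lift ω)).toSubmodule.subtype) := by
      refine IsPartialCorep.of_surjective _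
        (Subcoalgebra.rangeRestrict_surjective (CofreeCoalgebra.lift ω)) ?_
      convert hω
      exact LinearMap.ext fun d => CofreeCoalgebra.proj_lift ω d
    exact Subcoalgebra.le_sum (Λ := {X | IsPartialCorep
      (CofreeCoalgebra.proj k H ∘ₗ X.toSubmodule.subtype)}) h ⟨d, rfl⟩

theorem proj_lift {D : Type w} [AddCommGroup D] [Module k D] [Coalgebra k D] (ω : D →ₗ[k] H)
    (hω : IsPartialCorep ω) (d : D) : proj k H (lift ω hω d) = ω d :=
  CofreeCoalgebra.proj_lift ω d

theorem hom_ext {D : Type w} [AddCommGroup D] [Module k D] [Coalgebra k D]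
    (F G : D →ₗc[k] Hpar k H) (h : ∀ d, proj k H (F d) = proj k H (G d)) : F = G := by
  have := CofreeCoalgebra.hom_ext ((hparSubcoalgebra k H).incl.comp F)
    ((hparSubcoalgebra k H).incl.comp G) h
  ext d
  exact Subtype.ext_iff.1 (Subtype.ext (congrArg (fun f : D →ₗc[k] _ => f d) this))

variable (k H)

/-- `E : H^par → H`, `E(x) = p(x₁) S(p(x₂))`. -/
def E : Hpar k H →ₗ[k] H :=
  LinearMap.mul' k H ∘ₗ
    TensorProduct.map (proj k H) (HopfAlgebra.antipode k ∘ₗ proj k H) ∘ₗ comul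

/-- The coalgebra morphism `Ē : H^par → C(H)` with `p ∘ Ē = E`. -/
def EbarCofree : Hpar k H →ₗc[k] CofreeCoalgebra k H := CofreeCoalgebra.lift (E k H)

/-- The base coalgebra `C = Ē(H^par)` of `H^par`. -/
abbrev Base : Type (max u v) := Subcoalgebra.range (EbarCofree k H)

/-- `Ē`, regarded as a coalgebra morphism from `H^par` onto the base coalgebra. -/
def Ebar : Hpar k H →ₗc[k] Base k H := Subcoalgebra.rangeRestrict (EbarCofree k H)

/-- The linear map `H^par → H ⊗ C`, `x ↦ p(x₁) S(p(x₃)) ⊗ Ē(x₂)`. -/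
def coactionFormula : Hpar k H →ₗ[k] H ⊗[k] Base k H :=
  (LinearMap.mul' k H).rTensor (Base k H) ∘ₗ
    (TensorProduct.assoc k H H (Base k H)).symm.toLinearMap ∘ₗ
    (TensorProduct.comm k (Base k H) H).toLinearMap.lTensor H ∘ₗ
    TensorProduct.map (proj k H)
      (TensorProduct.map (Ebar k H : Hpar k H →ₗ[k] Base k H)
        (HopfAlgebra.antipode k ∘ₗ proj k H)) ∘ₗ
    comul.lTensor (Hpar k H) ∘ₗ comul

end Hpar
end Hpar

/-! ### Left partial comodule coalgebras and the partial cosmash coproduct -/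

section LeftCounital

variable {k : Type u} {M : Type v} [Field k] [AddCommGroup M] [Module k M]

/-- `Δ` is a coassociative comultiplication on `M` with left counit `ε`, and `π = (id ⊗ ε) Δ`.
Then `π` is a projection and its image is a coalgebra. -/
structure IsLeftCounital (Δ : M →ₗ[k] M ⊗[k] M) (ε : M →ₗ[k] k) (π : M →ₗ[k] M) : Prop where
  coassoc : ∀ m, TensorProduct.assoc k M M M (Δ.rTensor M (Δ m)) = Δ.lTensor M (Δ m)
  left : ∀ m, TensorProduct.lid k M (ε.rTensor M (Δ m)) = m
  right : ∀ m, TensorProduct.rid k M (ε.lTensor M (Δ m)) = π m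

namespace IsLeftCounital

variable {Δ : M →ₗ[k] M ⊗[k] M} {ε : M →ₗ[k] k} {π : M →ₗ[k] M}

theorem comul_proj (h : IsLeftCounital Δ ε π) (m : M) : Δ (π m) = π.lTensor M (Δ m) := by
  let A : M ⊗[k] (M ⊗[k] M) →ₗ[k] M ⊗[k] M :=
    ((TensorProduct.rid k M).toLinearMap ∘ₗ ε.lTensor M).lTensor M
  have h1 : ∀ t : M ⊗[k] M, Δ (TensorProduct.rid k M (ε.lTensor M t)) =
      A (TensorProduct.assoc k M M M (Δ.rTensor M t)) := by
    intro t
    induction t with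
    | zero => simp
    | add a b ha hb => simp only [map_add, ha, hb]
    | tmul a b =>
      simp only [LinearMap.lTensor_tmul, LinearMap.rTensor_tmul, TensorProduct.rid_tmul, map_smul]
      generalize Δ a = s
      induction s with
      | zero => simp
      | add a b ha hb => simp only [map_add, ha, hb, TensorProduct.add_tmul, smul_add]
      | tmul a c => simp [A]
  have h2 : ∀ t : M ⊗[k] M, A (Δ.lTensor M t) = π.lTensor M t := by
    intro t
    induction t with
    | zero => simp
    | add a b ha hb => simp only [map_add, ha, hb]
    | tmul a b => simp [A, h.right]
  rw [← h.right, h1, h.coassoc, h2]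

theorem proj_comul (h : IsLeftCounital Δ ε π) (m : M) : π.rTensor M (Δ m) = Δ m := by
  let A : M ⊗[k] (M ⊗[k] M) →ₗ[k] M ⊗[k] M :=
    ((TensorProduct.lid k M).toLinearMap ∘ₗ ε.rTensor M).lTensor M
  have h1 : ∀ t : M ⊗[k] M, π.rTensor M t =
      A (TensorProduct.assoc k M M M (Δ.rTensor M t)) := by
    intro t
    induction t with
    | zero => simp
    | add a b ha hb => simp only [map_add, ha, hb]
    | tmul a b =>
      simp only [LinearMap.rTensor_tmul, ← h.right]
      generalize Δ a = s
      induction s with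
      | zero => simp
      | add a b ha hb => simp only [map_add, ha, hb, TensorProduct.add_tmul]
      | tmul a c => simp [A, TensorProduct.smul_tmul]
  have h2 : ∀ t : M ⊗[k] M, A (Δ.lTensor M t) = t := by
    intro t
    induction t with
    | zero => simp
    | add a b ha hb => simp only [map_add, ha, hb]
    | tmul a b => simp [A, h.left]
  rw [h1, h.coassoc, h2]

theorem counit_proj (h : IsLeftCounital Δ ε π) (m : M) : ε (π m) = ε m := by
  have h1 : ∀ t : M ⊗[k] M, ε (TensorProduct.rid k M (ε.lTensor M t)) =
      ε (TensorProduct.lid k M (ε.rTensor M t)) := by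
    intro t
    induction t with
    | zero => simp
    | add a b ha hb => simp only [map_add, ha, hb]
    | tmul a b => simp [mul_comm]
  rw [← h.right, h1, h.left]

theorem proj_proj (h : IsLeftCounital Δ ε π) (m : M) : π (π m) = π m := by
  have h1 : ∀ t : M ⊗[k] M, TensorProduct.rid k M (ε.lTensor M (π.lTensor M t)) =
      TensorProduct.rid k M (ε.lTensor M t) := by
    intro t
    induction t with
    | zero => simp
    | add a b ha hb => simp only [map_add, ha, hb]
    | tmul a b => simp [h.counit_proj]
  rw [← h.right (π m), h.comul_proj, h1, h.right]

/-- The comultiplication `(π ⊗ π) Δ` restricted to the image of `π`. -/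
def comulRange (Δ : M →ₗ[k] M ⊗[k] M) (π : M →ₗ[k] M) :
    LinearMap.range π →ₗ[k] LinearMap.range π ⊗[k] LinearMap.range π :=
  TensorProduct.map π.rangeRestrict π.rangeRestrict ∘ₗ Δ ∘ₗ (LinearMap.range π).subtype

theorem rangeRestrict_proj (h : IsLeftCounital Δ ε π) (m : M) : π.rangeRestrict (π m) = π.rangeRestrict m :=
  Subtype.ext (h.proj_proj m)

theorem comulRange_apply (h : IsLeftCounital Δ ε π) (m : M) : comulRange Δ π (π.rangeRestrict m) =
    TensorProduct.map π.rangeRestrict π.rangeRestrict (Δ m) := by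
  have h1 : ∀ t : M ⊗[k] M, TensorProduct.map π.rangeRestrict π.rangeRestrict (π.lTensor M t) =
      TensorProduct.map π.rangeRestrict π.rangeRestrict t := by
    intro t
    induction t with
    | zero => simp
    | add a b ha hb => simp only [map_add, ha, hb]
    | tmul a b => simp [h.rangeRestrict_proj]
  change TensorProduct.map π.rangeRestrict π.rangeRestrict (Δ (π m)) = _
  rw [h.comul_proj, h1]

/-- The coalgebra structure on the image of `π`. -/
@[reducible] def coalgebra (h : IsLeftCounital Δ ε π) : Coalgebra k (LinearMap.range π) where
  comul := comulRange Δ π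
  counit := ε ∘ₗ (LinearMap.range π).subtype
  coassoc := by
    refine LinearMap.ext fun x => ?_
    obtain ⟨m, rfl⟩ := π.surjective_rangeRestrict x
    simp only [LinearMap.comp_apply, LinearEquiv.coe_coe, h.comulRange_apply]
    have h1 : ∀ t : M ⊗[k] M, TensorProduct.assoc k _ _ _ ((comulRange Δ π).rTensor _
        (TensorProduct.map π.rangeRestrict π.rangeRestrict t)) =
        TensorProduct.map π.rangeRestrict (TensorProduct.map π.rangeRestrict π.rangeRestrict)
          (TensorProduct.assoc k M M M (Δ.rTensor M t)) := by
      intro t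
      induction t with
      | zero => simp
      | add a b ha hb => simp only [map_add, ha, hb]
      | tmul a b =>
        simp only [LinearMap.rTensor_tmul, TensorProduct.map_tmul, h.comulRange_apply]
        generalize Δ a = s
        induction s with
        | zero => simp
        | add a b ha hb => simp only [map_add, ha, hb, TensorProduct.add_tmul]
        | tmul a c => simp
    have h2 : ∀ t : M ⊗[k] M, (comulRange Δ π).lTensor _
        (TensorProduct.map π.rangeRestrict π.rangeRestrict t) =
        TensorProduct.map π.rangeRestrict (TensorProduct.map π.rangeRestrict π.rangeRestrict)
          (Δ.lTensor M t) := by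
      intro t
      induction t with
      | zero => simp
      | add a b ha hb => simp only [map_add, ha, hb]
      | tmul a b => simp [h.comulRange_apply]
    rw [h1, h2, h.coassoc]
  rTensor_counit_comp_comul := by
    refine LinearMap.ext fun x => ?_
    obtain ⟨m, rfl⟩ := π.surjective_rangeRestrict x
    simp only [LinearMap.comp_apply, h.comulRange_apply]
    apply (TensorProduct.lid k _).injective
    have h1 : ∀ t : M ⊗[k] M, TensorProduct.lid k _
        ((ε ∘ₗ (LinearMap.range π).subtype).rTensor _
        (TensorProduct.map π.rangeRestrict π.rangeRestrict t)) =
        π.rangeRestrict (TensorProduct.lid k M (ε.rTensor M t)) := by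
      intro t
      induction t with
      | zero => simp
      | add a b ha hb => simp only [map_add, ha, hb]
      | tmul a b => simp [h.counit_proj]
    rw [h1, h.left]
    simp
  lTensor_counit_comp_comul := by
    refine LinearMap.ext fun x => ?_
    obtain ⟨m, rfl⟩ := π.surjective_rangeRestrict x
    simp only [LinearMap.comp_apply, h.comulRange_apply]
    apply (TensorProduct.rid k _).injective
    have h1 : ∀ t : M ⊗[k] M, TensorProduct.rid k _
        ((ε ∘ₗ (LinearMap.range π).subtype).lTensor _
        (TensorProduct.map π.rangeRestrict π.rangeRestrict t)) =
        π.rangeRestrict (TensorProduct.rid k M (ε.lTensor M t)) := by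
      intro t
      induction t with
      | zero => simp
      | add a b ha hb => simp only [map_add, ha, hb]
      | tmul a b => simp [h.counit_proj]
    rw [h1, h.right, h.rangeRestrict_proj]
    simp

end IsLeftCounital
end LeftCounital

section Comodule

variable {k : Type u} {H : Type v} {C : Type w} [Field k] [Ring H] [HopfAlgebra k H]
  [AddCommGroup C] [Module k C] [Coalgebra k C]

/-- `∇(c) = c^[-1] ε(c^[0])` for a linear map `λ : C → H ⊗ C`, `λ(c) = c^[-1] ⊗ c^[0]`. -/
def nabla (coact : C →ₗ[k] H ⊗[k] C) : C →ₗ[k] H :=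
  (TensorProduct.rid k H).toLinearMap ∘ₗ counit.lTensor H ∘ₗ coact

variable (k H C)

/-- `(a ⊗ c) ⊗ (b ⊗ d) ↦ a b ⊗ (c ⊗ d)`. -/
def mulFirst : (H ⊗[k] C) ⊗[k] (H ⊗[k] C) →ₗ[k] H ⊗[k] (C ⊗[k] C) :=
  (LinearMap.mul' k H).rTensor (C ⊗[k] C) ∘ₗ
    (TensorProduct.tensorTensorTensorComm k H C H C).toLinearMap

/-- `b ⊗ c ↦ b₁ ⊗ (b₂ ⊗ c)`. -/
def comulFirst : H ⊗[k] C →ₗ[k] H ⊗[k] (H ⊗[k] C) :=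
  (TensorProduct.assoc k H H C).toLinearMap ∘ₗ comul.rTensor C

/-- `a ⊗ (b ⊗ c) ↦ a b₁ ⊗ (b₂ ⊗ c)`. -/
def mulComulLeft : H ⊗[k] (H ⊗[k] C) →ₗ[k] H ⊗[k] (H ⊗[k] C) :=
  (LinearMap.mul' k H).rTensor (H ⊗[k] C) ∘ₗ
    (TensorProduct.assoc k H H (H ⊗[k] C)).symm.toLinearMap ∘ₗ (comulFirst k H C).lTensor H

/-- `(b ⊗ c) ⊗ a ↦ b₁ a ⊗ (b₂ ⊗ c)`. -/
def mulComulRight : (H ⊗[k] C) ⊗[k] H →ₗ[k] H ⊗[k] (H ⊗[k] C) :=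
  (LinearMap.mul' k H ∘ₗ (TensorProduct.comm k H H).toLinearMap).rTensor (H ⊗[k] C) ∘ₗ
    (TensorProduct.assoc k H H (H ⊗[k] C)).symm.toLinearMap ∘ₗ (comulFirst k H C).lTensor H ∘ₗ
    (TensorProduct.comm k (H ⊗[k] C) H).toLinearMap

/-- A (symmetric) left partial coaction of `H` on the coalgebra `C`, making `C` a left partial
`H`-comodule coalgebra. In Sweedler notation `λ(c) = c^[-1] ⊗ c^[0]` the axioms are
* `c^[-1] ⊗ c^[0]₁ ⊗ c^[0]₂ = c₁^[-1] c₂^[-1] ⊗ c₁^[0] ⊗ c₂^[0]`;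
* `ε(c^[-1]) c^[0] = c`;
* `c^[-1] ⊗ c^[0][-1] ⊗ c^[0][0] = ∇(c₁) c₂^[-1]₁ ⊗ c₂^[-1]₂ ⊗ c₂^[0]`;
* `c^[-1] ⊗ c^[0][-1] ⊗ c^[0][0] = c₁^[-1]₁ ∇(c₂) ⊗ c₁^[-1]₂ ⊗ c₁^[0]`. -/
structure LeftPartialCoaction where
  coact : C →ₗ[k] H ⊗[k] C
  comul_coact : comul.lTensor H ∘ₗ coact =
    mulFirst k H C ∘ₗ TensorProduct.map coact coact ∘ₗ comul
  counit_coact : (TensorProduct.lid k C).toLinearMap ∘ₗ counit.rTensor C ∘ₗ coact = LinearMap.id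
  coact_coact_left : coact.lTensor H ∘ₗ coact =
    mulComulLeft k H C ∘ₗ TensorProduct.map (nabla coact) coact ∘ₗ comul
  coact_coact_right : coact.lTensor H ∘ₗ coact =
    mulComulRight k H C ∘ₗ TensorProduct.map coact (nabla coact) ∘ₗ comul

/-- `(y ⊗ (a ⊗ z)) ⊗ (h ⊗ g) ↦ (y ⊗ a h) ⊗ (z ⊗ g)`. -/
def cosmashShuffle : (C ⊗[k] (H ⊗[k] C)) ⊗[k] (H ⊗[k] H) →ₗ[k] (C ⊗[k] H) ⊗[k] (C ⊗[k] H) :=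
  ((LinearMap.mul' k H).lTensor C ∘ₗ (TensorProduct.assoc k C H H).toLinearMap).rTensor
      (C ⊗[k] H) ∘ₗ
    (TensorProduct.tensorTensorTensorComm k (C ⊗[k] H) C H H).toLinearMap ∘ₗ
    (TensorProduct.assoc k C H C).symm.toLinearMap.rTensor (H ⊗[k] H)

variable {k H C}

@[simp] theorem mulFirst_tmul (a b : H) (c d : C) :
    mulFirst k H C ((a ⊗ₜ c) ⊗ₜ (b ⊗ₜ d)) = (a * b) ⊗ₜ (c ⊗ₜ d) := rfl

@[simp] theorem comulFirst_tmul (b : H) (c : C) :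
    comulFirst k H C (b ⊗ₜ c) = TensorProduct.assoc k H H C (comul b ⊗ₜ c) := rfl

@[simp] theorem cosmashShuffle_tmul (y z : C) (a h g : H) :
    cosmashShuffle k H C ((y ⊗ₜ (a ⊗ₜ z)) ⊗ₜ (h ⊗ₜ g)) = (y ⊗ₜ (a * h)) ⊗ₜ (z ⊗ₜ g) := rfl

namespace LeftPartialCoaction

variable (L : LeftPartialCoaction k H C)

/-- `x ⊗ h ↦ x₁ ⊗ ∇(x₂) h`. -/
def cosmashProj : C ⊗[k] H →ₗ[k] C ⊗[k] H :=
  (LinearMap.mul' k H).lTensor C ∘ₗ (TensorProduct.assoc k C H H).toLinearMap ∘ₗ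
    ((nabla L.coact).lTensor C ∘ₗ comul).rTensor H

/-- `x ⊗ h ↦ (x₁ ⊗ x₂^[-1] h₁) ⊗ (x₂^[0] ⊗ h₂)`. -/
def cosmashComul : C ⊗[k] H →ₗ[k] (C ⊗[k] H) ⊗[k] (C ⊗[k] H) :=
  cosmashShuffle k H C ∘ₗ TensorProduct.map (L.coact.lTensor C ∘ₗ comul) comul

/-- `x ⊗ h ↦ ε(x) ε(h)`. -/
def cosmashCounit (k : Type u) (H : Type v) (C : Type w) [Field k] [Ring H] [HopfAlgebra k H]
    [AddCommGroup C] [Module k C] [Coalgebra k C] : C ⊗[k] H →ₗ[k] k :=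
  (TensorProduct.lid k k).toLinearMap ∘ₗ TensorProduct.map counit counit

theorem coact_nabla_right (x : C) :
    (LinearMap.mul' k H).rTensor C ((TensorProduct.assoc k H H C).symm
      ((TensorProduct.comm k C H).toLinearMap.lTensor H (TensorProduct.assoc k H C H
        (TensorProduct.map L.coact (nabla L.coact) (comul x))))) = L.coact x := by
  have h1 := congrArg ((TensorProduct.rid k C).toLinearMap.lTensor H)
    (congrArg ((counit.lTensor C).lTensor H) (LinearMap.congr_fun L.comul_coact x))
  have h2 : ∀ t : H ⊗[k] C, (TensorProduct.rid k C).toLinearMap.lTensor H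
      ((counit.lTensor C).lTensor H (comul.lTensor H t)) = t := by
    intro t
    induction t with
    | zero => simp
    | add a b ha hb => simp only [map_add, ha, hb]
    | tmul a b => simp
  have h3 : ∀ t : C ⊗[k] C, (TensorProduct.rid k C).toLinearMap.lTensor H
      ((counit.lTensor C).lTensor H (mulFirst k H C (TensorProduct.map L.coact L.coact t))) =
      (LinearMap.mul' k H).rTensor C ((TensorProduct.assoc k H H C).symm
      ((TensorProduct.comm k C H).toLinearMap.lTensor H (TensorProduct.assoc k H C H
        (TensorProduct.map L.coact (nabla L.coact) t)))) := by
    intro t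
    induction t with
    | zero => simp
    | add a b ha hb => simp only [map_add, ha, hb]
    | tmul a b =>
      simp only [TensorProduct.map_tmul, nabla, LinearMap.comp_apply]
      generalize L.coact a = s
      generalize L.coact b = r
      induction s with
      | zero => simp
      | add a b ha hb => simp only [map_add, ha, hb, TensorProduct.add_tmul]
      | tmul a c =>
        induction r with
        | zero => simp
        | add a b ha hb => simp only [map_add, ha, hb, TensorProduct.tmul_add]
        | tmul b d => simp
  simp only [LinearMap.comp_apply, h2, h3] at h1
  exact h1.symm

/-- `(a ⊗ c) ⊗ (b ⊗ d) ↦ a b₁ ⊗ (c ⊗ (b₂ ⊗ d))`. -/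
def mulComulSecond : (H ⊗[k] C) ⊗[k] (H ⊗[k] C) →ₗ[k] H ⊗[k] (C ⊗[k] (H ⊗[k] C)) :=
  (LinearMap.mul' k H).rTensor (C ⊗[k] (H ⊗[k] C)) ∘ₗ
    (TensorProduct.tensorTensorTensorComm k H C H (H ⊗[k] C)).toLinearMap ∘ₗ
    (comulFirst k H C).lTensor (H ⊗[k] C)

theorem coact_comul_coact (x : C) :
    (L.coact.lTensor C ∘ₗ comul).lTensor H (L.coact x) =
      mulComulSecond (TensorProduct.map L.coact L.coact (comul x)) := by
  let M : (H ⊗[k] C) ⊗[k] (H ⊗[k] (H ⊗[k] C)) →ₗ[k] H ⊗[k] (C ⊗[k] (H ⊗[k] C)) :=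
    (LinearMap.mul' k H).rTensor (C ⊗[k] (H ⊗[k] C)) ∘ₗ
    (TensorProduct.tensorTensorTensorComm k H C H (H ⊗[k] C)).toLinearMap
  have h1 : (L.coact.lTensor C ∘ₗ comul).lTensor H (L.coact x) =
      (L.coact.lTensor C).lTensor H (comul.lTensor H (L.coact x)) := by
    rw [LinearMap.lTensor_comp]; rfl
  have h2 : ∀ t : C ⊗[k] C, (L.coact.lTensor C).lTensor H
      (mulFirst k H C (TensorProduct.map L.coact L.coact t)) =
      M (TensorProduct.map L.coact (L.coact.lTensor H ∘ₗ L.coact) t) := by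
    intro t
    induction t with
    | zero => simp
    | add a b ha hb => simp only [map_add, ha, hb]
    | tmul a b =>
      simp only [TensorProduct.map_tmul, LinearMap.comp_apply]
      generalize L.coact a = s
      generalize L.coact b = r
      induction s with
      | zero => simp
      | add a b ha hb => simp only [map_add, ha, hb, TensorProduct.add_tmul]
      | tmul a c =>
        induction r with
        | zero => simp
        | add a b ha hb => simp only [map_add, ha, hb, TensorProduct.tmul_add]
        | tmul b d => simp [M]
  have h3 : ∀ t : C ⊗[k] C, M (TensorProduct.map L.coact (L.coact.lTensor H ∘ₗ L.coact) t) =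
      M ((mulComulLeft k H C).lTensor (H ⊗[k] C) (TensorProduct.map L.coact
        (TensorProduct.map (nabla L.coact) L.coact) (comul.lTensor C t))) := by
    intro t
    rw [L.coact_coact_left]
    induction t with
    | zero => simp
    | add a b ha hb => simp only [map_add, ha, hb]
    | tmul a b => simp
  have h4 : ∀ t : C ⊗[k] C, M ((mulComulLeft k H C).lTensor (H ⊗[k] C) (TensorProduct.map L.coact
        (TensorProduct.map (nabla L.coact) L.coact)
          (TensorProduct.assoc k C C C (comul.rTensor C t)))) =
      mulComulSecond (TensorProduct.map L.coact L.coact t) := by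
    intro t
    induction t with
    | zero => simp
    | add a b ha hb => simp only [map_add, ha, hb]
    | tmul a b =>
      simp only [TensorProduct.map_tmul, LinearMap.rTensor_tmul]
      rw [← L.coact_nabla_right a]
      generalize comul (R := k) a = s
      generalize hr : L.coact b = r
      induction s with
      | zero => simp
      | add a b ha hb => simp only [map_add, ha, hb, TensorProduct.add_tmul]
      | tmul a c =>
        simp only [TensorProduct.map_tmul, TensorProduct.assoc_tmul, hr]
        clear hr
        generalize L.coact a = s
        generalize nabla L.coact c = n
        induction s with
        | zero => simp
        | add a b ha hb => simp only [map_add, ha, hb, TensorProduct.add_tmul]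
        | tmul a c =>
          induction r with
          | zero => simp
          | add a b ha hb => simp only [map_add, ha, hb, TensorProduct.tmul_add]
          | tmul b d =>
            simp only [mulComulLeft, mulComulSecond, LinearMap.comp_apply, LinearMap.lTensor_tmul,
              comulFirst_tmul, TensorProduct.assoc_tmul, LinearEquiv.coe_coe,
              TensorProduct.comm_tmul, TensorProduct.assoc_symm_tmul, LinearMap.rTensor_tmul,
              LinearMap.mul'_apply]
            generalize comul (R := k) b = q
            induction q with
            | zero => simp
            | add a b ha hb => simp only [map_add, ha, hb, TensorProduct.add_tmul, TensorProduct.tmul_add]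
            | tmul b e => simp [M, mul_assoc]
  have h5 := LinearMap.congr_fun L.comul_coact x
  simp only [LinearMap.comp_apply] at h5
  rw [h1, h5, h2, h3, ← coassoc_apply, h4]

/-- `(y ⊗ (a ⊗ (c ⊗ (b ⊗ d)))) ⊗ (h ⊗ (g ⊗ f)) ↦ (y ⊗ a h) ⊗ ((c ⊗ b g) ⊗ (d ⊗ f))`. -/
def cosmashShuffle₂ : (C ⊗[k] (H ⊗[k] (C ⊗[k] (H ⊗[k] C)))) ⊗[k] (H ⊗[k] (H ⊗[k] H)) →ₗ[k]
    (C ⊗[k] H) ⊗[k] ((C ⊗[k] H) ⊗[k] (C ⊗[k] H)) :=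
  ((LinearMap.mul' k H).lTensor C ∘ₗ (TensorProduct.assoc k C H H).toLinearMap).rTensor
      ((C ⊗[k] H) ⊗[k] (C ⊗[k] H)) ∘ₗ
    (cosmashShuffle k H C).lTensor ((C ⊗[k] H) ⊗[k] H) ∘ₗ
    (TensorProduct.tensorTensorTensorComm k (C ⊗[k] H) (C ⊗[k] (H ⊗[k] C)) H
      (H ⊗[k] H)).toLinearMap ∘ₗ
    (TensorProduct.assoc k C H (C ⊗[k] (H ⊗[k] C))).symm.toLinearMap.rTensor
      (H ⊗[k] (H ⊗[k] H))

theorem cosmashShuffle₂_tmul (y c d : C) (a b h g f : H) :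
    cosmashShuffle₂ (k := k) ((y ⊗ₜ (a ⊗ₜ (c ⊗ₜ (b ⊗ₜ d)))) ⊗ₜ (h ⊗ₜ (g ⊗ₜ f))) =
      (y ⊗ₜ (a * h)) ⊗ₜ ((c ⊗ₜ (b * g)) ⊗ₜ (d ⊗ₜ f)) := rfl

theorem cosmash_coassoc_left : ∀ (t : C ⊗[k] C) (s : H ⊗[k] H),
    TensorProduct.assoc k _ _ _ (L.cosmashComul.rTensor (C ⊗[k] H)
      (cosmashShuffle k H C (L.coact.lTensor C t ⊗ₜ s))) =
    cosmashShuffle₂ ((mulComulSecond ∘ₗ TensorProduct.map L.coact L.coact).lTensor C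
      (TensorProduct.assoc k C C C (comul.rTensor C t)) ⊗ₜ
      TensorProduct.assoc k H H H (comul.rTensor H s)) := by
  intro t s
  induction t with
  | zero => simp
  | add a b ha hb => simp only [map_add, ha, hb, TensorProduct.add_tmul]
  | tmul x y =>
    induction s with
    | zero => simp
    | add a b ha hb => simp only [map_add, ha, hb, TensorProduct.tmul_add]
    | tmul h g =>
      simp only [LinearMap.lTensor_tmul, LinearMap.rTensor_tmul]
      have e1 : ∀ (p : C ⊗[k] C), (mulComulSecond ∘ₗ TensorProduct.map L.coact L.coact).lTensor C
          (TensorProduct.assoc k C C C (p ⊗ₜ[k] y)) =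
          (mulComulSecond (k := k)).lTensor C (TensorProduct.assoc k C (H ⊗[k] C) (H ⊗[k] C)
            (L.coact.lTensor C p ⊗ₜ[k] L.coact y)) := by
        intro p
        induction p with
        | zero => simp
        | add a b ha hb => simp only [map_add, ha, hb, TensorProduct.add_tmul]
        | tmul a b => simp
      rw [e1]
      generalize L.coact y = r
      induction r with
      | zero => simp
      | add a b ha hb =>
        simp only [map_add, ha, hb, TensorProduct.tmul_add, TensorProduct.add_tmul]
      | tmul a z =>
        simp only [cosmashShuffle_tmul, LinearMap.rTensor_tmul, cosmashComul,
          LinearMap.comp_apply, TensorProduct.map_tmul, Bialgebra.comul_mul]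
        generalize L.coact.lTensor C (comul x) = q
        induction q with
        | zero => simp
        | add a b ha hb => simp only [map_add, ha, hb, TensorProduct.add_tmul]
        | tmul x₁ q =>
          induction q with
          | zero => simp
          | add a b ha hb =>
            simp only [map_add, ha, hb, TensorProduct.tmul_add, TensorProduct.add_tmul]
          | tmul b w =>
            simp only [TensorProduct.assoc_tmul, LinearMap.lTensor_tmul, mulComulSecond,
              LinearMap.comp_apply, comulFirst_tmul]
            generalize comul (R := k) a = α
            generalize comul (R := k) h = η
            induction α with
            | zero => simp
            | add a b ha hb =>
              simp only [map_add, ha, hb, TensorProduct.tmul_add, TensorProduct.add_tmul,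
                add_mul]
            | tmul a₁ a₂ =>
              induction η with
              | zero => simp
              | add a b ha hb =>
                simp only [map_add, ha, hb, TensorProduct.tmul_add, TensorProduct.add_tmul,
                  mul_add]
              | tmul h₁ h₂ => simp [cosmashShuffle₂_tmul, mul_assoc]

theorem cosmash_coassoc_right : ∀ (t : C ⊗[k] C) (s : H ⊗[k] H),
    L.cosmashComul.lTensor (C ⊗[k] H)
      (cosmashShuffle k H C (L.coact.lTensor C t ⊗ₜ s)) =
    cosmashShuffle₂ ((((L.coact.lTensor C ∘ₗ comul).lTensor H ∘ₗ L.coact).lTensor C t) ⊗ₜ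
      comul.lTensor H s) := by
  intro t s
  induction t with
  | zero => simp
  | add a b ha hb => simp only [map_add, ha, hb, TensorProduct.add_tmul]
  | tmul x y =>
    induction s with
    | zero => simp
    | add a b ha hb => simp only [map_add, ha, hb, TensorProduct.tmul_add]
    | tmul h g =>
      simp only [LinearMap.lTensor_tmul, LinearMap.comp_apply]
      generalize L.coact y = r
      induction r with
      | zero => simp
      | add a b ha hb =>
        simp only [map_add, ha, hb, TensorProduct.tmul_add, TensorProduct.add_tmul]
      | tmul a z =>
        simp only [cosmashShuffle_tmul, LinearMap.lTensor_tmul, cosmashComul,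
          LinearMap.comp_apply, TensorProduct.map_tmul]
        generalize L.coact.lTensor C (comul z) = q
        generalize comul (R := k) g = γ
        rfl

theorem cosmash_counit_left : ∀ (t : C ⊗[k] C) (s : H ⊗[k] H),
    TensorProduct.lid k _ ((cosmashCounit k H C).rTensor _
      (cosmashShuffle k H C (L.coact.lTensor C t ⊗ₜ s))) =
    TensorProduct.lid k C (counit.rTensor C t) ⊗ₜ[k]
      TensorProduct.lid k H (counit.rTensor H s) := by
  intro t s
  induction t with
  | zero => simp
  | add a b ha hb => simp only [map_add, ha, hb, TensorProduct.add_tmul]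
  | tmul x y =>
    induction s with
    | zero => simp
    | add a b ha hb => simp only [map_add, ha, hb, TensorProduct.tmul_add]
    | tmul h g =>
      have h1 := LinearMap.congr_fun L.counit_coact y
      simp only [LinearMap.comp_apply, LinearMap.id_apply] at h1
      simp only [LinearMap.lTensor_tmul, LinearMap.rTensor_tmul, TensorProduct.lid_tmul]
      conv_rhs => rw [← h1]
      generalize L.coact y = r
      induction r with
      | zero => simp
      | add a b ha hb =>
        simp only [map_add, ha, hb, TensorProduct.tmul_add, TensorProduct.add_tmul, smul_add]
      | tmul a z =>
        simp only [cosmashCounit, cosmashShuffle_tmul, LinearMap.rTensor_tmul,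
          LinearMap.comp_apply, TensorProduct.map_tmul, LinearEquiv.coe_coe,
          TensorProduct.lid_tmul, Bialgebra.counit_mul, smul_eq_mul,
          TensorProduct.tmul_smul, ← TensorProduct.smul_tmul', smul_smul]
        congr 1
        ring

theorem cosmash_counit_right : ∀ (t : C ⊗[k] C) (s : H ⊗[k] H),
    TensorProduct.rid k _ ((cosmashCounit k H C).lTensor _
      (cosmashShuffle k H C (L.coact.lTensor C t ⊗ₜ s))) =
    (LinearMap.mul' k H).lTensor C (TensorProduct.assoc k C H H
      ((nabla L.coact).lTensor C t ⊗ₜ TensorProduct.rid k H (counit.lTensor H s))) := by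
  intro t s
  induction t with
  | zero => simp
  | add a b ha hb => simp only [map_add, ha, hb, TensorProduct.add_tmul]
  | tmul x y =>
    induction s with
    | zero => simp
    | add a b ha hb => simp only [map_add, ha, hb, TensorProduct.tmul_add]
    | tmul h g =>
      simp only [LinearMap.lTensor_tmul, nabla, LinearMap.comp_apply]
      generalize L.coact y = r
      induction r with
      | zero => simp
      | add a b ha hb =>
        simp only [map_add, ha, hb, TensorProduct.tmul_add, TensorProduct.add_tmul]
      | tmul a z =>
        simp [cosmashCounit, ← TensorProduct.smul_tmul', smul_smul, mul_comm]

theorem cosmash_isLeftCounital :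
    IsLeftCounital L.cosmashComul (cosmashCounit k H C) L.cosmashProj where
  coassoc m := by
    have hc : (mulComulSecond ∘ₗ TensorProduct.map L.coact L.coact) ∘ₗ comul =
        (L.coact.lTensor C ∘ₗ comul).lTensor H ∘ₗ L.coact :=
      LinearMap.ext fun x => (L.coact_comul_coact x).symm
    induction m with
    | zero => simp
    | add a b ha hb => simp only [map_add, ha, hb]
    | tmul x h =>
      have h1 := L.cosmash_coassoc_left (comul x) (comul h)
      have h2 := L.cosmash_coassoc_right (comul x) (comul h)
      rw [coassoc_apply, coassoc_apply, ← LinearMap.lTensor_comp_apply, hc,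
        ← h2] at h1
      exact h1
  left m := by
    induction m with
    | zero => simp
    | add a b ha hb => simp only [map_add, ha, hb]
    | tmul x h =>
      have := L.cosmash_counit_left (comul x) (comul h)
      simp only [rTensor_counit_comul, TensorProduct.lid_tmul, one_smul] at this
      exact this
  right m := by
    induction m with
    | zero => simp
    | add a b ha hb => simp only [map_add, ha, hb]
    | tmul x h =>
      have := L.cosmash_counit_right (comul x) (comul h)
      simp only [lTensor_counit_comul, TensorProduct.rid_tmul, one_smul] at this
      exact this

end LeftPartialCoaction
end Comodule

section Comodule

variable {k : Type u} {H : Type v} {C : Type w} [Field k] [Ring H] [HopfAlgebra k H]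
  [AddCommGroup C] [Module k C] [Coalgebra k C]

namespace LeftPartialCoaction

variable (L : LeftPartialCoaction k H C)

/-- The partial cosmash coproduct: the subspace of `C ⊗ H` spanned by the elements
`x₁ ⊗ ∇(x₂) h`. -/
def Cosmash : Type (max w v) := LinearMap.range L.cosmashProj

instance : AddCommGroup L.Cosmash := inferInstanceAs (AddCommGroup (LinearMap.range L.cosmashProj))

instance : Module k L.Cosmash := inferInstanceAs (Module k (LinearMap.range L.cosmashProj))

/-- The linear map `C ⊗ H → Cosmash` sending `x ⊗ h` to the element `x >◂ h = x₁ ⊗ ∇(x₂) h`. -/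
def cosmashMk : C ⊗[k] H →ₗ[k] L.Cosmash := L.cosmashProj.rangeRestrict

instance : Coalgebra k L.Cosmash := L.cosmash_isLeftCounital.coalgebra

/-- `Δ(x >◂ h) = (x₁ >◂ x₂^[-1] h₁) ⊗ (x₂^[0] >◂ h₂)`. -/
theorem comul_cosmashMk (t : C ⊗[k] H) : comul (R := k) (L.cosmashMk t) =
    TensorProduct.map L.cosmashMk L.cosmashMk (L.cosmashComul t) :=
  L.cosmash_isLeftCounital.comulRange_apply t

/-- `ε(x >◂ h) = ε(x) ε(h)`. -/
theorem counit_cosmashMk (x : C) (h : H) :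
    counit (R := k) (L.cosmashMk (x ⊗ₜ h)) = counit (R := k) x * counit (R := k) h :=
  L.cosmash_isLeftCounital.counit_proj (x ⊗ₜ h)

theorem range_cosmashProj_eq_span : LinearMap.range L.cosmashProj =
    Submodule.span k {t | ∃ (x : C) (h : H), L.cosmashProj (x ⊗ₜ h) = t} := by
  rw [LinearMap.range_eq_map, ← TensorProduct.span_tmul_eq_top, Submodule.map_span]
  congr 1
  ext t
  simp only [Set.mem_image, Set.mem_ofPred_eq]
  constructor
  · rintro ⟨_, ⟨x, h, rfl⟩, rfl⟩
    exact ⟨x, h, rfl⟩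
  · rintro ⟨x, h, rfl⟩
    exact ⟨_, ⟨x, h, rfl⟩, rfl⟩

/-- The map `ω₀ : Cosmash → H`, `x >◂ h ↦ ∇(x) h`, which is the restriction of `ε ⊗ id`. -/
def omega₀ : L.Cosmash →ₗ[k] H :=
  (TensorProduct.lid k H).toLinearMap ∘ₗ counit.rTensor H ∘ₗ
    (LinearMap.range L.cosmashProj).subtype

theorem omega₀_cosmashMk (x : C) (h : H) :
    L.omega₀ (L.cosmashMk (x ⊗ₜ h)) = nabla L.coact x * h := by
  have h1 : ∀ t : C ⊗[k] C, TensorProduct.lid k H (counit.rTensor H ((LinearMap.mul' k H).lTensor C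
      (TensorProduct.assoc k C H H ((nabla L.coact).lTensor C t ⊗ₜ h)))) =
      nabla L.coact (TensorProduct.lid k C (counit.rTensor C t)) * h := by
    intro t
    induction t with
    | zero => simp
    | add a b ha hb => simp only [map_add, ha, hb, TensorProduct.add_tmul, add_mul]
    | tmul a b => simp
  refine (h1 (comul x)).trans ?_
  rw [rTensor_counit_comul, TensorProduct.lid_tmul, one_smul]

end LeftPartialCoaction
end Comodule

end
end HopfPar

open HopfPar

/-!
All identities are checked in convolution rings. For a coalgebra `X` and an algebra `A`, the linear
maps `X → A` form a ring under `(f * g)(x) = f(x₁) g(x₂)`, and algebra morphisms `A → B` and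
coalgebra morphisms `Y → X` induce ring morphisms. For a partial corepresentation `p : X → H` put
`q = S ∘ p` and `E = p * q`, and let the indices `1`, `2`, `Δ` denote composition with `h ↦ h ⊗ 1`,
`h ↦ 1 ⊗ h` and `Δ`. Contracting the two axioms suitably (`IsPartialCorep.left_contract`,
`IsPartialCorep.right_contract`) yields `p * q * p = p`, `q * p * q = q`, the remaining exchange
rules such as `q₁ * p_Δ = q₁ * p₁ * p₂`, the identity `p₁ * E₂ * q₁ = E_Δ * E₁`, and the fact that
`E₂` commutes with `q₁ * p₁`.

Elements of the base coalgebra `C` are handled by functionals. A multiplicative set of functionals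
on the cofree coalgebra which contains all `f ∘ p` separates points, because its annihilator is a
coideal contained in the kernel of `p` (`CofreeCoalgebra.separating`). Consider the functionals `b`
on `C` for which `β = b ∘ Ē` commutes with `q * p` and `p * β * q` factors through `Ē`. They form a
submonoid (`Hpar.baseFunctionals`): if `β'` commutes with `q * p`, then
`p * β * β' * q = (p * β * q) * (p * β' * q)`. By the last two identities above it contains all
functionals which factor through the projection to `H`, so it separates the points of `C`.

Contracting `p(x₁) S(p(x₃)) ⊗ Ē(x₂)` with such a `b` gives `p * β * q`. Hence the formula depends
only on `Ē(x)`, which defines the coaction (`Hpar.exists_coact`), and each axiom of a partial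
coaction becomes an identity between convolution products of `p`, `q` and `β`. The
comultiplicativity of `Φ` is tested in the same way (`Hpar.cosmashComul_Ebar_proj`).

That `ω₀` is a partial corepresentation holds for every partial coaction. It rests on
`c^[-1] ⊗ ∇(c^[0]) = ∇(c₁) ∇(c₂)₁ ⊗ ∇(c₂)₂ = ∇(c₁)₁ ∇(c₂) ⊗ ∇(c₁)₂`, which also gives
`ω₀(y₁) S(ω₀(y₂)) = ε(h) ∇(c)` for `y = c >◂ h`. Since `∇` is the projection `C → H`, uniqueness of
lifts to the cofree coalgebra shows that `Ē ∘ ω̄₀` is `c >◂ h ↦ ε(h) c`; therefore `Φ ∘ ω̄₀ = id`.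
The relation `p * q * p = p` gives `ω₀ ∘ Φ = p`, and therefore `ω̄₀ ∘ Φ = id`.
-/

namespace HopfPar
open WithConv

/-! ### Convolution rings and the antipode -/

section Convolution

variable {k X Y A B : Type*} [Field k] [AddCommGroup X] [Module k X] [Coalgebra k X]
  [AddCommGroup Y] [Module k Y] [Coalgebra k Y] [Ring A] [Algebra k A] [Ring B] [Algebra k B]

/-- Postcomposition with an algebra morphism, as a morphism of convolution rings. -/
noncomputable def convMap (g : A →ₐ[k] B) : WithConv (X →ₗ[k] A) →+* WithConv (X →ₗ[k] B) where
  toFun f := toConv (g.toLinearMap ∘ₗ f.ofConv)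
  map_one' := by ext x; simp
  map_mul' f f' := congrArg toConv (LinearMap.algHom_comp_convMul_distrib g f f')
  map_zero' := by ext x; simp
  map_add' f f' := by ext x; simp

/-- Precomposition with a coalgebra morphism, as a morphism of convolution rings. -/
noncomputable def convComap (F : X →ₗc[k] Y) : WithConv (Y →ₗ[k] A) →+* WithConv (X →ₗ[k] A) where
  toFun f := toConv (f.ofConv ∘ₗ F.toLinearMap)
  map_one' := by ext x; simp
  map_mul' f f' := congrArg toConv (LinearMap.convMul_comp_coalgHom_distrib f f' F)
  map_zero' := by ext x; simp
  map_add' f f' := by ext x; simp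

/-- A functional on `X`, viewed as an `A`-valued convolution element through `k → A`. -/
noncomputable abbrev convScalar (A : Type*) [Ring A] [Algebra k A] :
    WithConv (X →ₗ[k] k) →+* WithConv (X →ₗ[k] A) := convMap (Algebra.ofId k A)

@[simp] theorem convMap_apply (g : A →ₐ[k] B) (f : WithConv (X →ₗ[k] A)) (x : X) :
    (convMap g f).ofConv x = g (f.ofConv x) := rfl

@[simp] theorem convComap_apply (F : X →ₗc[k] Y) (f : WithConv (Y →ₗ[k] A)) (x : X) :
    (convComap F f).ofConv x = f.ofConv (F x) := rfl

theorem convMap_convScalar (g : A →ₐ[k] B) (f : WithConv (X →ₗ[k] k)) :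
    convMap g (convScalar A f) = convScalar B f := by
  ext x
  simp [Algebra.ofId_apply]

/-- In Sweedler notation, the convolution product of `x ↦ f(x) ⊗ 1` and `x ↦ 1 ⊗ g(x)` is
`x ↦ f(x₁) ⊗ g(x₂)`. The reverse product is `x ↦ f(x₂) ⊗ g(x₁)`, so the two factors need not
commute. -/
theorem includeLeft_mul_includeRight (f : WithConv (X →ₗ[k] A)) (g : WithConv (X →ₗ[k] B)) (x : X) :
    (convMap Algebra.TensorProduct.includeLeft f * convMap Algebra.TensorProduct.includeRight g :
      WithConv (X →ₗ[k] A ⊗[k] B)).ofConv x = TensorProduct.map f.ofConv g.ofConv (comul x) := by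
  change LinearMap.mul' k _ (TensorProduct.map _ _ (comul x)) = _
  generalize comul (R := k) x = t
  induction t with
  | zero => simp
  | add a b ha hb => simp only [map_add, ha, hb]
  | tmul a b => simp

end Convolution

section Hopf

variable {k H : Type*} [Field k] [Ring H] [HopfAlgebra k H]

variable (k H) in
/-- The embedding `h ↦ h ⊗ 1`. -/
noncomputable abbrev inL : H →ₐ[k] H ⊗[k] H := Algebra.TensorProduct.includeLeft

variable (k H) in
/-- The embedding `h ↦ 1 ⊗ h`. -/
noncomputable abbrev inR : H →ₐ[k] H ⊗[k] H := Algebra.TensorProduct.includeRight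

variable (k H) in
/-- The comultiplication as an algebra morphism. -/
noncomputable abbrev inΔ : H →ₐ[k] H ⊗[k] H := Bialgebra.comulAlgHom k H

variable (k H) in
/-- The identity of `H` as a convolution element. -/
noncomputable abbrev cId : WithConv (H →ₗ[k] H) := toConv LinearMap.id

variable (k H) in
/-- The antipode of `H` as a convolution element. -/
noncomputable abbrev cS : WithConv (H →ₗ[k] H) := toConv (HopfAlgebra.antipode k)

theorem cId_mul_cS : cId k H * cS k H = 1 := LinearMap.id_mul_antipode
theorem cS_mul_cId : cS k H * cId k H = 1 := LinearMap.antipode_mul_id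

theorem convMap_inΔ_cId : convMap (inΔ k H) (cId k H) =
    convMap (inL k H) (cId k H) * convMap (inR k H) (cId k H) := by
  ext x
  rw [includeLeft_mul_includeRight]
  simp

/-- The antipode is an anti-morphism of coalgebras: `Δ(S(h)) = S(h₂) ⊗ S(h₁)`. -/
theorem convMap_inΔ_cS : convMap (inΔ k H) (cS k H) =
    convMap (inR k H) (cS k H) * convMap (inL k H) (cS k H) := by
  refine (left_inv_eq_right_inv (a := convMap (inΔ k H) (cId k H)) ?_ ?_)
  · rw [← map_mul, cS_mul_cId, map_one]
  · rw [convMap_inΔ_cId, mul_assoc, ← mul_assoc (convMap (inR k H) (cId k H)), ← map_mul,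
      cId_mul_cS, map_one, one_mul, ← map_mul, cId_mul_cS, map_one]

end Hopf

/-! ### Consequences of the axioms of a partial corepresentation -/

section Corep

variable {k H D A : Type*} [Field k] [Ring H] [HopfAlgebra k H]
  [AddCommGroup D] [Module k D] [Coalgebra k D] [Ring A] [Algebra k A]

/-- `d ↦ S(ω(d))`, as a convolution element. -/
noncomputable abbrev antipodeConv (ω : D →ₗ[k] H) : WithConv (D →ₗ[k] H) :=
  toConv (HopfAlgebra.antipode k ∘ₗ ω)

/-- `d ↦ ω(d₁) S(ω(d₂))`, as a convolution element. -/
noncomputable abbrev idemConv (ω : D →ₗ[k] H) : WithConv (D →ₗ[k] H) :=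
  toConv ω * antipodeConv ω

namespace IsPartialCorep

variable {ω : D →ₗ[k] H} (hω : IsPartialCorep ω)
include hω

theorem one_comp : toConv ((1 : WithConv (H →ₗ[k] A)).ofConv ∘ₗ ω) = 1 := by
  ext d
  exact congrArg (algebraMap k A) (LinearMap.congr_fun hω.counit_comp d)

/-- The left axiom, contracted along `a ⊗ b ↦ u(a) v(b)` for an algebra morphism `v`. -/
theorem left_contract (u : WithConv (H →ₗ[k] A)) (v : H →ₐ[k] A) :
    toConv (u.ofConv ∘ₗ ω) * convMap v (idemConv ω) =
      toConv ((u * toConv v.toLinearMap).ofConv ∘ₗ ω) * convMap v (antipodeConv ω) := by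
  ext d
  have h1 := congrArg (fun t => LinearMap.mul' k A (TensorProduct.map u.ofConv v.toLinearMap t))
    (LinearMap.congr_fun hω.left d)
  have h2 : ∀ t : D ⊗[k] D, LinearMap.mul' k A (TensorProduct.map u.ofConv v.toLinearMap
      ((LinearMap.mul' k H).lTensor H (TensorProduct.assoc k H H H
        (TensorProduct.map (comul ∘ₗ ω) (HopfAlgebra.antipode k ∘ₗ ω) t)))) =
      LinearMap.mul' k A (TensorProduct.map ((u * toConv v.toLinearMap).ofConv ∘ₗ ω)
        (v.toLinearMap ∘ₗ HopfAlgebra.antipode k ∘ₗ ω) t) := by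
    intro t
    induction t with
    | zero => simp
    | add a b ha hb => simp only [map_add, ha, hb]
    | tmul a b =>
      simp only [TensorProduct.map_tmul, LinearMap.comp_apply, LinearMap.mul'_apply,
        LinearMap.convMul_apply]
      generalize comul (R := k) (ω a) = s
      induction s with
      | zero => simp
      | add a b ha hb => simp only [map_add, ha, hb, TensorProduct.add_tmul, add_mul]
      | tmul x y => simp [mul_assoc]
  have h3 : ∀ t : D ⊗[k] D, LinearMap.mul' k A (TensorProduct.map u.ofConv v.toLinearMap
      (TensorProduct.map ω (LinearMap.mul' k H ∘ₗ
        TensorProduct.map ω (HopfAlgebra.antipode k ∘ₗ ω)) (comul.lTensor D t))) =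
      LinearMap.mul' k A (TensorProduct.map (u.ofConv ∘ₗ ω)
        (v.toLinearMap ∘ₗ (idemConv ω).ofConv) t) := by
    intro t
    induction t with
    | zero => simp
    | add a b ha hb => simp only [map_add, ha, hb]
    | tmul a b => rfl
  exact (h3 (comul d)).symm.trans (h1.symm.trans (h2 (comul d)))

/-- The right axiom, contracted along `a ⊗ b ↦ u(a) v(b)` for an algebra morphism `u`. -/
theorem right_contract (u : H →ₐ[k] A) (v : WithConv (H →ₗ[k] A)) :
    convMap u (idemConv ω) * toConv (v.ofConv ∘ₗ ω) =
      convMap u (toConv ω) * toConv ((convMap u (cS k H) * v).ofConv ∘ₗ ω) := by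
  ext d
  have h1 := congrArg (fun t => LinearMap.mul' k A (TensorProduct.map u.toLinearMap v.ofConv t))
    (LinearMap.congr_fun hω.right d)
  have h2 : ∀ t : D ⊗[k] D, LinearMap.mul' k A (TensorProduct.map u.toLinearMap v.ofConv
      ((LinearMap.mul' k H ∘ₗ (HopfAlgebra.antipode k).lTensor H).rTensor H
        ((TensorProduct.assoc k H H H).symm (TensorProduct.map ω (comul ∘ₗ ω) t)))) =
      LinearMap.mul' k A (TensorProduct.map (u.toLinearMap ∘ₗ ω)
        ((convMap u (cS k H) * v).ofConv ∘ₗ ω) t) := by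
    intro t
    induction t with
    | zero => simp
    | add a b ha hb => simp only [map_add, ha, hb]
    | tmul a b =>
      simp only [TensorProduct.map_tmul, LinearMap.comp_apply, LinearMap.mul'_apply,
        LinearMap.convMul_apply]
      generalize comul (R := k) (ω b) = s
      induction s with
      | zero => simp
      | add a b ha hb => simp only [map_add, ha, hb, TensorProduct.tmul_add, mul_add]
      | tmul x y => simp [mul_assoc]
  have h3 : ∀ t : D ⊗[k] D, LinearMap.mul' k A (TensorProduct.map u.toLinearMap v.ofConv
      (TensorProduct.map (LinearMap.mul' k H ∘ₗ
        TensorProduct.map ω (HopfAlgebra.antipode k ∘ₗ ω)) ω (comul.rTensor D t))) =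
      LinearMap.mul' k A (TensorProduct.map (u.toLinearMap ∘ₗ (idemConv ω).ofConv)
        (v.ofConv ∘ₗ ω) t) := by
    intro t
    induction t with
    | zero => simp
    | add a b ha hb => simp only [map_add, ha, hb]
    | tmul a b => rfl
  exact (h3 (comul d)).symm.trans (h1.symm.trans (h2 (comul d)))

/-- `ω(d₁) S(ω(d₂)) ω(d₃) = ω(d)`. -/
theorem idem_mul_self : idemConv ω * toConv ω = toConv ω := by
  have h := hω.right_contract (AlgHom.id k H) (cId k H)
  have e : convMap (AlgHom.id k H) (cS k H) * cId k H = 1 := cS_mul_cId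
  rw [e, hω.one_comp, mul_one] at h
  exact h

/-- `S(ω(d₁)) ω(d₂) S(ω(d₃)) = S(ω(d))`. -/
theorem antipode_mul_idem : antipodeConv ω * idemConv ω = antipodeConv ω := by
  have h := hω.left_contract (cS k H) (AlgHom.id k H)
  have e : cS k H * toConv (AlgHom.id k H).toLinearMap = 1 := cS_mul_cId
  rw [e, hω.one_comp, one_mul] at h
  exact h

/-- `ω(d₁)₁ ⊗ ω(d₁)₂ S(ω(d₂)) = ω(d₁) ⊗ ω(d₂) S(ω(d₃))`. -/
theorem inΔ_mul_inR : convMap (inΔ k H) (toConv ω) * convMap (inR k H) (antipodeConv ω) =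
    convMap (inL k H) (toConv ω) * convMap (inR k H) (idemConv ω) := by
  have h := hω.left_contract (convMap (inL k H) (cId k H)) (inR k H)
  have e : convMap (inL k H) (cId k H) * toConv (inR k H).toLinearMap =
    convMap (inΔ k H) (cId k H) := convMap_inΔ_cId.symm
  rw [e] at h
  exact h.symm

/-- `ω(d₁) S(ω(d₂)) ω(d₃)₁ ⊗ ω(d₃)₂ = ω(d₁) ⊗ ω(d₂)`. -/
theorem inL_idem_mul_inΔ : convMap (inL k H) (idemConv ω) * convMap (inΔ k H) (toConv ω) =
    convMap (inL k H) (toConv ω) * convMap (inR k H) (toConv ω) := by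
  have h := hω.right_contract (inL k H) (convMap (inΔ k H) (cId k H))
  rw [convMap_inΔ_cId, ← mul_assoc, ← map_mul, cS_mul_cId, map_one, one_mul,
    ← convMap_inΔ_cId] at h
  exact h

/-- `S(ω(d₃)) ⊗ ω(d₁) S(ω(d₂)) = S(ω(d₂)₂) ⊗ ω(d₁) S(ω(d₂)₁)`. -/
theorem inR_idem_mul_inL : convMap (inR k H) (idemConv ω) * convMap (inL k H) (antipodeConv ω) =
    convMap (inR k H) (toConv ω) * convMap (inΔ k H) (antipodeConv ω) := by
  have h := hω.right_contract (inR k H) (convMap (inL k H) (cS k H))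
  rw [← convMap_inΔ_cS] at h
  exact h

/-- `E(d₁)₁ ω(d₂) ⊗ E(d₁)₂ = ω(d₁)₁ ⊗ ω(d₁)₂ S(ω(d₂))` for `E(d) = ω(d₁) S(ω(d₂))`. -/
theorem inΔ_idem_mul_inL : convMap (inΔ k H) (idemConv ω) * convMap (inL k H) (toConv ω) =
    convMap (inΔ k H) (toConv ω) * convMap (inR k H) (antipodeConv ω) := by
  have h := hω.right_contract (inΔ k H) (convMap (inL k H) (cId k H))
  rw [convMap_inΔ_cS, mul_assoc, ← map_mul, cS_mul_cId, map_one, mul_one] at h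
  exact h

/-- `S(ω(d₁)₂) E(d₂) ⊗ S(ω(d₁)₁) = S(ω(d₂)) ⊗ S(ω(d₁))` for `E(d) = ω(d₁) S(ω(d₂))`. -/
theorem inΔ_antipode_mul_inL_idem :
    convMap (inΔ k H) (antipodeConv ω) * convMap (inL k H) (idemConv ω) =
      convMap (inR k H) (antipodeConv ω) * convMap (inL k H) (antipodeConv ω) := by
  have h := hω.left_contract (convMap (inΔ k H) (cS k H)) (inL k H)
  have e : toConv (inL k H).toLinearMap = convMap (inL k H) (cId k H) := rfl
  rw [e, convMap_inΔ_cS, mul_assoc, ← map_mul, cS_mul_cId, map_one, mul_one,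
    ← convMap_inΔ_cS] at h
  exact h

/-- `S(ω(d₁)) E(d₂)₁ ⊗ E(d₂)₂ = S(ω(d₂)₂) ⊗ ω(d₁) S(ω(d₂)₁)` for `E(d) = ω(d₁) S(ω(d₂))`. -/
theorem inL_antipode_mul_inΔ_idem :
    convMap (inL k H) (antipodeConv ω) * convMap (inΔ k H) (idemConv ω) =
      convMap (inR k H) (toConv ω) * convMap (inΔ k H) (antipodeConv ω) := by
  have h := hω.left_contract (convMap (inL k H) (cS k H)) (inΔ k H)
  have e : toConv (inΔ k H).toLinearMap = convMap (inΔ k H) (cId k H) := rfl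
  rw [e, convMap_inΔ_cId, ← mul_assoc, ← map_mul, cS_mul_cId, map_one, one_mul] at h
  exact h

/-- `E(d)` and `S(ω(d₁)) ω(d₂)`, placed in different tensor legs, commute. -/
theorem inR_idem_commute : Commute (convMap (inR k H) (idemConv ω))
    (convMap (inL k H) (antipodeConv ω * toConv ω)) := by
  rw [commute_iff_eq, map_mul _ (antipodeConv ω), ← mul_assoc, hω.inR_idem_mul_inL, ← hω.inL_antipode_mul_inΔ_idem,
    mul_assoc, hω.inΔ_idem_mul_inL, hω.inΔ_mul_inR, mul_assoc]

/-- `ω(d₁) S(ω(d₃)) ⊗ E(d₂) = E(d₁)₁ E(d₂) ⊗ E(d₁)₂`. -/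
theorem inL_mul_inR_idem_mul_inL :
    convMap (inL k H) (toConv ω) * convMap (inR k H) (idemConv ω) *
      convMap (inL k H) (antipodeConv ω) =
    convMap (inΔ k H) (idemConv ω) * convMap (inL k H) (idemConv ω) := by
  rw [← hω.inΔ_mul_inR, ← hω.inΔ_idem_mul_inL, mul_assoc, ← map_mul]

/-- `S(ω(d₁)) ω(d₂)₁ ⊗ ω(d₂)₂ = S(ω(d₁)) ω(d₂) ⊗ ω(d₃)`. -/
theorem inL_antipode_mul_inΔ :
    convMap (inL k H) (antipodeConv ω) * convMap (inΔ k H) (toConv ω) =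
      convMap (inL k H) (antipodeConv ω * toConv ω) * convMap (inR k H) (toConv ω) := by
  conv_lhs => rw [← hω.antipode_mul_idem]
  rw [map_mul, mul_assoc, hω.inL_idem_mul_inΔ, ← mul_assoc, ← map_mul]

/-- `S(ω(d₁)₂) ω(d₂) ⊗ S(ω(d₁)₁) = S(ω(d₂)) ω(d₃) ⊗ S(ω(d₁))`. -/
theorem inΔ_antipode_mul_inL :
    convMap (inΔ k H) (antipodeConv ω) * convMap (inL k H) (toConv ω) =
      convMap (inR k H) (antipodeConv ω) * convMap (inL k H) (antipodeConv ω * toConv ω) := by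
  conv_lhs => rw [← hω.idem_mul_self]
  rw [map_mul _ (idemConv ω), ← mul_assoc, hω.inΔ_antipode_mul_inL_idem, mul_assoc, ← map_mul]

end IsPartialCorep
end Corep

/-! ### The universal partial corepresentation and separating functionals -/

section CorepConv

variable {k H D : Type*} [Field k] [Ring H] [HopfAlgebra k H]
  [AddCommGroup D] [Module k D] [Coalgebra k D]

/-- The axioms of a partial corepresentation as identities between `H ⊗ H`-valued convolution
elements. In this form they are visibly compatible with pulling back along coalgebra morphisms. -/
theorem isPartialCorep_iff (ω : D →ₗ[k] H) : IsPartialCorep ω ↔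
    counit ∘ₗ ω = (counit : D →ₗ[k] k) ∧
    convMap (inΔ k H) (toConv ω) * convMap (inR k H) (antipodeConv ω) =
      convMap (inL k H) (toConv ω) * convMap (inR k H) (idemConv ω) ∧
    convMap (inL k H) (toConv ω) *
        toConv ((convMap (inL k H) (cS k H) * convMap (inR k H) (cId k H)).ofConv ∘ₗ ω) =
      convMap (inL k H) (idemConv ω) * convMap (inR k H) (toConv ω) := by
  have l1 : (LinearMap.mul' k H).lTensor H ∘ₗ (TensorProduct.assoc k H H H).toLinearMap ∘ₗ
      TensorProduct.map (comul (R := k) ∘ₗ ω) (HopfAlgebra.antipode k ∘ₗ ω) ∘ₗ comul =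
      (convMap (inΔ k H) (toConv ω) * convMap (inR k H) (antipodeConv ω)).ofConv := by
    ext d
    simp only [LinearMap.comp_apply, LinearMap.convMul_apply]
    generalize comul (R := k) d = t
    induction t with
    | zero => simp
    | add a b ha hb => simp only [map_add, ha, hb]
    | tmul a b =>
      change _ = comul (R := k) (ω a) * (1 ⊗ₜ HopfAlgebra.antipode k (ω b))
      simp only [TensorProduct.map_tmul, LinearMap.comp_apply]
      generalize comul (R := k) (ω a) = s
      induction s with
      | zero => simp
      | add a b ha hb => simp only [map_add, ha, hb, TensorProduct.add_tmul, add_mul]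
      | tmul x y => simp
  have l2 : TensorProduct.map ω (LinearMap.mul' k H ∘ₗ
      TensorProduct.map ω (HopfAlgebra.antipode k ∘ₗ ω)) ∘ₗ comul.lTensor D ∘ₗ comul =
      (convMap (inL k H) (toConv ω) * convMap (inR k H) (idemConv ω)).ofConv := by
    ext d
    rw [includeLeft_mul_includeRight]
    simp only [LinearMap.comp_apply]
    generalize comul (R := k) d = t
    induction t with
    | zero => simp
    | add a b ha hb => simp only [map_add, ha, hb]
    | tmul a b => rfl
  have r1 : (LinearMap.mul' k H ∘ₗ (HopfAlgebra.antipode k).lTensor H).rTensor H ∘ₗ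
      (TensorProduct.assoc k H H H).symm.toLinearMap ∘ₗ
      TensorProduct.map ω (comul (R := k) ∘ₗ ω) ∘ₗ comul =
      (convMap (inL k H) (toConv ω) * toConv ((convMap (inL k H) (cS k H) *
        convMap (inR k H) (cId k H)).ofConv ∘ₗ ω)).ofConv := by
    ext d
    simp only [LinearMap.comp_apply, LinearMap.convMul_apply]
    generalize comul (R := k) d = t
    induction t with
    | zero => simp
    | add a b ha hb => simp only [map_add, ha, hb]
    | tmul a b =>
      simp only [TensorProduct.map_tmul, LinearMap.comp_apply, LinearMap.mul'_apply,
        includeLeft_mul_includeRight]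
      change _ = (ω a ⊗ₜ 1) * _
      generalize comul (R := k) (ω b) = s
      induction s with
      | zero => simp
      | add a b ha hb => simp only [map_add, ha, hb, TensorProduct.tmul_add, mul_add]
      | tmul x y => simp
  have r2 : TensorProduct.map (LinearMap.mul' k H ∘ₗ
      TensorProduct.map ω (HopfAlgebra.antipode k ∘ₗ ω)) ω ∘ₗ comul.rTensor D ∘ₗ comul =
      (convMap (inL k H) (idemConv ω) * convMap (inR k H) (toConv ω)).ofConv := by
    ext d
    rw [includeLeft_mul_includeRight]
    simp only [LinearMap.comp_apply]
    generalize comul (R := k) d = t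
    induction t with
    | zero => simp
    | add a b ha hb => simp only [map_add, ha, hb]
    | tmul a b => rfl
  constructor
  · rintro ⟨h0, h1, h2⟩
    refine ⟨h0, ?_, ?_⟩
    · rw [l1, l2] at h1
      exact ofConv_injective h1
    · rw [r1, r2] at h2
      exact ofConv_injective h2
  · rintro ⟨h0, h1, h2⟩
    refine ⟨h0, ?_, ?_⟩
    · rw [l1, l2, h1]
    · rw [r1, r2, h2]

/-- Linear maps out of `H^par` agree if they agree on each of the subcoalgebras whose sum is
`H^par`. -/
theorem Hpar.linearMap_ext {V : Type*} [AddCommGroup V] [Module k V] {f g : Hpar k H →ₗ[k] V}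
    (h : ∀ S : Subcoalgebra k (CofreeCoalgebra k H),
      IsPartialCorep (CofreeCoalgebra.proj k H ∘ₗ S.toSubmodule.subtype) →
      ∀ F : S →ₗc[k] Hpar k H, (∀ s : S, (F s : CofreeCoalgebra k H) = s) →
      f ∘ₗ F.toLinearMap = g ∘ₗ F.toLinearMap) : f = g := by
  have hle : (hparSubcoalgebra k H).toSubmodule ≤
      (LinearMap.eqLocus f g).map (hparSubcoalgebra k H).toSubmodule.subtype := by
    refine iSup₂_le fun S hS s hs => ?_
    have hmem := fun a : S => Subcoalgebra.le_sum hS a.2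
    exact ⟨⟨s, hmem ⟨s, hs⟩⟩, LinearMap.congr_fun
      (h S hS ((hparSubcoalgebra k H).codRestrict S.incl hmem) fun _ => rfl) ⟨s, hs⟩, rfl⟩
  ext x
  obtain ⟨y, hy, hxy⟩ := hle x.2
  rw [← Subtype.ext hxy]
  exact hy

/-- The restriction of `p` to `H^par` is a partial corepresentation: the axioms are linear
identities that hold on each of the subcoalgebras whose sum is `H^par`. -/
theorem Hpar.isPartialCorep_proj : IsPartialCorep (Hpar.proj k H) := by
  have hF : ∀ {S : Subcoalgebra k (CofreeCoalgebra k H)} (F : S →ₗc[k] Hpar k H),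
      (∀ s : S, (F s : CofreeCoalgebra k H) = s) →
      Hpar.proj k H ∘ₗ F.toLinearMap = CofreeCoalgebra.proj k H ∘ₗ S.toSubmodule.subtype :=
    fun F hF => LinearMap.ext fun s => congrArg (CofreeCoalgebra.proj k H) (hF s)
  refine (isPartialCorep_iff _).2 ⟨linearMap_ext ?_,
    ofConv_injective (linearMap_ext ?_), ofConv_injective (linearMap_ext ?_)⟩ <;> intro S hS F hFS <;> rw [isPartialCorep_iff] at hS
  · rw [LinearMap.comp_assoc, hF F hFS, hS.1]
    exact F.counit_comp.symm
  · refine congrArg ofConv (?_ : convComap F _ = convComap F _)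
    have := hS.2.1
    rw [← hF F hFS] at this
    simp only [idemConv, map_mul] at this ⊢
    exact this
  · refine congrArg ofConv (?_ : convComap F _ = convComap F _)
    have := hS.2.2
    rw [← hF F hFS] at this
    simp only [idemConv, map_mul] at this ⊢
    exact this

end CorepConv

section Separation

variable {k M N : Type*} [Field k] [AddCommGroup M] [Module k M] [AddCommGroup N] [Module k N]

/-- A set of functionals separates points. -/
def Separating (F : Set (N →ₗ[k] k)) : Prop := ∀ n, (∀ f ∈ F, f n = 0) → n = 0

/-- Tensors in `M ⊗ N` are separated by contracting `N` with a separating set of functionals. -/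
theorem Separating.tensor_right {F : Set (N →ₗ[k] k)} (hF : Separating F) {t s : M ⊗[k] N}
    (h : ∀ f ∈ F, TensorProduct.rid k M (f.lTensor M t) = TensorProduct.rid k M (f.lTensor M s)) :
    t = s := by
  classical
  let b := Module.Basis.ofVectorSpace k M
  have key : ∀ (f : N →ₗ[k] k) i (r : M ⊗[k] N), f (TensorProduct.equivFinsuppOfBasisLeft b r i) =
      b.coord i (TensorProduct.rid k M (f.lTensor M r)) := by
    intro f i r
    induction r with
    | zero => simp
    | add x y hx hy => simp only [map_add, Finsupp.add_apply, hx, hy]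
    | tmul x y => simp [mul_comm]
  apply (TensorProduct.equivFinsuppOfBasisLeft b).injective
  ext i
  refine sub_eq_zero.1 (hF _ fun f hf => ?_)
  rw [map_sub, key, key, h f hf, sub_self]

/-- Tensors in `N ⊗ M` are separated by contracting `N` with a separating set of functionals. -/
theorem Separating.tensor_left {F : Set (N →ₗ[k] k)} (hF : Separating F) {t s : N ⊗[k] M}
    (h : ∀ f ∈ F, TensorProduct.lid k M (f.rTensor M t) = TensorProduct.lid k M (f.rTensor M s)) :
    t = s := by
  apply (TensorProduct.comm k N M).injective
  refine hF.tensor_right fun f hf => ?_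
  have e : ∀ r : N ⊗[k] M, TensorProduct.rid k M (f.lTensor M (TensorProduct.comm k N M r)) =
      TensorProduct.lid k M (f.rTensor M r) := by
    intro r
    induction r with
    | zero => simp
    | add x y hx hy => simp only [map_add, hx, hy]
    | tmul x y => simp
  rw [e, e, h f hf]

/-- Products `f ⊗ g` of functionals from separating sets separate the points of `M ⊗ N`. -/
theorem Separating.tensor {F : Set (M →ₗ[k] k)} {G : Set (N →ₗ[k] k)} (hF : Separating F)
    (hG : Separating G) :
    Separating {b : M ⊗[k] N →ₗ[k] k | ∃ f ∈ F, ∃ g ∈ G,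
      b = LinearMap.mul' k k ∘ₗ TensorProduct.map f g} := by
  intro t ht
  refine hG.tensor_right fun g hg => ?_
  rw [map_zero, map_zero]
  refine hF _ fun f hf => ?_
  rw [← ht _ ⟨f, hf, g, hg, rfl⟩]
  generalize t = r
  induction r with
  | zero => simp
  | add x y hx hy => simp only [map_add, hx, hy]
  | tmul x y => simp [mul_comm]

/-- A multiplicative set of functionals on the cofree coalgebra that contains all functionals
factoring through `p` separates points: its annihilator is a coideal on which `p` vanishes. -/
theorem CofreeCoalgebra.separating {V : Type*} [AddCommGroup V] [Module k V]
    (B : Submonoid (WithConv (CofreeCoalgebra k V →ₗ[k] k)))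
    (hB : ∀ f : V →ₗ[k] k, toConv (f ∘ₗ CofreeCoalgebra.proj k V) ∈ B) :
    Separating {f : CofreeCoalgebra k V →ₗ[k] k | toConv f ∈ B} := by
  let N : Submodule k (CofreeCoalgebra k V) := ⨅ b ∈ B, LinearMap.ker b.ofConv
  have hN : ∀ n, n ∈ N ↔ ∀ b ∈ B, b.ofConv n = 0 := fun n => by simp [N]
  have hle : ∀ b ∈ B, N ≤ LinearMap.ker b.ofConv := fun b hb n hn => (hN n).1 hn b hb
  have hsep : Separating {f : CofreeCoalgebra k V ⧸ N →ₗ[k] k | toConv (f ∘ₗ N.mkQ) ∈ B} := by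
    intro n hn
    obtain ⟨n, rfl⟩ := N.mkQ_surjective n
    refine (Submodule.Quotient.mk_eq_zero _).2 ((hN n).2 fun b hb => ?_)
    exact hn (N.liftQ b.ofConv (hle b hb)) hb
  have hco : N.IsCoideal := by
    refine ⟨fun n hn => (hN n).1 hn 1 B.one_mem, fun n hn => ?_⟩
    refine hsep.tensor hsep _ ?_
    rintro _ ⟨f, hf, g, hg, rfl⟩
    rw [LinearMap.comp_apply, TensorProduct.map_map]
    exact (hN n).1 hn _ (B.mul_mem hf hg)
  have hbot := coideal_eq_bot N hco fun n hn => by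
    refine (Module.forall_dual_apply_eq_zero_iff k _).1 fun f => ?_
    exact (hN n).1 hn _ (hB f)
  intro n hn
  have : n ∈ N := (hN n).2 fun b hb => hn b.ofConv hb
  rwa [hbot] at this

end Separation

/-! ### Functionals on the base coalgebra -/

section Contraction

variable {k X A : Type*} [Field k] [AddCommGroup X] [Module k X] [Coalgebra k X]
  [Ring A] [Algebra k A]

/-- Contracting the second leg of the `A ⊗ B`-valued convolution product `(φ ⊗ 1) * T * (φ' ⊗ 1)`
with a functional: the outer factors are untouched. -/
theorem contract_mul_mul {B : Type*} [Ring B] [Algebra k B] (f : B →ₗ[k] k)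
    (φ φ' : WithConv (X →ₗ[k] A)) (T : WithConv (X →ₗ[k] A ⊗[k] B)) (x : X) :
    TensorProduct.rid k A (f.lTensor A
      ((convMap Algebra.TensorProduct.includeLeft φ * T *
        convMap Algebra.TensorProduct.includeLeft φ').ofConv x)) =
      (φ * toConv ((TensorProduct.rid k A).toLinearMap ∘ₗ f.lTensor A ∘ₗ T.ofConv) *
        φ').ofConv x := by
  have hl : ∀ (a : A) (t : A ⊗[k] B), TensorProduct.rid k A (f.lTensor A ((a ⊗ₜ 1) * t)) =
      a * TensorProduct.rid k A (f.lTensor A t) := by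
    intro a t
    induction t with
    | zero => simp
    | add x y hx hy => simp only [map_add, hx, hy, mul_add]
    | tmul x y => simp
  have hr : ∀ (a : A) (t : A ⊗[k] B), TensorProduct.rid k A (f.lTensor A (t * (a ⊗ₜ 1))) =
      TensorProduct.rid k A (f.lTensor A t) * a := by
    intro a t
    induction t with
    | zero => simp
    | add x y hx hy => simp only [map_add, hx, hy, add_mul]
    | tmul x y => simp
  have h1 : ∀ (U : WithConv (X →ₗ[k] A ⊗[k] B)) (x : X), TensorProduct.rid k A (f.lTensor A
      ((U * convMap Algebra.TensorProduct.includeLeft φ').ofConv x)) =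
      (toConv ((TensorProduct.rid k A).toLinearMap ∘ₗ f.lTensor A ∘ₗ U.ofConv) * φ').ofConv x := by
    intro U x
    simp only [LinearMap.convMul_apply]
    generalize comul (R := k) x = t
    induction t with
    | zero => simp
    | add a b ha hb => simp only [map_add, ha, hb]
    | tmul a b => exact hr _ _
  have h2 : ∀ x : X, TensorProduct.rid k A (f.lTensor A
      ((convMap Algebra.TensorProduct.includeLeft φ * T).ofConv x)) =
      (φ * toConv ((TensorProduct.rid k A).toLinearMap ∘ₗ f.lTensor A ∘ₗ T.ofConv)).ofConv x := by
    intro x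
    simp only [LinearMap.convMul_apply]
    generalize comul (R := k) x = t
    induction t with
    | zero => simp
    | add a b ha hb => simp only [map_add, ha, hb]
    | tmul a b => exact hl _ _
  rw [h1]
  exact congrArg (fun U : WithConv (X →ₗ[k] A) => (U * φ').ofConv x)
    (WithConv.ext (LinearMap.ext h2))

/-- The contraction of `1 ⊗ ψ(x)` is the scalar `f(ψ(x))`. -/
theorem contract_includeRight {B : Type*} [Ring B] [Algebra k B] (f : B →ₗ[k] k)
    (ψ : WithConv (X →ₗ[k] B)) :
    toConv ((TensorProduct.rid k A).toLinearMap ∘ₗ f.lTensor A ∘ₗ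
      (convMap (Algebra.TensorProduct.includeRight : B →ₐ[k] A ⊗[k] B) ψ).ofConv) =
      convScalar A (toConv (f ∘ₗ ψ.ofConv)) := by
  ext x
  simp [Algebra.ofId_apply, Algebra.algebraMap_eq_smul_one]

end Contraction

namespace Hpar

variable (k H : Type*) [Field k] [Ring H] [HopfAlgebra k H]

/-- The universal partial corepresentation `p`, as a convolution element. -/
noncomputable abbrev projConv : WithConv (Hpar k H →ₗ[k] H) := toConv (proj k H)

/-- `x ↦ S(p(x))`, as a convolution element. -/
noncomputable abbrev projAntipode : WithConv (Hpar k H →ₗ[k] H) := antipodeConv (proj k H)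

/-- The restriction of the cofree projection `C(H) → H` to the base coalgebra. -/
noncomputable def baseProj : Base k H →ₗ[k] H :=
  CofreeCoalgebra.proj k H ∘ₗ (Subcoalgebra.range (EbarCofree k H)).toSubmodule.subtype

variable {k H}

theorem Ebar_surjective : Function.Surjective (Ebar k H) :=
  Subcoalgebra.rangeRestrict_surjective _

/-- The coalgebra morphism `Ē` lifts `E = p * (S ∘ p)`. -/
theorem convComap_baseProj :
    convComap (Ebar k H) (toConv (baseProj k H)) = projConv k H * projAntipode k H := by
  ext x
  exact CofreeCoalgebra.proj_lift (E k H) x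

/-- A functional on the base coalgebra, pulled back along `Ē` to an `A`-valued convolution
element. -/
noncomputable abbrev pullScalar (A : Type*) [Ring A] [Algebra k A]
    (b : WithConv (Base k H →ₗ[k] k)) : WithConv (Hpar k H →ₗ[k] A) :=
  convScalar A (convComap (Ebar k H) b)

theorem projAntipode_mul : projAntipode k H * (projConv k H * projAntipode k H) =
    projAntipode k H := isPartialCorep_proj.antipode_mul_idem

theorem proj_mul : projConv k H * (projAntipode k H * projConv k H) = projConv k H := by
  rw [← mul_assoc]
  exact isPartialCorep_proj.idem_mul_self

/-- `b ↦ p * (b ∘ Ē) * (S ∘ p)` is multiplicative as soon as the second functional commutes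
with `(S ∘ p) * p`, since `(S ∘ p) * p * (S ∘ p) = S ∘ p`. -/
theorem conj_mul (b : WithConv (Base k H →ₗ[k] k)) {b' : WithConv (Base k H →ₗ[k] k)}
    (hb' : Commute (pullScalar H b') (projAntipode k H * projConv k H)) :
    projConv k H * pullScalar H (b * b') * projAntipode k H =
      (projConv k H * pullScalar H b * projAntipode k H) *
        (projConv k H * pullScalar H b' * projAntipode k H) := by
  have e : pullScalar H (b * b') = pullScalar H b * pullScalar H b' := by
    simp only [pullScalar, map_mul]
  calc _ = projConv k H * pullScalar H b * pullScalar H b' *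
        (projAntipode k H * (projConv k H * projAntipode k H)) := by
        rw [e, projAntipode_mul, ← mul_assoc (projConv k H)]
    _ = projConv k H * pullScalar H b * (pullScalar H b' *
        (projAntipode k H * projConv k H)) * projAntipode k H := by
        simp only [mul_assoc]
    _ = _ := by
        rw [hb'.eq]
        simp only [mul_assoc]

variable (k H) in
/-- The functionals `b` on the base coalgebra for which `b ∘ Ē` commutes with `(S ∘ p) * p` and
for which `x ↦ p(x₁) b(Ē(x₂)) S(p(x₃))` factors through `Ē`. -/
noncomputable def baseFunctionals : Submonoid (WithConv (Base k H →ₗ[k] k)) where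
  carrier := {b | Commute (pullScalar H b) (projAntipode k H * projConv k H) ∧
    projConv k H * pullScalar H b * projAntipode k H ∈
      (convComap (Ebar k H) : WithConv (Base k H →ₗ[k] H) →+* _).range}
  one_mem' := by
    refine ⟨?_, toConv (baseProj k H), ?_⟩
    · rw [pullScalar, map_one, map_one]
      exact Commute.one_left _
    · rw [pullScalar, map_one, map_one, mul_one]
      exact convComap_baseProj
  mul_mem' := by
    rintro b b' ⟨h1, h2⟩ ⟨h1', h2'⟩
    have e : pullScalar H (b * b') = pullScalar H b * pullScalar H b' := by
      simp only [pullScalar, map_mul]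
    refine ⟨?_, ?_⟩
    · rw [e]
      exact h1.mul_left h1'
    · rw [conj_mul b h1']
      exact mul_mem h2 h2'

/-- Functionals factoring through the projection to `H` belong to `baseFunctionals`: contract the
identities `E(x₁) ⊗ S(p(x₂)) p(x₃) = E(x₃) ⊗ S(p(x₁)) p(x₂)` and
`p(x₁) S(p(x₃)) ⊗ E(x₂) = E(x₁)₁ E(x₂) ⊗ E(x₁)₂`. -/
theorem comp_baseProj_mem (f : H →ₗ[k] k) :
    toConv (f ∘ₗ baseProj k H) ∈ baseFunctionals k H := by
  have hω := isPartialCorep_proj (k := k) (H := H)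
  have hpull : toConv ((TensorProduct.rid k H).toLinearMap ∘ₗ f.lTensor H ∘ₗ
      (convMap (inR k H) (idemConv (proj k H))).ofConv) =
      pullScalar H (toConv (f ∘ₗ baseProj k H)) := by
    rw [contract_includeRight, idemConv, ← convComap_baseProj]
    rfl
  refine ⟨?_, ?_⟩
  · ext x
    have h := congrArg (fun T : WithConv (Hpar k H →ₗ[k] H ⊗[k] H) =>
      TensorProduct.rid k H (f.lTensor H (T.ofConv x))) hω.inR_idem_commute.eq
    have h1 := contract_mul_mul f 1 (projAntipode k H * projConv k H)
      (convMap (inR k H) (idemConv (proj k H))) x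
    have h2 := contract_mul_mul f (projAntipode k H * projConv k H) 1
      (convMap (inR k H) (idemConv (proj k H))) x
    rw [map_one, one_mul, one_mul, hpull] at h1
    rw [map_one, mul_one, mul_one, hpull] at h2
    exact h1.symm.trans (h.trans h2)
  · refine ⟨toConv ((TensorProduct.rid k H).toLinearMap ∘ₗ f.lTensor H ∘ₗ
      (convMap (inΔ k H) (toConv (baseProj k H)) *
        convMap (inL k H) (toConv (baseProj k H))).ofConv), ?_⟩
    have e : convComap (Ebar k H) (convMap (inΔ k H) (toConv (baseProj k H)) *
        convMap (inL k H) (toConv (baseProj k H))) =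
        convMap (inΔ k H) (idemConv (proj k H)) * convMap (inL k H) (idemConv (proj k H)) := by
      rw [idemConv, ← convComap_baseProj, map_mul]
      rfl
    ext x
    have h := congrArg (fun T : WithConv (Hpar k H →ₗ[k] H ⊗[k] H) =>
      TensorProduct.rid k H (f.lTensor H (T.ofConv x)))
      (e.trans hω.inL_mul_inR_idem_mul_inL.symm)
    rw [← hpull]
    exact h.trans (contract_mul_mul f _ _ _ x)

/-- The functionals in `baseFunctionals` separate the points of the base coalgebra. -/
theorem separating_baseFunctionals :
    Separating {b : Base k H →ₗ[k] k | toConv b ∈ baseFunctionals k H} := by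
  have h := CofreeCoalgebra.separating ((baseFunctionals k H).comap
    (convComap (Subcoalgebra.range (EbarCofree k H)).incl : _ →+* WithConv (Base k H →ₗ[k] k)))
    fun f => comp_baseProj_mem f
  intro c hc
  refine (Subcoalgebra.range (EbarCofree k H)).incl_injective ((h _ fun b hb => ?_).trans (map_zero _).symm)
  exact hc _ hb

/-- The formula `p(x₁) S(p(x₃)) ⊗ Ē(x₂)` with a linear map applied to its second leg. -/
theorem lTensor_coactionFormula {A : Type*} [Ring A] [Algebra k A] (ψ : Base k H →ₗ[k] A)
    (x : Hpar k H) : ψ.lTensor H (coactionFormula k H x) =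
      (convMap Algebra.TensorProduct.includeLeft (projConv k H) *
        convMap Algebra.TensorProduct.includeRight (convComap (Ebar k H) (toConv ψ)) *
        convMap Algebra.TensorProduct.includeLeft (projAntipode k H) :
        WithConv (Hpar k H →ₗ[k] H ⊗[k] A)).ofConv x := by
  rw [mul_assoc]
  simp only [coactionFormula, LinearMap.comp_apply, LinearMap.convMul_apply]
  generalize comul (R := k) x = t
  induction t with
  | zero => simp
  | add a b ha hb => simp only [map_add, ha, hb]
  | tmul a b =>
    simp only [LinearMap.lTensor_tmul, TensorProduct.map_tmul, LinearMap.convMul_def,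
      LinearMap.comp_apply]
    generalize comul (R := k) b = s
    induction s with
    | zero => simp
    | add a b ha hb => simp only [map_add, ha, hb, TensorProduct.tmul_add]
    | tmul b c => simp

/-- The formula `p(x₁) S(p(x₃)) ⊗ Ē(x₂)` contracted with a functional. -/
theorem contract_coactionFormula (b : Base k H →ₗ[k] k) (x : Hpar k H) :
    TensorProduct.rid k H (b.lTensor H (coactionFormula k H x)) =
      (projConv k H * pullScalar H (toConv b) * projAntipode k H).ofConv x := by
  have e : ∀ φ : WithConv (Hpar k H →ₗ[k] H),
      convMap (Algebra.TensorProduct.rid k k H).toAlgHom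
        (convMap (Algebra.TensorProduct.includeLeft : H →ₐ[k] H ⊗[k] k) φ) = φ := by
    intro φ
    ext x
    simp
  have e' : ∀ φ : WithConv (Hpar k H →ₗ[k] k),
      convMap (Algebra.TensorProduct.rid k k H).toAlgHom
        (convMap (Algebra.TensorProduct.includeRight : k →ₐ[k] H ⊗[k] k) φ) = convScalar H φ := by
    intro φ
    ext x
    simp [Algebra.ofId_apply, Algebra.algebraMap_eq_smul_one]
  rw [lTensor_coactionFormula]
  have h : ∀ T : WithConv (Hpar k H →ₗ[k] H ⊗[k] k), TensorProduct.rid k H (T.ofConv x) =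
      (convMap (Algebra.TensorProduct.rid k k H).toAlgHom T).ofConv x := fun _ => rfl
  rw [h, map_mul, map_mul, e, e, e']

/-- The linear map `λ : C → H ⊗ C` with `λ(Ē(x)) = p(x₁) S(p(x₃)) ⊗ Ē(x₂)` exists. -/
theorem exists_coact : ∃ l : Base k H →ₗ[k] H ⊗[k] Base k H,
    ∀ x, l (Ebar k H x) = coactionFormula k H x := by
  obtain ⟨s, hs⟩ := (Ebar k H : Hpar k H →ₗ[k] Base k H).exists_rightInverse_of_surjective
    (LinearMap.range_eq_top.2 Ebar_surjective)
  refine ⟨coactionFormula k H ∘ₗ s, fun x => ?_⟩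
  refine separating_baseFunctionals.tensor_right fun b hb => ?_
  obtain ⟨ψ, hψ⟩ := hb.2
  rw [LinearMap.comp_apply, contract_coactionFormula, contract_coactionFormula, ← hψ]
  exact congrArg ψ.ofConv (LinearMap.congr_fun hs (Ebar k H x))

end Hpar

/-! ### The partial coaction on the base coalgebra -/

/-- Tensors in `M ⊗ (M' ⊗ N)` are separated by contracting `N` with a separating set of
functionals. -/
theorem Separating.tensor_right_right {k M M' N : Type*} [Field k] [AddCommGroup M] [Module k M]
    [AddCommGroup M'] [Module k M'] [AddCommGroup N] [Module k N]
    {F : Set (N →ₗ[k] k)} (hF : Separating F) {t s : M ⊗[k] (M' ⊗[k] N)}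
    (h : ∀ f ∈ F,
      ((TensorProduct.rid k M').toLinearMap ∘ₗ f.lTensor M').lTensor M t =
      ((TensorProduct.rid k M').toLinearMap ∘ₗ f.lTensor M').lTensor M s) : t = s := by
  apply (TensorProduct.assoc k M M' N).symm.injective
  refine hF.tensor_right fun f hf => ?_
  have e : ∀ r : M ⊗[k] (M' ⊗[k] N), TensorProduct.rid k (M ⊗[k] M')
      (f.lTensor (M ⊗[k] M') ((TensorProduct.assoc k M M' N).symm r)) =
      ((TensorProduct.rid k M').toLinearMap ∘ₗ f.lTensor M').lTensor M r := by
    intro r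
    induction r with
    | zero => simp
    | add x y hx hy => simp only [map_add, hx, hy]
    | tmul x y =>
      induction y with
      | zero => simp
      | add a b ha hb => simp only [map_add, ha, hb, TensorProduct.tmul_add]
      | tmul a b => simp
  rw [e, e, h f hf]

section Contraction

variable {k H C : Type*} [Field k] [Ring H] [HopfAlgebra k H] [AddCommGroup C] [Module k C]

theorem contract_mulFirst (f g : C →ₗ[k] k) (u v : H ⊗[k] C) :
    TensorProduct.rid k H ((LinearMap.mul' k k ∘ₗ TensorProduct.map f g).lTensor H
      (mulFirst k H C (u ⊗ₜ v))) =
      TensorProduct.rid k H (f.lTensor H u) * TensorProduct.rid k H (g.lTensor H v) := by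
  induction u with
  | zero => simp
  | add a b ha hb => simp only [map_add, ha, hb, TensorProduct.add_tmul, add_mul]
  | tmul a c =>
    induction v with
    | zero => simp
    | add a b ha hb => simp only [map_add, ha, hb, TensorProduct.tmul_add, mul_add]
    | tmul b d => simp [smul_smul, mul_comm]

theorem contract_mulComulLeft (b : C →ₗ[k] k) (a : H) (u : H ⊗[k] C) :
    ((TensorProduct.rid k H).toLinearMap ∘ₗ b.lTensor H).lTensor H
        (mulComulLeft k H C (a ⊗ₜ u)) =
      (a ⊗ₜ 1) * comul (R := k) (TensorProduct.rid k H (b.lTensor H u)) := by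
  induction u with
  | zero => simp
  | add a b ha hb => simp only [map_add, ha, hb, TensorProduct.tmul_add, mul_add]
  | tmul c d =>
    simp only [mulComulLeft, LinearMap.comp_apply, LinearMap.lTensor_tmul, comulFirst_tmul,
      LinearEquiv.coe_coe, TensorProduct.rid_tmul, map_smul]
    generalize comul (R := k) c = s
    induction s with
    | zero => simp
    | add a b ha hb =>
      simp only [map_add, ha, hb, TensorProduct.tmul_add, TensorProduct.add_tmul, mul_add,
        smul_add]
    | tmul c₁ c₂ => simp

theorem contract_mulComulRight (b : C →ₗ[k] k) (a : H) (u : H ⊗[k] C) :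
    ((TensorProduct.rid k H).toLinearMap ∘ₗ b.lTensor H).lTensor H
        (mulComulRight k H C (u ⊗ₜ a)) =
      comul (R := k) (TensorProduct.rid k H (b.lTensor H u)) * (a ⊗ₜ 1) := by
  induction u with
  | zero => simp
  | add a b ha hb => simp only [map_add, ha, hb, TensorProduct.add_tmul, add_mul]
  | tmul c d =>
    simp only [mulComulRight, LinearMap.comp_apply, LinearMap.lTensor_tmul, comulFirst_tmul,
      LinearEquiv.coe_coe, TensorProduct.rid_tmul, map_smul, TensorProduct.comm_tmul]
    generalize comul (R := k) c = s
    induction s with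
    | zero => simp
    | add a b ha hb =>
      simp only [map_add, ha, hb, TensorProduct.tmul_add, TensorProduct.add_tmul, add_mul,
        smul_add]
    | tmul c₁ c₂ => simp

end Contraction

namespace Hpar

variable {k H : Type*} [Field k] [Ring H] [HopfAlgebra k H]

/-- `x ↦ p(x₁) b(Ē(x₂)) S(p(x₃))`. -/
noncomputable abbrev conjConv (b : WithConv (Base k H →ₗ[k] k)) : WithConv (Hpar k H →ₗ[k] H) :=
  projConv k H * pullScalar H b * projAntipode k H

theorem comul_Ebar (x : Hpar k H) : comul (R := k) (Ebar k H x) =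
    TensorProduct.map (Ebar k H : Hpar k H →ₗ[k] Base k H) (Ebar k H : Hpar k H →ₗ[k] Base k H)
      (comul x) :=
  (LinearMap.congr_fun (Ebar k H).map_comp_comul x).symm

/-- The left coassociativity axiom of the coaction on the base coalgebra, contracted with `b`: both
sides compute `p(x₁) S(p(x₅)) ⊗ p(x₂) b(Ē(x₃)) S(p(x₄))`. -/
theorem inL_mul_conj_mul_inL {b : WithConv (Base k H →ₗ[k] k)} (hb : b ∈ baseFunctionals k H) :
    convMap (inL k H) (projConv k H) * convMap (inR k H) (conjConv b) *
        convMap (inL k H) (projAntipode k H) =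
      convMap (inL k H) (projConv k H * projAntipode k H) * convMap (inΔ k H) (conjConv b) := by
  have hω := isPartialCorep_proj (k := k) (H := H)
  have h1 := hω.inL_idem_mul_inΔ
  have h2 := hω.inR_idem_mul_inL
  have h3 := congrArg (convMap (inR k H)) (projAntipode_mul (k := k) (H := H))
  have h4 := congrArg (convMap (inR k H)) (proj_mul (k := k) (H := H))
  have h5 := congrArg (convMap (inR k H)) hb.1.eq
  simp only [conjConv, idemConv, map_mul, pullScalar, convMap_convScalar] at h1 h2 h3 h4 h5 ⊢
  generalize convScalar (H ⊗[k] H) (convComap (Ebar k H) b) = β at *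
  generalize convMap (inL k H) (projConv k H) = p₁ at *
  generalize convMap (inR k H) (projConv k H) = p₂ at *
  generalize convMap (inΔ k H) (projConv k H) = p at *
  generalize convMap (inL k H) (projAntipode k H) = q₁ at *
  generalize convMap (inR k H) (projAntipode k H) = q₂ at *
  generalize convMap (inΔ k H) (projAntipode k H) = q at *
  symm
  calc p₁ * q₁ * (p * β * q) = (p₁ * q₁ * p) * β * q := by simp only [mul_assoc]
    _ = p₁ * (p₂ * (q₂ * p₂)) * β * q := by rw [h1, h4]
    _ = p₁ * p₂ * ((q₂ * p₂) * β) * q := by simp only [mul_assoc]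
    _ = p₁ * p₂ * β * q₂ * (p₂ * q) := by rw [← h5]; simp only [mul_assoc]
    _ = p₁ * p₂ * β * (q₂ * (p₂ * q₂)) * q₁ := by rw [← h2]; simp only [mul_assoc]
    _ = _ := by rw [h3]; simp only [mul_assoc]

/-- The right coassociativity axiom of the coaction on the base coalgebra, contracted with `b`: both
sides compute `p(x₁) S(p(x₅)) ⊗ p(x₂) b(Ē(x₃)) S(p(x₄))`. -/
theorem inL_mul_conj_mul_inL' {b : WithConv (Base k H →ₗ[k] k)} (hb : b ∈ baseFunctionals k H) :
    convMap (inL k H) (projConv k H) * convMap (inR k H) (conjConv b) *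
        convMap (inL k H) (projAntipode k H) =
      convMap (inΔ k H) (conjConv b) * convMap (inL k H) (projConv k H * projAntipode k H) := by
  have hω := isPartialCorep_proj (k := k) (H := H)
  have h1 := hω.inΔ_antipode_mul_inL
  have h2 := hω.inΔ_mul_inR
  have h3 := congrArg (convMap (inR k H)) (projAntipode_mul (k := k) (H := H))
  have h3' := congrArg (convMap (inL k H)) (projAntipode_mul (k := k) (H := H))
  have h4 := congrArg (convMap (inR k H)) (proj_mul (k := k) (H := H))
  have h5 := congrArg (convMap (inR k H)) hb.1.eq
  simp only [conjConv, idemConv, map_mul, pullScalar, convMap_convScalar] at h1 h2 h3 h3' h4 h5 ⊢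
  generalize convScalar (H ⊗[k] H) (convComap (Ebar k H) b) = β at *
  generalize convMap (inL k H) (projConv k H) = p₁ at *
  generalize convMap (inR k H) (projConv k H) = p₂ at *
  generalize convMap (inΔ k H) (projConv k H) = p at *
  generalize convMap (inL k H) (projAntipode k H) = q₁ at *
  generalize convMap (inR k H) (projAntipode k H) = q₂ at *
  generalize convMap (inΔ k H) (projAntipode k H) = q at *
  symm
  calc p * β * q * (p₁ * q₁) = p * β * (q * p₁) * q₁ := by simp only [mul_assoc]
    _ = p * β * q₂ * (q₁ * (p₁ * q₁)) := by rw [h1]; simp only [mul_assoc]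
    _ = p * β * (q₂ * (p₂ * q₂)) * q₁ := by rw [h3', h3]
    _ = p * (β * (q₂ * p₂)) * q₂ * q₁ := by simp only [mul_assoc]
    _ = (p * q₂) * p₂ * β * q₂ * q₁ := by rw [h5]; simp only [mul_assoc]
    _ = p₁ * (p₂ * (q₂ * p₂)) * β * q₂ * q₁ := by rw [h2]; simp only [mul_assoc]
    _ = _ := by rw [h4]; simp only [mul_assoc]

section Coaction

variable {l : Base k H →ₗ[k] H ⊗[k] Base k H} (hl : ∀ x, l (Ebar k H x) = coactionFormula k H x)
include hl

/-- The coaction contracted with a functional `b` and pulled back along `Ē` is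
`p * (b ∘ Ē) * (S ∘ p)`. -/
theorem contract_coact (b : Base k H →ₗ[k] k) :
    convComap (Ebar k H) (toConv ((TensorProduct.rid k H).toLinearMap ∘ₗ b.lTensor H ∘ₗ l)) =
      conjConv (toConv b) := by
  ext x
  refine Eq.trans ?_ (contract_coactionFormula b x)
  rw [← hl]
  rfl

/-- `∇(Ē(x)) = E(x)`: take `b = ε`. -/
theorem convComap_nabla :
    convComap (Ebar k H) (toConv (nabla l)) = projConv k H * projAntipode k H := by
  have e : toConv (counit : Base k H →ₗ[k] k) = 1 := rfl
  have h := contract_coact hl counit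
  rw [e, conjConv, pullScalar, map_one, map_one, mul_one] at h
  exact h

/-- On the base coalgebra, `∇` is the projection to `H`. -/
theorem nabla_eq_baseProj : nabla l = baseProj k H := by
  ext c
  obtain ⟨x, rfl⟩ := Ebar_surjective c
  have h := (convComap_nabla hl).trans convComap_baseProj.symm
  exact LinearMap.congr_fun (congrArg ofConv h) x

/-- The axiom `c^[-1] ⊗ c^[0]₁ ⊗ c^[0]₂ = c₁^[-1] c₂^[-1] ⊗ c₁^[0] ⊗ c₂^[0]`. -/
theorem comul_coact : comul.lTensor H ∘ₗ l =
    mulFirst k H (Base k H) ∘ₗ TensorProduct.map l l ∘ₗ comul := by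
  ext c
  obtain ⟨x, rfl⟩ := Ebar_surjective c
  refine (separating_baseFunctionals.tensor separating_baseFunctionals).tensor_right ?_
  rintro _ ⟨f, hf, g, hg, rfl⟩
  have h2 : ∀ t : Hpar k H ⊗[k] Hpar k H, TensorProduct.rid k H
      ((LinearMap.mul' k k ∘ₗ TensorProduct.map f g).lTensor H (mulFirst k H _
        (TensorProduct.map l l (TensorProduct.map (Ebar k H : Hpar k H →ₗ[k] Base k H)
          (Ebar k H : Hpar k H →ₗ[k] Base k H) t)))) =
      LinearMap.mul' k H (TensorProduct.map (conjConv (toConv f)).ofConv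
        (conjConv (toConv g)).ofConv t) := by
    intro t
    rw [← contract_coact hl, ← contract_coact hl]
    induction t with
    | zero => simp
    | add a b ha hb => simp only [map_add, ha, hb]
    | tmul a b => exact contract_mulFirst _ _ _ _
  have h3 := contract_coactionFormula (toConv f * toConv g).ofConv x
  rw [toConv_ofConv, conj_mul _ hg.1, ← hl] at h3
  refine Eq.trans ?_ (h3.trans ?_)
  · rw [LinearMap.comp_apply, ← LinearMap.lTensor_comp_apply]
    rfl
  · rw [LinearMap.comp_apply, LinearMap.comp_apply, comul_Ebar, h2]
    rfl

/-- The axiom `ε(c^[-1]) c^[0] = c`. -/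
theorem counit_coact :
    (TensorProduct.lid k (Base k H)).toLinearMap ∘ₗ counit.rTensor (Base k H) ∘ₗ l =
      LinearMap.id := by
  refine LinearMap.ext fun c => ?_
  obtain ⟨x, rfl⟩ := Ebar_surjective c
  refine sub_eq_zero.1 (separating_baseFunctionals _ fun b _ => ?_)
  rw [map_sub, sub_eq_zero]
  have h1 : ∀ t : H ⊗[k] Base k H,
      b (TensorProduct.lid k (Base k H) (counit.rTensor (Base k H) t)) =
      counit (R := k) (TensorProduct.rid k H (b.lTensor H t)) := by
    intro t
    induction t with
    | zero => simp
    | add a b ha hb => simp only [map_add, ha, hb]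
    | tmul a b => simp [mul_comm]
  have h2 : convMap (Bialgebra.counitAlgHom k H) (projConv k H) = 1 :=
    WithConv.ext (isPartialCorep_proj (k := k) (H := H)).counit_comp
  have h3 : convMap (Bialgebra.counitAlgHom k H) (projAntipode k H) = 1 := by
    rw [← h2]
    ext x
    exact HopfAlgebra.counit_antipode _
  have h4 : convMap (Bialgebra.counitAlgHom k H) (conjConv (toConv b)) =
      convComap (Ebar k H) (toConv b) := by
    rw [map_mul, map_mul, h2, h3, one_mul, mul_one, convMap_convScalar]
    rfl
  refine (h1 _).trans ?_
  rw [hl, contract_coactionFormula]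
  exact LinearMap.congr_fun (congrArg ofConv h4) x

/-- Contracting `c^[-1] ⊗ c^[0][-1] ⊗ c^[0][0]`. -/
theorem contract_coact_coact (b : Base k H →ₗ[k] k) (x : Hpar k H) :
    ((TensorProduct.rid k H).toLinearMap ∘ₗ b.lTensor H).lTensor H
        ((l.lTensor H ∘ₗ l) (Ebar k H x)) =
      (convMap (inL k H) (projConv k H) * convMap (inR k H) (conjConv (toConv b)) *
        convMap (inL k H) (projAntipode k H)).ofConv x := by
  rw [← contract_coact hl, ← lTensor_coactionFormula, LinearMap.comp_apply,
    ← LinearMap.lTensor_comp_apply, hl]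
  rfl

/-- The axiom `c^[-1] ⊗ c^[0][-1] ⊗ c^[0][0] = ∇(c₁) c₂^[-1]₁ ⊗ c₂^[-1]₂ ⊗ c₂^[0]`. -/
theorem coact_coact_left : l.lTensor H ∘ₗ l =
    mulComulLeft k H (Base k H) ∘ₗ TensorProduct.map (nabla l) l ∘ₗ comul := by
  ext c
  obtain ⟨x, rfl⟩ := Ebar_surjective c
  refine separating_baseFunctionals.tensor_right_right fun b hb => ?_
  rw [contract_coact_coact hl, inL_mul_conj_mul_inL hb]
  rw [LinearMap.comp_apply, LinearMap.comp_apply, comul_Ebar, ← convComap_nabla hl,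
    ← contract_coact hl]
  simp only [LinearMap.convMul_apply]
  generalize comul (R := k) x = t
  induction t with
  | zero => simp
  | add a b ha hb => simp only [map_add, ha, hb]
  | tmul a c => exact (contract_mulComulLeft _ _ _).symm

/-- The axiom `c^[-1] ⊗ c^[0][-1] ⊗ c^[0][0] = c₁^[-1]₁ ∇(c₂) ⊗ c₁^[-1]₂ ⊗ c₁^[0]`. -/
theorem coact_coact_right : l.lTensor H ∘ₗ l =
    mulComulRight k H (Base k H) ∘ₗ TensorProduct.map l (nabla l) ∘ₗ comul := by
  ext c
  obtain ⟨x, rfl⟩ := Ebar_surjective c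
  refine separating_baseFunctionals.tensor_right_right fun b hb => ?_
  rw [contract_coact_coact hl, inL_mul_conj_mul_inL' hb]
  rw [LinearMap.comp_apply, LinearMap.comp_apply, comul_Ebar, ← convComap_nabla hl,
    ← contract_coact hl]
  simp only [LinearMap.convMul_apply]
  generalize comul (R := k) x = t
  induction t with
  | zero => simp
  | add a b ha hb => simp only [map_add, ha, hb]
  | tmul a c => exact (contract_mulComulRight _ _ _).symm

end Coaction

variable (k H) in
/-- The left partial coaction of `H` on the base coalgebra with
`λ(Ē(x)) = p(x₁) S(p(x₃)) ⊗ Ē(x₂)`. -/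
noncomputable def baseCoaction : LeftPartialCoaction k H (Base k H) where
  coact := exists_coact.choose
  comul_coact := comul_coact exists_coact.choose_spec
  counit_coact := counit_coact exists_coact.choose_spec
  coact_coact_left := coact_coact_left exists_coact.choose_spec
  coact_coact_right := coact_coact_right exists_coact.choose_spec

theorem baseCoaction_coact_Ebar (x : Hpar k H) :
    (baseCoaction k H).coact (Ebar k H x) = coactionFormula k H x :=
  exists_coact.choose_spec x

end Hpar

/-! ### The partial corepresentation on a partial cosmash coproduct -/

section Hopf

variable {k H : Type*} [Field k] [Ring H] [HopfAlgebra k H]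

variable (k H) in
/-- `h ↦ S(h₁) ⊗ h₂`. -/
noncomputable abbrev antipodeComul : H →ₗ[k] H ⊗[k] H :=
  (convMap (inL k H) (cS k H) * convMap (inR k H) (cId k H)).ofConv

theorem antipodeComul_apply (h : H) :
    antipodeComul k H h = (HopfAlgebra.antipode k).rTensor H (comul h) :=
  includeLeft_mul_includeRight _ _ h

theorem antipodeComul_one : antipodeComul k H 1 = 1 := by
  rw [antipodeComul_apply]
  simp [Algebra.TensorProduct.one_def]

variable (k H) in
/-- `a ⊗ b ↦ a S(b)`. -/
noncomputable abbrev mulAntipode : H ⊗[k] H →ₗ[k] H :=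
  LinearMap.mul' k H ∘ₗ (HopfAlgebra.antipode k).lTensor H

variable (k H) in
/-- `a ⊗ b ↦ a₁ ⊗ a₂ S(b)`. -/
noncomputable abbrev comulMulAntipode : H ⊗[k] H →ₗ[k] H ⊗[k] H :=
  LinearMap.mul' k _ ∘ₗ TensorProduct.map (inΔ k H).toLinearMap
    ((inR k H).toLinearMap ∘ₗ HopfAlgebra.antipode k)

variable (k H) in
/-- `a ⊗ b ↦ a S(b₁) ⊗ b₂`. -/
noncomputable abbrev mulAntipodeComul : H ⊗[k] H →ₗ[k] H ⊗[k] H :=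
  LinearMap.mul' k _ ∘ₗ TensorProduct.map (inL k H).toLinearMap (antipodeComul k H)

/-- `a h₁ S(b h₂) = ε(h) a S(b)`. -/
theorem mulAntipode_mul_comul (t : H ⊗[k] H) (h : H) :
    mulAntipode k H (t * comul h) = counit (R := k) h • mulAntipode k H t := by
  induction t with
  | zero => simp
  | add a b ha hb => simp only [map_add, ha, hb, add_mul, smul_add]
  | tmul a b =>
    have h1 : ∀ s : H ⊗[k] H, mulAntipode k H ((a ⊗ₜ b) * s) =
        a * mulAntipode k H s * HopfAlgebra.antipode k b := by
      intro s
      induction s with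
      | zero => simp
      | add a b ha hb => simp only [map_add, ha, hb, mul_add, add_mul]
      | tmul x y => simp [HopfAlgebra.antipode_mul_antidistrib, mul_assoc]
    rw [h1]
    simp only [LinearMap.comp_apply, HopfAlgebra.mul_antipode_lTensor_comul_apply]
    simp [Algebra.algebraMap_eq_smul_one]

/-- `(a h₁)₁ ⊗ (a h₁)₂ S(b h₂) = a₁ h ⊗ a₂ S(b)`. -/
theorem comulMulAntipode_mul_comul (t : H ⊗[k] H) (h : H) :
    comulMulAntipode k H (t * comul h) = comulMulAntipode k H t * (h ⊗ₜ 1) := by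
  induction t with
  | zero => simp
  | add a b ha hb => simp only [map_add, ha, hb, add_mul]
  | tmul a b =>
    have h1 : ∀ s : H ⊗[k] H, comulMulAntipode k H ((a ⊗ₜ b) * s) =
        inΔ k H a * comulMulAntipode k H s * inR k H (HopfAlgebra.antipode k b) := by
      intro s
      induction s with
      | zero => simp
      | add a b ha hb => simp only [map_add, ha, hb, mul_add, add_mul]
      | tmul x y => simp [HopfAlgebra.antipode_mul_antidistrib, mul_assoc]
    have h2 : convMap (inΔ k H) (cId k H) * convMap (inR k H) (cS k H) =
        convMap (inL k H) (cId k H) := by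
      rw [convMap_inΔ_cId, mul_assoc, ← map_mul, cId_mul_cS, map_one, mul_one]
    have h3 : comulMulAntipode k H (comul h) = h ⊗ₜ 1 :=
      LinearMap.congr_fun (congrArg ofConv h2) h
    rw [h1, h3]
    simp [mul_assoc]

/-- `S((b g)₁) ⊗ (b g)₂ = S(g₁) S(b₁) ⊗ b₂ g₂`. -/
theorem antipodeComul_mul (b g : H) : antipodeComul k H (b * g) =
    TensorProduct.map (LinearMap.mul' k H)
      (LinearMap.mul' k H ∘ₗ (TensorProduct.comm k H H).toLinearMap)
      (TensorProduct.tensorTensorTensorComm k H H H H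
        (antipodeComul k H g ⊗ₜ antipodeComul k H b)) := by
  simp only [antipodeComul_apply, Bialgebra.comul_mul]
  generalize comul (R := k) b = s
  generalize comul (R := k) g = t
  induction s with
  | zero => simp
  | add a b ha hb => simp only [map_add, ha, hb, add_mul, TensorProduct.tmul_add]
  | tmul x y =>
    induction t with
    | zero => simp
    | add a b ha hb => simp only [map_add, ha, hb, mul_add, TensorProduct.add_tmul]
    | tmul z w => simp [HopfAlgebra.antipode_mul_antidistrib]

/-- `a h₁ S((b h₂)₁) ⊗ (b h₂)₂ = a S(b₁) ⊗ b₂ h`. -/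
theorem mulAntipodeComul_mul_comul (t : H ⊗[k] H) (h : H) :
    mulAntipodeComul k H (t * comul h) = mulAntipodeComul k H t * (1 ⊗ₜ h) := by
  induction t with
  | zero => simp
  | add a b ha hb => simp only [map_add, ha, hb, add_mul]
  | tmul a b =>
    -- `B u` is `x ⊗ y ↦ u₁ x ⊗ y u₂`
    let B : H ⊗[k] H → H ⊗[k] H → H ⊗[k] H := fun u r =>
      TensorProduct.map (LinearMap.mul' k H)
        (LinearMap.mul' k H ∘ₗ (TensorProduct.comm k H H).toLinearMap)
        (TensorProduct.tensorTensorTensorComm k H H H H (u ⊗ₜ r))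
    have hB0 : ∀ r, B 0 r = 0 := fun r => by simp [B]
    have hB : ∀ u v r, B (u + v) r = B u r + B v r := fun u v r => by
      simp only [B, map_add, TensorProduct.add_tmul]
    have hBm : ∀ (x : H) u r, (x ⊗ₜ[k] 1) * B u r = B ((x ⊗ₜ[k] 1) * u) r := by
      intro x u r
      induction u with
      | zero => simp [hB0]
      | add a b ha hb => simp only [ha, hb, mul_add, hB]
      | tmul u v =>
        induction r with
        | zero => simp [B]
        | add a b ha hb => simp only [B, map_add, TensorProduct.tmul_add, mul_add] at ha hb ⊢
                           rw [ha, hb]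
        | tmul r s => simp [B, mul_assoc]
    have hBr : ∀ r, B (1 ⊗ₜ h) r = r * (1 ⊗ₜ h) := by
      intro r
      induction r with
      | zero => simp [B]
      | add a b ha hb => simp only [B, map_add, TensorProduct.tmul_add, add_mul] at ha hb ⊢
                         rw [ha, hb]
      | tmul r s => simp [B]
    have h1 : ∀ s : H ⊗[k] H, mulAntipodeComul k H ((a ⊗ₜ b) * s) =
        (a ⊗ₜ 1) * B (mulAntipodeComul k H s) (antipodeComul k H b) := by
      intro s
      induction s with
      | zero => simp [hB0]
      | add a b ha hb => simp only [map_add, ha, hb, mul_add, hB]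
      | tmul x y =>
        simp only [Algebra.TensorProduct.tmul_mul_tmul, LinearMap.comp_apply,
          TensorProduct.map_tmul, LinearMap.mul'_apply]
        rw [antipodeComul_mul]
        change ((a * x) ⊗ₜ 1) * B _ _ = (a ⊗ₜ 1) * B ((x ⊗ₜ 1) * _) _
        rw [← hBm, ← mul_assoc, Algebra.TensorProduct.tmul_mul_tmul, one_mul]
    have h2 : convMap (inL k H) (cId k H) * toConv (antipodeComul k H) =
        convMap (inR k H) (cId k H) := by
      rw [antipodeComul, toConv_ofConv, ← mul_assoc, ← map_mul, cId_mul_cS, map_one, one_mul]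
    have h3 : mulAntipodeComul k H (comul h) = 1 ⊗ₜ h :=
      LinearMap.congr_fun (congrArg ofConv h2) h
    rw [h1, h3, hBr, ← mul_assoc]
    simp

end Hopf

namespace LeftPartialCoaction

variable {k H C : Type*} [Field k] [Ring H] [HopfAlgebra k H]
  [AddCommGroup C] [Module k C] [Coalgebra k C] (L : LeftPartialCoaction k H C)

/-- `∇ : C → H`, as a convolution element. -/
noncomputable abbrev nablaConv : WithConv (C →ₗ[k] H) := toConv (nabla L.coact)

theorem counit_nabla (c : C) : counit (R := k) (nabla L.coact c) = counit (R := k) c := by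
  have h1 : ∀ t : H ⊗[k] C, counit (R := k) (TensorProduct.rid k H (counit.lTensor H t)) =
      counit (R := k) (TensorProduct.lid k C (counit.rTensor C t)) := by
    intro t
    induction t with
    | zero => simp
    | add a b ha hb => simp only [map_add, ha, hb]
    | tmul a b => simp [mul_comm]
  exact (h1 _).trans (congrArg counit (LinearMap.congr_fun L.counit_coact c))

/-- `∇` is a convolution idempotent. -/
theorem nablaConv_mul_self : L.nablaConv * L.nablaConv = L.nablaConv := by
  ext c
  have h := congrArg (fun t => TensorProduct.rid k H
    ((LinearMap.mul' k k ∘ₗ TensorProduct.map counit counit).lTensor H t))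
    (LinearMap.congr_fun L.comul_coact c)
  have h1 : (LinearMap.mul' k k ∘ₗ TensorProduct.map counit counit) ∘ₗ comul =
      (counit : C →ₗ[k] k) :=
    congrArg ofConv (mul_one (1 : WithConv (C →ₗ[k] k)))
  simp only [LinearMap.comp_apply] at h
  rw [← LinearMap.lTensor_comp_apply, h1] at h
  refine Eq.trans ?_ h.symm
  simp only [LinearMap.convMul_apply]
  generalize comul (R := k) c = t
  induction t with
  | zero => simp
  | add a b ha hb => simp only [map_add, ha, hb]
  | tmul a b => exact (contract_mulFirst _ _ _ _).symm

/-- `c ↦ c^[-1] ⊗ ∇(c^[0])`. -/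
noncomputable abbrev coactNabla : C →ₗ[k] H ⊗[k] H := (nabla L.coact).lTensor H ∘ₗ L.coact

/-- `c^[-1] ⊗ ∇(c^[0]) = ∇(c₁) ∇(c₂)₁ ⊗ ∇(c₂)₂`. -/
theorem coactNabla_eq_left : toConv L.coactNabla =
    convMap (inL k H) L.nablaConv * convMap (inΔ k H) L.nablaConv := by
  ext c
  have h := congrArg (((TensorProduct.rid k H).toLinearMap ∘ₗ
    (counit : C →ₗ[k] k).lTensor H).lTensor H) (LinearMap.congr_fun L.coact_coact_left c)
  simp only [LinearMap.comp_apply] at h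
  rw [← LinearMap.lTensor_comp_apply] at h
  refine Eq.trans h ?_
  simp only [LinearMap.convMul_apply]
  generalize comul (R := k) c = t
  induction t with
  | zero => simp
  | add a b ha hb => simp only [map_add, ha, hb]
  | tmul a b => exact contract_mulComulLeft _ _ _

/-- `c^[-1] ⊗ ∇(c^[0]) = ∇(c₁)₁ ∇(c₂) ⊗ ∇(c₁)₂`. -/
theorem coactNabla_eq_right : toConv L.coactNabla =
    convMap (inΔ k H) L.nablaConv * convMap (inL k H) L.nablaConv := by
  ext c
  have h := congrArg (((TensorProduct.rid k H).toLinearMap ∘ₗ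
    (counit : C →ₗ[k] k).lTensor H).lTensor H) (LinearMap.congr_fun L.coact_coact_right c)
  simp only [LinearMap.comp_apply] at h
  rw [← LinearMap.lTensor_comp_apply] at h
  refine Eq.trans h ?_
  simp only [LinearMap.convMul_apply]
  generalize comul (R := k) c = t
  induction t with
  | zero => simp
  | add a b ha hb => simp only [map_add, ha, hb]
  | tmul a b => exact contract_mulComulRight _ _ _

theorem inL_nablaConv_mul_coactNabla :
    convMap (inL k H) L.nablaConv * toConv L.coactNabla = toConv L.coactNabla := by
  rw [coactNabla_eq_left, ← mul_assoc, ← map_mul, nablaConv_mul_self]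

/-- A linear map on `H ⊗ H` applied to `c^[-1] ⊗ ∇(c^[0]) = (∇(c₁) ⊗ 1) Δ(∇(c₂))`. -/
theorem comp_coactNabla {A : Type*} [Ring A] [Algebra k A] (M : H ⊗[k] H →ₗ[k] A)
    (u v : H →ₗ[k] A) (hM : ∀ a b, M ((a ⊗ₜ 1) * comul b) = u a * v b) :
    toConv (M ∘ₗ L.coactNabla) =
      toConv (u ∘ₗ nabla L.coact) * toConv (v ∘ₗ nabla L.coact) := by
  have h := congrArg (fun T : WithConv (C →ₗ[k] H ⊗[k] H) => T.ofConv) L.coactNabla_eq_left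
  ext c
  refine (congrArg M (LinearMap.congr_fun h c)).trans ?_
  simp only [LinearMap.convMul_apply]
  generalize comul (R := k) c = t
  induction t with
  | zero => simp
  | add a b ha hb => simp only [map_add, ha, hb]
  | tmul a b => exact hM _ _

/-- `c^[-1] S(∇(c^[0])) = ∇(c)`. -/
theorem mulAntipode_coactNabla (c : C) :
    mulAntipode k H (L.coactNabla c) = nabla L.coact c := by
  have h := L.comp_coactNabla (mulAntipode k H) LinearMap.id
    (Algebra.linearMap k H ∘ₗ counit) (fun a b => by
      rw [mulAntipode_mul_comul]
      simp [Algebra.algebraMap_eq_smul_one])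
  have e : toConv ((Algebra.linearMap k H ∘ₗ counit) ∘ₗ nabla L.coact) = 1 := by
    ext c
    exact congrArg (algebraMap k H) (L.counit_nabla c)
  rw [e, mul_one] at h
  exact LinearMap.congr_fun (congrArg ofConv h) c

/-- `c^[-1]₁ ⊗ c^[-1]₂ S(∇(c^[0])) = c^[-1] ⊗ ∇(c^[0])`. This uses both expressions for the right
side, hence both coassociativity axioms of a partial coaction. -/
theorem comulMulAntipode_coactNabla (c : C) :
    comulMulAntipode k H (L.coactNabla c) = L.coactNabla c := by
  have h := L.comp_coactNabla (comulMulAntipode k H) (inΔ k H).toLinearMap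
    (inL k H).toLinearMap (fun a b => by
      rw [comulMulAntipode_mul_comul]
      simp [← Algebra.TensorProduct.one_def])
  exact LinearMap.congr_fun (congrArg ofConv (h.trans L.coactNabla_eq_right.symm)) c

/-- `c^[-1] S(∇(c^[0])₁) ⊗ ∇(c^[0])₂ = ∇(c₁) ⊗ ∇(c₂)`. -/
theorem mulAntipodeComul_coactNabla (c : C) :
    mulAntipodeComul k H (L.coactNabla c) =
      TensorProduct.map (nabla L.coact) (nabla L.coact) (comul c) := by
  have h := L.comp_coactNabla (mulAntipodeComul k H) (inL k H).toLinearMap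
    (inR k H).toLinearMap (fun a b => by
      rw [mulAntipodeComul_mul_comul, LinearMap.comp_apply, TensorProduct.map_tmul,
        antipodeComul_one]
      simp)
  exact (LinearMap.congr_fun (congrArg ofConv h) c).trans
    (includeLeft_mul_includeRight L.nablaConv L.nablaConv c)

theorem cosmashMk_surjective : Function.Surjective L.cosmashMk :=
  LinearMap.surjective_rangeRestrict _

/-- Linear maps out of the cosmash coproduct are determined on the elements `c >◂ h`. -/
theorem cosmash_ext {V : Type*} [AddCommGroup V] [Module k V] {f g : L.Cosmash →ₗ[k] V}
    (h : ∀ c h, f (L.cosmashMk (c ⊗ₜ h)) = g (L.cosmashMk (c ⊗ₜ h))) : f = g := by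
  have e : f ∘ₗ L.cosmashMk = g ∘ₗ L.cosmashMk := TensorProduct.ext' h
  ext y
  obtain ⟨t, rfl⟩ := L.cosmashMk_surjective y
  exact LinearMap.congr_fun e t

/-- Applying `ε` to the factor in `H` of the first component of
`(c₁ ⊗ c₂^[-1] h₁) ⊗ (c₂^[0] ⊗ h₂)` gives `c₁ ⊗ (c₂ ⊗ h)`. -/
theorem counit_cosmashComul (c : C) (h : H) :
    ((TensorProduct.rid k C).toLinearMap ∘ₗ counit.lTensor C).rTensor (C ⊗[k] H)
      (L.cosmashComul (c ⊗ₜ h)) = TensorProduct.assoc k C C H (comul c ⊗ₜ h) := by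
  have h1 : ∀ (t : C ⊗[k] C) (s : H ⊗[k] H),
      ((TensorProduct.rid k C).toLinearMap ∘ₗ counit.lTensor C).rTensor (C ⊗[k] H)
        (cosmashShuffle k H C (L.coact.lTensor C t ⊗ₜ s)) =
      TensorProduct.assoc k C C H (t ⊗ₜ TensorProduct.lid k H (counit.rTensor H s)) := by
    intro t s
    induction t with
    | zero => simp
    | add a b ha hb => simp only [map_add, ha, hb, TensorProduct.add_tmul]
    | tmul x y =>
      induction s with
      | zero => simp
      | add a b ha hb => simp only [map_add, ha, hb, TensorProduct.tmul_add]
      | tmul h g =>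
        have h1 := LinearMap.congr_fun L.counit_coact y
        simp only [LinearMap.comp_apply, LinearMap.id_apply] at h1
        conv_rhs => rw [← h1]
        simp only [LinearMap.lTensor_tmul]
        generalize L.coact y = r
        induction r with
        | zero => simp
        | add a b ha hb =>
          simp only [map_add, ha, hb, TensorProduct.tmul_add, TensorProduct.add_tmul]
        | tmul a z => simp [← TensorProduct.smul_tmul', smul_smul, mul_comm]
  refine (h1 (comul c) (comul h)).trans ?_
  rw [rTensor_counit_comul, TensorProduct.lid_tmul, one_smul]

/-- The cosmash comultiplication of `c ⊗ h`, followed by a map on the first component that factors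
through `id ⊗ ε`. -/
theorem map_cosmashComul_of_left {V W : Type*} [AddCommGroup V] [Module k V] [AddCommGroup W]
    [Module k W] (α : C ⊗[k] H →ₗ[k] V) (u : C →ₗ[k] V)
    (hα : ∀ c h, α (c ⊗ₜ h) = counit (R := k) h • u c) (β : C ⊗[k] H →ₗ[k] W) (c : C) (h : H) :
    TensorProduct.map α β (L.cosmashComul (c ⊗ₜ h)) =
      TensorProduct.map u β (TensorProduct.assoc k C C H (comul c ⊗ₜ h)) := by
  have e : α = u ∘ₗ (TensorProduct.rid k C).toLinearMap ∘ₗ counit.lTensor C :=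
    TensorProduct.ext' fun c h => by simp [hα]
  rw [← counit_cosmashComul, e, LinearMap.rTensor, TensorProduct.map_map, LinearMap.comp_id]

/-- `ω₀((c >◂ h)₁) ⊗ ω₀((c >◂ h)₂) = c^[-1] h₁ ⊗ ∇(c^[0]) h₂`. -/
theorem map_omega₀_cosmashComul (c : C) (h : H) :
    TensorProduct.map (L.omega₀ ∘ₗ L.cosmashMk) (L.omega₀ ∘ₗ L.cosmashMk)
      (L.cosmashComul (c ⊗ₜ h)) = L.coactNabla c * comul h := by
  have h1 : ∀ (t : C ⊗[k] C) (s : H ⊗[k] H),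
      TensorProduct.map (L.omega₀ ∘ₗ L.cosmashMk) (L.omega₀ ∘ₗ L.cosmashMk)
        (cosmashShuffle k H C (L.coact.lTensor C t ⊗ₜ s)) =
      LinearMap.mul' k _ (TensorProduct.map ((inL k H).toLinearMap ∘ₗ nabla L.coact)
        L.coactNabla t) * s := by
    intro t s
    induction t with
    | zero => simp
    | add a b ha hb => simp only [map_add, ha, hb, TensorProduct.add_tmul, add_mul]
    | tmul x y =>
      induction s with
      | zero => simp
      | add a b ha hb => simp only [map_add, ha, hb, TensorProduct.tmul_add, mul_add]
      | tmul h g =>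
        simp only [LinearMap.lTensor_tmul, TensorProduct.map_tmul, LinearMap.comp_apply]
        generalize L.coact y = r
        induction r with
        | zero => simp
        | add a b ha hb =>
          simp only [map_add, ha, hb, TensorProduct.tmul_add, TensorProduct.add_tmul, add_mul]
        | tmul a z => simp [omega₀_cosmashMk, mul_assoc]
  refine (h1 (comul c) (comul h)).trans ?_
  exact congrArg (· * comul (R := k) h)
    (LinearMap.congr_fun (congrArg ofConv L.inL_nablaConv_mul_coactNabla) c)

/-- `ω₀((c >◂ h)₁) S(ω₀((c >◂ h)₂)) = ε(h) ∇(c)`. -/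
theorem idemConv_omega₀ (c : C) (h : H) :
    (idemConv L.omega₀).ofConv (L.cosmashMk (c ⊗ₜ h)) = counit (R := k) h • nabla L.coact c := by
  have h1 : (idemConv L.omega₀).ofConv (L.cosmashMk (c ⊗ₜ h)) = mulAntipode k H
      (TensorProduct.map (L.omega₀ ∘ₗ L.cosmashMk) (L.omega₀ ∘ₗ L.cosmashMk)
        (L.cosmashComul (c ⊗ₜ h))) := by
    rw [LinearMap.convMul_apply, comul_cosmashMk]
    simp only [LinearMap.comp_apply, LinearMap.lTensor, TensorProduct.map_map]
    rfl
  rw [h1, map_omega₀_cosmashComul, mulAntipode_mul_comul, mulAntipode_coactNabla]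

/-- `ω₀((c >◂ h)₁) ⊗ ω₀((c >◂ h)₂) S(ω₀((c >◂ h)₃)) = c^[-1] h ⊗ ∇(c^[0])`. -/
theorem map_omega₀_idemConv (c : C) (h : H) :
    TensorProduct.map (L.omega₀ ∘ₗ L.cosmashMk) ((idemConv L.omega₀).ofConv ∘ₗ L.cosmashMk)
      (L.cosmashComul (c ⊗ₜ h)) = L.coactNabla c * (h ⊗ₜ 1) := by
  have h1 : ∀ (t : C ⊗[k] C) (s : H ⊗[k] H),
      TensorProduct.map (L.omega₀ ∘ₗ L.cosmashMk) ((idemConv L.omega₀).ofConv ∘ₗ L.cosmashMk)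
        (cosmashShuffle k H C (L.coact.lTensor C t ⊗ₜ s)) =
      LinearMap.mul' k _ (TensorProduct.map ((inL k H).toLinearMap ∘ₗ nabla L.coact)
        L.coactNabla t) * (TensorProduct.rid k H (counit.lTensor H s) ⊗ₜ 1) := by
    intro t s
    induction t with
    | zero => simp
    | add a b ha hb => simp only [map_add, ha, hb, TensorProduct.add_tmul, add_mul]
    | tmul x y =>
      induction s with
      | zero => simp
      | add a b ha hb =>
        simp only [map_add, ha, hb, TensorProduct.tmul_add, mul_add, TensorProduct.add_tmul]
      | tmul h g =>
        simp only [LinearMap.lTensor_tmul, TensorProduct.map_tmul, LinearMap.comp_apply]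
        generalize L.coact y = r
        induction r with
        | zero => simp
        | add a b ha hb =>
          simp only [map_add, ha, hb, TensorProduct.tmul_add, TensorProduct.add_tmul, add_mul]
        | tmul a z =>
          simp only [cosmashShuffle_tmul, TensorProduct.map_tmul, LinearMap.comp_apply,
            idemConv_omega₀, omega₀_cosmashMk]
          simp [mul_assoc, TensorProduct.smul_tmul]
  refine (h1 (comul c) (comul h)).trans ?_
  rw [lTensor_counit_comul, TensorProduct.rid_tmul, one_smul]
  exact congrArg (· * (h ⊗ₜ[k] (1 : H)))
    (LinearMap.congr_fun (congrArg ofConv L.inL_nablaConv_mul_coactNabla) c)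

/-- `ω₀` is a partial corepresentation, for every left partial coaction. -/
theorem isPartialCorep_omega₀ : IsPartialCorep L.omega₀ := by
  refine (isPartialCorep_iff _).2 ⟨?_, ?_, ?_⟩
  · refine L.cosmash_ext fun c h => ?_
    rw [counit_cosmashMk, LinearMap.comp_apply, omega₀_cosmashMk, Bialgebra.counit_mul,
      counit_nabla]
  · refine ofConv_injective (L.cosmash_ext fun c h => ?_)
    rw [includeLeft_mul_includeRight, comul_cosmashMk, TensorProduct.map_map]
    refine Eq.trans ?_ (L.map_omega₀_idemConv c h).symm
    have h1 : (convMap (inΔ k H) (toConv L.omega₀) *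
        convMap (inR k H) (antipodeConv L.omega₀)).ofConv (L.cosmashMk (c ⊗ₜ h)) =
        comulMulAntipode k H (TensorProduct.map (L.omega₀ ∘ₗ L.cosmashMk)
          (L.omega₀ ∘ₗ L.cosmashMk) (L.cosmashComul (c ⊗ₜ h))) := by
      rw [LinearMap.convMul_apply, comul_cosmashMk, LinearMap.comp_apply, TensorProduct.map_map,
        TensorProduct.map_map]
      rfl
    rw [h1, map_omega₀_cosmashComul, comulMulAntipode_mul_comul, comulMulAntipode_coactNabla]
  · refine ofConv_injective (L.cosmash_ext fun c h => ?_)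
    rw [includeLeft_mul_includeRight, comul_cosmashMk, TensorProduct.map_map]
    have h1 : (convMap (inL k H) (toConv L.omega₀) *
        toConv (antipodeComul k H ∘ₗ L.omega₀)).ofConv (L.cosmashMk (c ⊗ₜ h)) =
        mulAntipodeComul k H (TensorProduct.map (L.omega₀ ∘ₗ L.cosmashMk)
          (L.omega₀ ∘ₗ L.cosmashMk) (L.cosmashComul (c ⊗ₜ h))) := by
      rw [LinearMap.convMul_apply, comul_cosmashMk, LinearMap.comp_apply, TensorProduct.map_map,
        TensorProduct.map_map]
      rfl
    refine h1.trans ?_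
    rw [map_omega₀_cosmashComul, mulAntipodeComul_mul_comul, mulAntipodeComul_coactNabla,
      L.map_cosmashComul_of_left _ (nabla L.coact) (fun c h => L.idemConv_omega₀ c h)]
    generalize comul (R := k) c = t
    induction t with
    | zero => simp
    | add a b ha hb => simp only [map_add, ha, hb, TensorProduct.add_tmul, add_mul]
    | tmul a b =>
      simp [omega₀_cosmashMk]

/-- The linear map `c >◂ h ↦ ε(h) c`. -/
noncomputable def cosmashFst : L.Cosmash →ₗ[k] C :=
  (TensorProduct.rid k C).toLinearMap ∘ₗ counit.lTensor C ∘ₗ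
    (LinearMap.range L.cosmashProj).subtype

theorem cosmashFst_cosmashMk (c : C) (h : H) :
    L.cosmashFst (L.cosmashMk (c ⊗ₜ h)) = counit (R := k) h • c := by
  have h1 : ∀ t : C ⊗[k] C, TensorProduct.rid k C (counit.lTensor C
      ((LinearMap.mul' k H).lTensor C (TensorProduct.assoc k C H H
        ((nabla L.coact).lTensor C t ⊗ₜ h)))) =
      counit (R := k) h • TensorProduct.rid k C (counit.lTensor C t) := by
    intro t
    induction t with
    | zero => simp
    | add a b ha hb => simp only [map_add, ha, hb, TensorProduct.add_tmul, smul_add]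
    | tmul a b => simp [counit_nabla, smul_smul, mul_comm]
  refine (h1 (comul c)).trans ?_
  rw [lTensor_counit_comul, TensorProduct.rid_tmul, one_smul]

/-- The coalgebra morphism `c >◂ h ↦ ε(h) c`. -/
noncomputable def cosmashFstHom : L.Cosmash →ₗc[k] C where
  toLinearMap := L.cosmashFst
  counit_comp := L.cosmash_ext fun c h => by
    rw [LinearMap.comp_apply, cosmashFst_cosmashMk, counit_cosmashMk, map_smul, smul_eq_mul,
      mul_comm]
  map_comp_comul := L.cosmash_ext fun c h => by
    rw [LinearMap.comp_apply, LinearMap.comp_apply, comul_cosmashMk, TensorProduct.map_map,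
      L.map_cosmashComul_of_left _ LinearMap.id (fun c h => L.cosmashFst_cosmashMk c h),
      cosmashFst_cosmashMk, map_smul]
    generalize comul (R := k) c = t
    induction t with
    | zero => simp
    | add a b ha hb => simp only [map_add, ha, hb, TensorProduct.add_tmul, smul_add]
    | tmul a b => simp [cosmashFst_cosmashMk]

/-- Every element `y` of the cosmash coproduct is `π(y₁) >◂ ω₀(y₂)`, where `π(c >◂ h) = ε(h) c`. -/
theorem cosmashMk_map_fst_omega₀ (y : L.Cosmash) :
    L.cosmashMk (TensorProduct.map L.cosmashFst L.omega₀ (comul y)) = y := by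
  suffices h : L.cosmashMk ∘ₗ TensorProduct.map L.cosmashFst L.omega₀ ∘ₗ comul = LinearMap.id from
    LinearMap.congr_fun h y
  refine L.cosmash_ext fun c h => ?_
  have h1 : ∀ t : C ⊗[k] C, TensorProduct.map LinearMap.id (L.omega₀ ∘ₗ L.cosmashMk)
      (TensorProduct.assoc k C C H (t ⊗ₜ h)) =
      (LinearMap.mul' k H).lTensor C (TensorProduct.assoc k C H H
        ((nabla L.coact).lTensor C t ⊗ₜ h)) := by
    intro t
    induction t with
    | zero => simp
    | add a b ha hb => simp only [map_add, ha, hb, TensorProduct.add_tmul]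
    | tmul a b => simp [omega₀_cosmashMk]
  rw [LinearMap.comp_apply, LinearMap.comp_apply, comul_cosmashMk, TensorProduct.map_map,
    L.map_cosmashComul_of_left _ LinearMap.id (fun c h => L.cosmashFst_cosmashMk c h), h1]
  exact L.cosmash_isLeftCounital.rangeRestrict_proj (c ⊗ₜ h)

end LeftPartialCoaction

/-! ### The isomorphism between `H^par` and the cosmash coproduct -/

/-- Tensors in `(N ⊗ M') ⊗ M` are separated by contracting `N` with a separating set of
functionals. -/
theorem Separating.tensor_left_left {k M M' N : Type*} [Field k] [AddCommGroup M] [Module k M]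
    [AddCommGroup M'] [Module k M'] [AddCommGroup N] [Module k N]
    {F : Set (N →ₗ[k] k)} (hF : Separating F) {t s : (N ⊗[k] M') ⊗[k] M}
    (h : ∀ f ∈ F,
      ((TensorProduct.lid k M').toLinearMap ∘ₗ f.rTensor M').rTensor M t =
      ((TensorProduct.lid k M').toLinearMap ∘ₗ f.rTensor M').rTensor M s) : t = s := by
  apply (TensorProduct.assoc k N M' M).injective
  refine hF.tensor_left fun f hf => ?_
  have e : ∀ r : (N ⊗[k] M') ⊗[k] M, TensorProduct.lid k (M' ⊗[k] M)
      (f.rTensor (M' ⊗[k] M) (TensorProduct.assoc k N M' M r)) =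
      ((TensorProduct.lid k M').toLinearMap ∘ₗ f.rTensor M').rTensor M r := by
    intro r
    induction r with
    | zero => simp
    | add x y hx hy => simp only [map_add, hx, hy]
    | tmul x y =>
      induction x with
      | zero => simp
      | add a b ha hb => simp only [map_add, ha, hb, TensorProduct.add_tmul]
      | tmul a b => simp [TensorProduct.smul_tmul']
  rw [e, e, h f hf]

/-- Tensors in `(N ⊗ M) ⊗ (N ⊗ M)` are separated by contracting both copies of `N` with
functionals from a separating set. -/
theorem Separating.tensor_left_map {k M N : Type*} [Field k] [AddCommGroup M] [Module k M]
    [AddCommGroup N] [Module k N] {F : Set (N →ₗ[k] k)} (hF : Separating F)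
    {t s : (N ⊗[k] M) ⊗[k] (N ⊗[k] M)}
    (h : ∀ f ∈ F, ∀ g ∈ F, TensorProduct.map
        ((TensorProduct.lid k M).toLinearMap ∘ₗ f.rTensor M)
        ((TensorProduct.lid k M).toLinearMap ∘ₗ g.rTensor M) t =
      TensorProduct.map ((TensorProduct.lid k M).toLinearMap ∘ₗ f.rTensor M)
        ((TensorProduct.lid k M).toLinearMap ∘ₗ g.rTensor M) s) : t = s := by
  refine hF.tensor_left_left fun f hf => (TensorProduct.comm k _ _).injective ?_
  refine hF.tensor_left_left fun g hg => (TensorProduct.comm k _ _).injective ?_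
  simpa only [LinearMap.rTensor, ← TensorProduct.map_comm, TensorProduct.map_map,
    LinearMap.id_comp, LinearMap.comp_id, TensorProduct.comm_comm] using h f hf g hg

namespace Hpar

variable {k H : Type*} [Field k] [Ring H] [HopfAlgebra k H]

/-- Both sides compute `b(Ē(x₁)) p(x₂) b'(Ē(x₃)) ⊗ p(x₄)`. -/
theorem pullScalar_mul_conj_mul (b : WithConv (Base k H →ₗ[k] k))
    {b' : WithConv (Base k H →ₗ[k] k)} (hb' : b' ∈ baseFunctionals k H) :
    pullScalar (H ⊗[k] H) b * convMap (inL k H) (conjConv b') *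
        convMap (inΔ k H) (projConv k H) =
      convMap (inL k H) (pullScalar H b * projConv k H) *
        convMap (inR k H) (pullScalar H b' * projConv k H) := by
  have hω := isPartialCorep_proj (k := k) (H := H)
  have h1 := hω.inL_antipode_mul_inΔ
  have h2 := congrArg (convMap (inL k H)) (proj_mul (k := k) (H := H))
  have h3 := congrArg (convMap (inL k H)) hb'.1.eq
  simp only [conjConv, map_mul, pullScalar, convMap_convScalar] at h1 h2 h3 ⊢
  generalize convScalar (H ⊗[k] H) (convComap (Ebar k H) b) = β at *
  generalize convScalar (H ⊗[k] H) (convComap (Ebar k H) b') = β' at *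
  generalize convMap (inL k H) (projConv k H) = p₁ at *
  generalize convMap (inR k H) (projConv k H) = p₂ at *
  generalize convMap (inΔ k H) (projConv k H) = p at *
  generalize convMap (inL k H) (projAntipode k H) = q₁ at *
  calc β * (p₁ * β' * q₁) * p = β * p₁ * β' * (q₁ * p) := by simp only [mul_assoc]
    _ = β * p₁ * (β' * (q₁ * p₁)) * p₂ := by rw [h1]; simp only [mul_assoc]
    _ = β * (p₁ * (q₁ * p₁)) * β' * p₂ := by rw [h3]; simp only [mul_assoc]
    _ = _ := by rw [h2]; simp only [mul_assoc]

section Iso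

variable {L : LeftPartialCoaction k H (Base k H)}
  (hL : ∀ x : Hpar k H, L.coact (Ebar k H x) = coactionFormula k H x)

variable (L) in
/-- The linear map `x ↦ Ē(x₁) >◂ p(x₂)`. -/
noncomputable def toCosmash : Hpar k H →ₗ[k] L.Cosmash :=
  L.cosmashMk ∘ₗ TensorProduct.map (Ebar k H : Hpar k H →ₗ[k] Base k H) (proj k H) ∘ₗ comul

theorem counit_toCosmash (x : Hpar k H) : counit (R := k) (toCosmash L x) = counit (R := k) x := by
  have h1 : ∀ t : Hpar k H ⊗[k] Hpar k H, counit (R := k) (L.cosmashMk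
      (TensorProduct.map (Ebar k H : Hpar k H →ₗ[k] Base k H) (proj k H) t)) =
      LinearMap.mul' k k (TensorProduct.map counit counit t) := by
    intro t
    induction t with
    | zero => simp
    | add a b ha hb => simp only [map_add, ha, hb]
    | tmul x y =>
      rw [TensorProduct.map_tmul, LeftPartialCoaction.counit_cosmashMk]
      exact congrArg₂ (· * ·) (LinearMap.congr_fun (Ebar k H).counit_comp x)
        (LinearMap.congr_fun (isPartialCorep_proj (k := k) (H := H)).counit_comp y)
  refine (h1 (comul x)).trans ?_
  exact LinearMap.congr_fun (congrArg ofConv (mul_one (1 : WithConv (Hpar k H →ₗ[k] k)))) x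

include hL

/-- The contraction of `Δ(Ē(x) >◂ h)` with functionals on the legs in the base coalgebra. -/
theorem contract_cosmashComul (b b' : Base k H →ₗ[k] k) (x : Hpar k H) (h : H) :
    TensorProduct.map ((TensorProduct.lid k H).toLinearMap ∘ₗ b.rTensor H)
        ((TensorProduct.lid k H).toLinearMap ∘ₗ b'.rTensor H)
        (L.cosmashComul (Ebar k H x ⊗ₜ h)) =
      (pullScalar (H ⊗[k] H) (toConv b) * convMap (inL k H) (conjConv (toConv b'))).ofConv x *
        comul h := by
  have h1 : ∀ (t : Hpar k H ⊗[k] Hpar k H) (s : H ⊗[k] H),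
      TensorProduct.map ((TensorProduct.lid k H).toLinearMap ∘ₗ b.rTensor H)
        ((TensorProduct.lid k H).toLinearMap ∘ₗ b'.rTensor H)
        (cosmashShuffle k H (Base k H) (L.coact.lTensor (Base k H)
          (TensorProduct.map (Ebar k H : Hpar k H →ₗ[k] Base k H)
            (Ebar k H : Hpar k H →ₗ[k] Base k H) t) ⊗ₜ s)) =
      LinearMap.mul' k _ (TensorProduct.map (pullScalar (H ⊗[k] H) (toConv b)).ofConv
        (convMap (inL k H) (conjConv (toConv b'))).ofConv t) * s := by
    intro t s
    rw [← contract_coact hL]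
    induction t with
    | zero => simp
    | add a b ha hb => simp only [map_add, ha, hb, TensorProduct.add_tmul, add_mul]
    | tmul x y =>
      induction s with
      | zero => simp
      | add a b ha hb => simp only [map_add, ha, hb, TensorProduct.tmul_add, mul_add]
      | tmul h g =>
        change TensorProduct.map _ _ (cosmashShuffle k H (Base k H)
          ((Ebar k H x ⊗ₜ L.coact (Ebar k H y)) ⊗ₜ (h ⊗ₜ g))) =
          algebraMap k (H ⊗[k] H) (b (Ebar k H x)) *
            (TensorProduct.rid k H (b'.lTensor H (L.coact (Ebar k H y))) ⊗ₜ 1) * (h ⊗ₜ g)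
        generalize L.coact (Ebar k H y) = r
        induction r with
        | zero => simp
        | add a b ha hb =>
          simp only [map_add, ha, hb, TensorProduct.tmul_add, TensorProduct.add_tmul, mul_add,
            add_mul]
        | tmul a z => simp [Algebra.algebraMap_eq_smul_one, TensorProduct.smul_tmul', smul_smul,
            mul_comm]
  refine Eq.trans ?_ (h1 (comul x) (comul h))
  rw [← comul_Ebar]
  rfl

/-- The cosmash comultiplication of `Ē(x₁) ⊗ p(x₂)` is
`(Ē(x₁) ⊗ p(x₂)) ⊗ (Ē(x₃) ⊗ p(x₄))`. -/
theorem cosmashComul_Ebar_proj (x : Hpar k H) :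
    L.cosmashComul (TensorProduct.map (Ebar k H : Hpar k H →ₗ[k] Base k H) (proj k H) (comul x)) =
      TensorProduct.map
        (TensorProduct.map (Ebar k H : Hpar k H →ₗ[k] Base k H) (proj k H) ∘ₗ comul)
        (TensorProduct.map (Ebar k H : Hpar k H →ₗ[k] Base k H) (proj k H) ∘ₗ comul)
        (comul x) := by
  refine separating_baseFunctionals.tensor_left_map fun b _ b' hb' => ?_
  have h1 : ∀ t : Hpar k H ⊗[k] Hpar k H,
      TensorProduct.map ((TensorProduct.lid k H).toLinearMap ∘ₗ b.rTensor H)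
        ((TensorProduct.lid k H).toLinearMap ∘ₗ b'.rTensor H) (L.cosmashComul
          (TensorProduct.map (Ebar k H : Hpar k H →ₗ[k] Base k H) (proj k H) t)) =
      LinearMap.mul' k _ (TensorProduct.map
        (pullScalar (H ⊗[k] H) (toConv b) * convMap (inL k H) (conjConv (toConv b'))).ofConv
        (convMap (inΔ k H) (projConv k H)).ofConv t) := by
    intro t
    induction t with
    | zero => simp only [map_zero]
    | add a b ha hb => simp only [map_add, ha, hb]
    | tmul x y => exact contract_cosmashComul hL b b' x _
  have h2 : ∀ f : Base k H →ₗ[k] k, ((TensorProduct.lid k H).toLinearMap ∘ₗ f.rTensor H) ∘ₗ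
      TensorProduct.map (Ebar k H : Hpar k H →ₗ[k] Base k H) (proj k H) ∘ₗ comul =
      (pullScalar H (toConv f) * projConv k H).ofConv := by
    intro f
    ext x
    simp only [LinearMap.convMul_apply, LinearMap.comp_apply]
    generalize comul (R := k) x = t
    induction t with
    | zero => simp
    | add a b ha hb => simp only [map_add, ha, hb]
    | tmul x y => simp [Algebra.ofId_apply, Algebra.algebraMap_eq_smul_one]
  rw [h1, TensorProduct.map_map, h2, h2]
  exact (LinearMap.congr_fun (congrArg ofConv (pullScalar_mul_conj_mul (toConv b) hb')) x).trans
    (includeLeft_mul_includeRight _ _ x)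

theorem map_toCosmash_comul (x : Hpar k H) :
    TensorProduct.map (toCosmash L) (toCosmash L) (comul x) =
      comul (R := k) (toCosmash L x) := by
  refine Eq.trans ?_ (L.comul_cosmashMk _).symm
  rw [LinearMap.comp_apply, cosmashComul_Ebar_proj hL, TensorProduct.map_map]
  rfl

/-- `x ↦ Ē(x₁) >◂ p(x₂)` as a coalgebra morphism. -/
noncomputable def toCosmashHom : Hpar k H →ₗc[k] L.Cosmash where
  toLinearMap := toCosmash L
  counit_comp := LinearMap.ext counit_toCosmash
  map_comp_comul := LinearMap.ext (map_toCosmash_comul hL)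

theorem lift_toCosmash (x : Hpar k H) :
    lift L.omega₀ L.isPartialCorep_omega₀ (toCosmash L x) = x := by
  refine congrArg (fun F : Hpar k H →ₗc[k] Hpar k H => F x)
    (hom_ext ((lift L.omega₀ L.isPartialCorep_omega₀).comp (toCosmashHom hL))
      (CoalgHom.id k _) fun x => ?_)
  refine (proj_lift L.omega₀ L.isPartialCorep_omega₀ (toCosmash L x)).trans ?_
  have h1 : ∀ t : Hpar k H ⊗[k] Hpar k H, L.omega₀ (L.cosmashMk
      (TensorProduct.map (Ebar k H : Hpar k H →ₗ[k] Base k H) (proj k H) t)) =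
      LinearMap.mul' k H (TensorProduct.map (projConv k H * projAntipode k H).ofConv
        (projConv k H).ofConv t) := by
    intro t
    rw [← convComap_nabla hL]
    induction t with
    | zero => simp
    | add a b ha hb => simp only [map_add, ha, hb]
    | tmul x y => exact L.omega₀_cosmashMk _ _
  refine (h1 (comul x)).trans ?_
  exact LinearMap.congr_fun (congrArg ofConv
    (isPartialCorep_proj (k := k) (H := H)).idem_mul_self) x

/-- `Ē ∘ ω̄₀` is the morphism `c >◂ h ↦ ε(h) c`: both lift `c >◂ h ↦ ε(h) ∇(c)` to the cofree
coalgebra. -/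
theorem Ebar_lift (y : L.Cosmash) :
    Ebar k H (lift L.omega₀ L.isPartialCorep_omega₀ y) = L.cosmashFst y := by
  have h := CofreeCoalgebra.hom_ext
    ((EbarCofree k H).comp (lift L.omega₀ L.isPartialCorep_omega₀))
    ((Subcoalgebra.range (EbarCofree k H)).incl.comp L.cosmashFstHom) fun y => ?_
  · exact Subtype.ext (congrArg (fun F : L.Cosmash →ₗc[k] CofreeCoalgebra k H => F y) h)
  · have h1 : convComap (lift L.omega₀ L.isPartialCorep_omega₀) (toConv (E k H)) =
        idemConv L.omega₀ := by
      have e : toConv (E k H) = projConv k H * projAntipode k H := rfl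
      have e' : convComap (lift L.omega₀ L.isPartialCorep_omega₀) (projConv k H) =
          toConv L.omega₀ :=
        WithConv.ext (LinearMap.ext (proj_lift L.omega₀ L.isPartialCorep_omega₀))
      rw [e, map_mul, e']
      refine congrArg (toConv L.omega₀ * ·) (WithConv.ext (LinearMap.ext fun y => ?_))
      exact congrArg (HopfAlgebra.antipode k) (LinearMap.congr_fun (congrArg ofConv e') y)
    have h2 : (idemConv L.omega₀).ofConv = nabla L.coact ∘ₗ L.cosmashFst :=
      L.cosmash_ext fun c h => by
        rw [L.idemConv_omega₀, LinearMap.comp_apply, L.cosmashFst_cosmashMk, map_smul]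
    refine (CofreeCoalgebra.proj_lift (E k H) _).trans ?_
    refine (LinearMap.congr_fun (congrArg ofConv h1) y).trans ?_
    rw [h2, nabla_eq_baseProj hL]
    rfl

theorem toCosmash_lift (y : L.Cosmash) :
    toCosmash L (lift L.omega₀ L.isPartialCorep_omega₀ y) = y := by
  refine Eq.trans ?_ (L.cosmashMk_map_fst_omega₀ y)
  refine congrArg L.cosmashMk ?_
  have h1 := LinearMap.congr_fun (lift L.omega₀ L.isPartialCorep_omega₀).map_comp_comul y
  refine (congrArg (TensorProduct.map (Ebar k H : Hpar k H →ₗ[k] Base k H) (proj k H))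
    h1.symm).trans ?_
  rw [LinearMap.comp_apply, TensorProduct.map_map]
  exact congrArg₂ (fun f g => TensorProduct.map f g (comul y))
    (LinearMap.ext (Ebar_lift hL)) (LinearMap.ext (proj_lift _ _))

/-- The isomorphism `x ↦ Ē(x₁) >◂ p(x₂)` of coalgebras, with inverse `ω̄₀`. -/
noncomputable def cosmashEquiv : Hpar k H ≃ₗc[k] L.Cosmash where
  toCoalgHom := toCosmashHom hL
  invFun := lift L.omega₀ L.isPartialCorep_omega₀
  left_inv := lift_toCosmash hL
  right_inv := toCosmash_lift hL

end Iso

end Hpar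

end HopfPar

open HopfPar
theorem mainTheorem3 {k : Type*} {H : Type*} [Field k] [Ring H] [HopfAlgebra k H]
    (hS : Function.Bijective (HopfAlgebra.antipode k (A := H))) :
    ∃ L : LeftPartialCoaction k H (Hpar.Base k H),
      (∀ x : Hpar k H, L.coact (Hpar.Ebar k H x) = Hpar.coactionFormula k H x) ∧
      ∃ (hω : IsPartialCorep L.omega₀) (Φ : Hpar k H ≃ₗc[k] L.Cosmash),
        (∀ x : Hpar k H, Φ x = L.cosmashMk
          (TensorProduct.map (Hpar.Ebar k H : Hpar k H →ₗ[k] Hpar.Base k H) (Hpar.proj k H)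
            (comul x))) ∧
        (Φ.symm : L.Cosmash →ₗc[k] Hpar k H) = Hpar.lift L.omega₀ hω := by
  refine ⟨Hpar.baseCoaction k H, Hpar.baseCoaction_coact_Ebar,
    LeftPartialCoaction.isPartialCorep_omega₀ _,
    Hpar.cosmashEquiv Hpar.baseCoaction_coact_Ebar, fun x => rfl, ?_⟩
  ext y
  rfl
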